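/- Let $\Omega=\mathbb{R}^2/\Lambda$ be a flat torus (doubly periodic domain), where $\Lambda$ is the lattice spanned by two linearly independent vectors, let $|\Omega|$ be its area, let $3\le N\le 5$ and $\lambda>0$. For $i=1,\dots,N$ let $n_i\ge 0$ be integers, not all zero, and let $p_{i1},\dots,p_{in_i}\in\Omega$ be points, repeated according to multiplicity. Let $K$ be the $N\times N$ Cartan matrix of $SU(N+1)$ ($K_{ii}=2$, $K_{ij}=-1$ if $|i-j|=1$, $K_{ij}=0$ otherwise) and put $$A=K^{-1}=(a_{jk}),\qquad r_j=\sum_{k=1}^N a_{jk},\qquad R=\mathrm{diag}\{r_1,\dots,r_N\},\qquad M=RKR,\qquad b_j=4\pi\sum_{k=1}^N a_{jk}n_k ,\qquad \mathbf b=(b_1,\dots,b_N)^\tau .$$ Let $u_i^0\in L^1(\Omega)$ be the solution, in the sense of distributions on $\Omega$, of $$\Delta u_i^0=4\pi\sum_{s=1}^{n_i}\delta_{p_{is}}-\frac{4\pi n_i}{|\Omega|},\qquad \int_\Omega u_i^0\,dx=0 .$$ On the Hilbert space $(W^{1,2}(\Omega))^N$ with norm $\|\mathbf w\|^2=\sum_{i=1}^N\int_\Omega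 (w_i^2+|\nabla w_i|^2)\,dx$ consider the functional $$I(\mathbf v)=\frac12\sum_{i=1}^2\int_\Omega \partial_i\mathbf v^\tau A\,\partial_i\mathbf v\,dx+\frac\lambda2\int_\Omega(\mathbf U-\mathbf 1)^\tau M(\mathbf U-\mathbf 1)\,dx+\frac1{|\Omega|}\int_\Omega \mathbf b^\tau\mathbf v\,dx,$$ where $\mathbf U=(e^{u_1^0+v_1},\dots,e^{u_N^0+v_N})^\tau$ and $\mathbf 1=(1,\dots,1)^\tau$. Let $I'(\mathbf v)$ denote its Fréchet derivative and $\|\cdot\|_*$ the norm of the dual space of $(W^{1,2}(\Omega))^N$. Then $I$ satisfies the Palais–Smale condition: if $(\mathbf v_m)_{m\in\mathbb N}$ is a sequence in $(W^{1,2}(\Omega))^N$ such that $I(\mathbf v_m)\to a_0$ for some constant $a_0\in\mathbb R$ and $\|I'(\mathbf v_m)\|_*\to 0$ as $m\to\infty$, then $(\mathbf v_m)$ has a subsequence that converges strongly in $(W^{1,2}(\Omega))^N$. -/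

import Mathlib

open MeasureTheory Filter Topology Matrix
open scoped ContDiff InnerProductSpace Laplacian

noncomputable section

namespace ChernSimons

/-- The Euclidean plane. -/
abbrev Plane : Type := EuclideanSpace ℝ (Fin 2)

/-- The doubly periodic domain, represented by the half-open period cell of the lattice spanned
by `e 0` and `e 1`. -/
abbrev cell (e : Module.Basis (Fin 2) ℝ Plane) : Set Plane := ZSpan.fundamentalDomain e

/-- Lebesgue measure on the period cell. -/
abbrev cellMeasure (e : Module.Basis (Fin 2) ℝ Plane) : Measure Plane :=
  volume.restrict (cell e)

/-- The area of the period cell. -/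
def area (e : Module.Basis (Fin 2) ℝ Plane) : ℝ := volume.real (cell e)

/-- Test functions on the flat torus: smooth doubly periodic functions on the plane. -/
structure IsTest (e : Module.Basis (Fin 2) ℝ Plane) (φ : Plane → ℝ) : Prop where
  smooth : ContDiff ℝ ∞ φ
  periodic : ∀ (k : Fin 2) (x : Plane), φ (x + e k) = φ x

/-- The `i`-th classical partial derivative. -/
def partialDeriv (i : Fin 2) (φ : Plane → ℝ) (x : Plane) : ℝ :=
  fderiv ℝ φ x (EuclideanSpace.single i 1)

/-- `g` is the `i`-th weak derivative of `f` on the flat torus. -/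
def IsWeakPartial (e : Module.Basis (Fin 2) ℝ Plane) (i : Fin 2) (f g : Plane → ℝ) : Prop :=
  ∀ φ : Plane → ℝ, IsTest e φ →
    ∫ x in cell e, f x * partialDeriv i φ x = -(∫ x in cell e, g x * φ x)

instance cellMeasure_finite (e : Module.Basis (Fin 2) ℝ Plane) :
    IsFiniteMeasure (cellMeasure e) :=
  ⟨by
    rw [Measure.restrict_apply_univ]
    exact (ZSpan.fundamentalDomain_isBounded e).measure_lt_top⟩

theorem integrable_mul_continuous (e : Module.Basis (Fin 2) ℝ Plane)
    (f : Lp ℝ 2 (cellMeasure e)) {ψ : Plane → ℝ} (hψ : Continuous ψ) :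
    Integrable (fun x => f x * ψ x) (cellMeasure e) := by
  have hf : Integrable (f : Plane → ℝ) (cellMeasure e) :=
    (Lp.memLp f).integrable (by norm_num)
  obtain ⟨C, hC⟩ := (ZSpan.fundamentalDomain_isBounded e).isCompact_closure.exists_bound_of_continuousOn
    hψ.continuousOn
  refine hf.mul_bdd (c := C) hψ.aestronglyMeasurable ?_
  filter_upwards [ae_restrict_mem (ZSpan.fundamentalDomain_measurableSet e)] with x hx
  exact hC x (subset_closure hx)

theorem IsTest.continuous_partialDeriv {e : Module.Basis (Fin 2) ℝ Plane} {φ : Plane → ℝ}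
    (h : IsTest e φ) (i : Fin 2) : Continuous (partialDeriv i φ) :=
  (h.smooth.continuous_fderiv (by simp)).clm_apply continuous_const

theorem integral_add_mul (e : Module.Basis (Fin 2) ℝ Plane) (u v : Lp ℝ 2 (cellMeasure e))
    {ψ : Plane → ℝ} (hψ : Continuous ψ) :
    ∫ x in cell e, (u + v) x * ψ x
      = (∫ x in cell e, u x * ψ x) + (∫ x in cell e, v x * ψ x) := by
  rw [← integral_add (integrable_mul_continuous e u hψ) (integrable_mul_continuous e v hψ)]
  refine integral_congr_ae ?_
  filter_upwards [Lp.coeFn_add u v] with x hx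
  rw [hx, Pi.add_apply, add_mul]

theorem integral_smul_mul (e : Module.Basis (Fin 2) ℝ Plane) (c : ℝ) (u : Lp ℝ 2 (cellMeasure e))
    (ψ : Plane → ℝ) :
    ∫ x in cell e, (c • u) x * ψ x = c * ∫ x in cell e, u x * ψ x := by
  rw [← integral_const_mul]
  refine integral_congr_ae ?_
  filter_upwards [Lp.coeFn_smul c u] with x hx
  rw [hx, Pi.smul_apply, smul_eq_mul, mul_assoc]

/-- The Sobolev space `W^{1,2}` of the flat torus. An element is an `L²` function together with its
(unique) weak gradient, so that the norm inherited from the ambient `ℓ²` product is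
`‖f‖² = ‖f‖_{L²}² + ‖∂₁f‖_{L²}² + ‖∂₂f‖_{L²}²`. -/
def W12 (e : Module.Basis (Fin 2) ℝ Plane) :
    Submodule ℝ (WithLp 2 (Lp ℝ 2 (cellMeasure e) ×
      PiLp 2 (fun _ : Fin 2 => Lp ℝ 2 (cellMeasure e)))) where
  carrier := {f | ∀ i, IsWeakPartial e i f.fst (f.snd i)}
  zero_mem' := by
    intro i φ _
    have h := integral_smul_mul e 0 0 (partialDeriv i φ)
    have h' := integral_smul_mul e 0 0 φ
    rw [zero_smul, zero_mul] at h h'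
    exact h.trans (by rw [← neg_zero]; exact congrArg Neg.neg h'.symm)
  add_mem' := by
    intro f g hf hg i φ hφ
    refine (integral_add_mul e f.fst g.fst (hφ.continuous_partialDeriv i)).trans ?_
    rw [hf i φ hφ, hg i φ hφ, ← neg_add]
    exact congrArg Neg.neg
      (integral_add_mul e (f.snd i) (g.snd i) hφ.smooth.continuous).symm
  smul_mem' := by
    intro c f hf i φ hφ
    refine (integral_smul_mul e c f.fst (partialDeriv i φ)).trans ?_
    rw [hf i φ hφ, mul_neg]
    exact congrArg Neg.neg (integral_smul_mul e c (f.snd i) φ).symm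

/-- The underlying `L²` function of a Sobolev function. -/
abbrev W12.toFun {e : Module.Basis (Fin 2) ℝ Plane} (f : W12 e) : Plane → ℝ := f.1.fst

/-- The weak derivative `∂ᵢ f` of a Sobolev function. -/
abbrev W12.grad {e : Module.Basis (Fin 2) ℝ Plane} (f : W12 e) (i : Fin 2) : Plane → ℝ :=
  f.1.snd i

/-- The product space `(W^{1,2})^N` with `‖w‖² = ∑ⱼ ‖wⱼ‖²`. -/
abbrev W12N (e : Module.Basis (Fin 2) ℝ Plane) (N : ℕ) : Type :=
  PiLp 2 (fun _ : Fin N => W12 e)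

/-- `u` is the background function with vortex points `p 0, …, p (n - 1)` (listed with
multiplicity; points of the torus are given by representatives in the plane): the mean-zero
integrable distributional solution on the torus of `Δ u = 4π ∑ₛ δ_{p s} - 4π n / |Ω|`. -/
structure IsBackground (e : Module.Basis (Fin 2) ℝ Plane) {n : ℕ} (p : Fin n → Plane)
    (u : Plane → ℝ) : Prop where
  integrable : IntegrableOn u (cell e)
  mean_zero : ∫ x in cell e, u x = 0
  equation : ∀ φ : Plane → ℝ, IsTest e φ →
    ∫ x in cell e, u x * (Δ φ) x
      = 4 * Real.pi * (∑ s, φ (p s)) - 4 * Real.pi * n / area e * (∫ x in cell e, φ x)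

/-- The Cartan matrix `K` of `SU(N+1)`, with real entries. -/
def K (N : ℕ) : Matrix (Fin N) (Fin N) ℝ := (CartanMatrix.A N).map (Int.cast : ℤ → ℝ)

/-- `A = K⁻¹`. -/
def A (N : ℕ) : Matrix (Fin N) (Fin N) ℝ := (K N)⁻¹

/-- `r_j = ∑ₖ a_{jk}`. -/
def r (N : ℕ) (j : Fin N) : ℝ := ∑ k, A N j k

/-- `M = R K R` with `R = diag (r_1, …, r_N)`. -/
def M (N : ℕ) : Matrix (Fin N) (Fin N) ℝ := diagonal (r N) * K N * diagonal (r N)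

/-- `b_j = 4π ∑ₖ a_{jk} n_k`. -/
def bvec {N : ℕ} (n : Fin N → ℕ) (j : Fin N) : ℝ := 4 * Real.pi * ∑ k, A N j k * n k

/-- The action functional
`I(v) = ½ ∑ᵢ ∫ ∂ᵢvᵀ A ∂ᵢv + (λ/2) ∫ (U - 1)ᵀ M (U - 1) + |Ω|⁻¹ ∫ bᵀ v`, where
`U_j = exp (u⁰_j + v_j)`. -/
def action (e : Module.Basis (Fin 2) ℝ Plane) {N : ℕ} (lam : ℝ) (n : Fin N → ℕ)
    (u₀ : Fin N → Plane → ℝ) (v : W12N e N) : ℝ :=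
  1 / 2 * (∑ i : Fin 2, ∫ x in cell e,
      (fun j => W12.grad (v j) i x) ⬝ᵥ A N *ᵥ (fun j => W12.grad (v j) i x))
    + lam / 2 * (∫ x in cell e,
      (fun j => Real.exp (u₀ j x + W12.toFun (v j) x) - 1) ⬝ᵥ
        M N *ᵥ (fun j => Real.exp (u₀ j x + W12.toFun (v j) x) - 1))
    + 1 / area e * (∫ x in cell e, bvec n ⬝ᵥ (fun j => W12.toFun (v j) x))

end ChernSimons

end

/-! Put ξ_j = log r_j + u_j^0 + v_j and a_j = exp ξ_j. Since K r = 1, the potential term of the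
differential is the pairing with λ a_j((Ka)_j - 1), the force. The difficulty is that the force is
quadratic in a, while the obvious test, the constant tuple (1,...,1), bounds a in L² only
(`exists_integral_weight_sq_le`); the heart of the proof is to raise this integrability.

Let ψ(x) be the minimiser of ½ψᵀKψ - ξ(x)ᵀψ over the positive cone, a vector-valued substitute for
the positive part of ξ that is adapted to K. The test direction is Kψ. Since AK = 1, the gradient
term becomes ∑∫∇v_j·∇ψ_j with v = ξ - u⁰ up to constants. Monotonicity of ξ ↦ ψ gives ∑∇ξ_j·∇ψ_j ≥
∇ψᵀK∇ψ; the part with u⁰ is estimated by Δu_j^0 ≥ -4πn_j/|Ω| and ψ ≥ 0, and the loss cancels against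
the term with b. The force pairs with Kψ to at least -C(1+|a|²), with no logarithm lost
(`IsCompl.pairing_lower_bound`). So ψ is bounded in W^{1,2} along almost critical points
(`exists_norm_compl_le`). Since ξ ≤ 2ψ, the Moser–Trudinger inequality bounds a in L⁴, hence the
force in L².

The rest is standard. Testing with the mean-free part of v bounds that part. The inequality exp t ≥
1 + t bounds the means above; the lower bound on the action together with b_j > 0 bounds them below
(`exists_norm_le`). Rellich's theorem gives a subsequence that is Cauchy in L², and coercivity of A
with the L² bound on the forces makes the gradients Cauchy too (`norm_sub_sq_le`).

The analysis on the torus rests on Fourier series. Fejér sums are smooth, converge in L², commute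
with weak derivatives, and preserve the lower bound on Δu⁰ because the Fejér kernel is nonnegative.
They are needed because u⁰, and so ξ, need not lie in W^{1,2}. The Moser–Trudinger inequality comes
from iterating an L²–W^{1,1} Sobolev inequality over the level sets of a function. -/

noncomputable section

namespace ChernSimons

section

/-! ### The Cartan matrix -/

/-- The explicit inverse of the Cartan matrix of `SU(N+1)`. -/
def invK (N : ℕ) : Matrix (Fin N) (Fin N) ℝ :=
  fun i j => ((min i.1 j.1 : ℕ) + 1) * (N - (max i.1 j.1 : ℕ)) / (N + 1)

theorem invK_pos {N : ℕ} (i j : Fin N) : 0 < invK N i j := by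
  have h : (max i.1 j.1 : ℕ) < N := max_lt i.2 j.2
  have h' : ((max i.1 j.1 : ℕ) : ℝ) < N := by exact_mod_cast h
  unfold invK
  have : 0 < (N : ℝ) - (max i.1 j.1 : ℕ) := by linarith
  positivity

set_option maxHeartbeats 1000000 in
theorem K_mul_invK {N : ℕ} (hN3 : 3 ≤ N) (hN5 : N ≤ 5) : K N * invK N = 1 := by
  interval_cases N <;> ext i j <;> fin_cases i <;> fin_cases j <;>
    norm_num [K, invK, Matrix.mul_apply, Fin.sum_univ_succ, CartanMatrix.A, Matrix.one_apply,
      Fin.succ]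

theorem A_eq_invK {N : ℕ} (hN3 : 3 ≤ N) (hN5 : N ≤ 5) : A N = invK N :=
  Matrix.inv_eq_right_inv (K_mul_invK hN3 hN5)

theorem K_symm {N : ℕ} (i j : Fin N) : K N i j = K N j i := by
  have := congrFun (congrFun (CartanMatrix.A_transpose N) j) i
  simp only [K, Matrix.map_apply]
  rw [← this, Matrix.transpose_apply]

theorem K_diag {N : ℕ} (i : Fin N) : K N i i = 2 := by
  simp [K, CartanMatrix.A]

theorem K_off_diag {N : ℕ} {i j : Fin N} (h : i ≠ j) : K N i j ≤ 0 := by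
  simp only [K, CartanMatrix.A, Matrix.map_apply, Matrix.of_apply]
  split_ifs <;> simp_all

theorem abs_K_le {N : ℕ} (i j : Fin N) : |K N i j| ≤ 2 := by
  simp only [K, CartanMatrix.A, Matrix.map_apply, Matrix.of_apply]
  split_ifs <;> simp

/-- The form equals x_0² + ∑(x_{j+1} - x_j)² + x_{N-1}². Each x_j is a sum of j + 1 increments (x_0
being the first), so by Cauchy–Schwarz ∑ x_j² is at most 1 + ... + N ≤ 15 times the form. The hints
are the squares behind Cauchy–Schwarz. -/
theorem K_coercive {N : ℕ} (hN3 : 3 ≤ N) (hN5 : N ≤ 5) (x : Fin N → ℝ) :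
    1 / 15 * ∑ j, x j ^ 2 ≤ x ⬝ᵥ K N *ᵥ x := by
  interval_cases N
  · simp [dotProduct, mulVec, K, Fin.sum_univ_succ, CartanMatrix.A, Fin.succ]
    nlinarith [sq_nonneg (x 0 - (x 1 - x 0)), sq_nonneg (x 0 - (x 2 - x 1)),
      sq_nonneg ((x 1 - x 0) - (x 2 - x 1)), sq_nonneg (x 0), sq_nonneg (x 1 - x 0),
      sq_nonneg (x 2 - x 1), sq_nonneg (x 2)]
  · simp [dotProduct, mulVec, K, Fin.sum_univ_succ, CartanMatrix.A, Fin.succ]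
    nlinarith [sq_nonneg (x 0 - (x 1 - x 0)), sq_nonneg (x 0 - (x 2 - x 1)),
      sq_nonneg (x 0 - (x 3 - x 2)), sq_nonneg ((x 1 - x 0) - (x 2 - x 1)),
      sq_nonneg ((x 1 - x 0) - (x 3 - x 2)), sq_nonneg ((x 2 - x 1) - (x 3 - x 2)),
      sq_nonneg (x 0), sq_nonneg (x 1 - x 0), sq_nonneg (x 2 - x 1), sq_nonneg (x 3 - x 2),
      sq_nonneg (x 3)]
  · simp [dotProduct, mulVec, K, Fin.sum_univ_succ, CartanMatrix.A, Fin.succ]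
    nlinarith [sq_nonneg (x 0 - (x 1 - x 0)), sq_nonneg (x 0 - (x 2 - x 1)),
      sq_nonneg (x 0 - (x 3 - x 2)), sq_nonneg (x 0 - (x 4 - x 3)),
      sq_nonneg ((x 1 - x 0) - (x 2 - x 1)), sq_nonneg ((x 1 - x 0) - (x 3 - x 2)),
      sq_nonneg ((x 1 - x 0) - (x 4 - x 3)), sq_nonneg ((x 2 - x 1) - (x 3 - x 2)),
      sq_nonneg ((x 2 - x 1) - (x 4 - x 3)), sq_nonneg ((x 3 - x 2) - (x 4 - x 3)),
      sq_nonneg (x 0), sq_nonneg (x 1 - x 0), sq_nonneg (x 2 - x 1), sq_nonneg (x 3 - x 2),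
      sq_nonneg (x 4 - x 3), sq_nonneg (x 4)]

end

/-! ### Consequences for A, r, M and b -/

section

theorem K_mul_A {N : ℕ} (hN3 : 3 ≤ N) (hN5 : N ≤ 5) : K N * A N = 1 := by
  rw [A_eq_invK hN3 hN5, K_mul_invK hN3 hN5]

theorem A_mul_K {N : ℕ} (hN3 : 3 ≤ N) (hN5 : N ≤ 5) : A N * K N = 1 :=
  mul_eq_one_comm.mp (K_mul_A hN3 hN5)

theorem A_pos {N : ℕ} (hN3 : 3 ≤ N) (hN5 : N ≤ 5) (i j : Fin N) : 0 < A N i j := by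
  rw [A_eq_invK hN3 hN5]; exact invK_pos i j

theorem A_symm {N : ℕ} (hN3 : 3 ≤ N) (hN5 : N ≤ 5) (i j : Fin N) : A N i j = A N j i := by
  rw [A_eq_invK hN3 hN5]; simp only [invK, min_comm, max_comm]

theorem K_transpose (N : ℕ) : (K N)ᵀ = K N := by ext i j; exact K_symm j i

theorem r_pos {N : ℕ} (hN3 : 3 ≤ N) (hN5 : N ≤ 5) (j : Fin N) : 0 < r N j :=
  Finset.sum_pos (fun k _ => A_pos hN3 hN5 j k) ⟨j, Finset.mem_univ j⟩

theorem r_eq_A_mulVec_one (N : ℕ) : r N = A N *ᵥ 1 := by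
  ext j; simp [r, mulVec, dotProduct]

theorem K_mulVec_r {N : ℕ} (hN3 : 3 ≤ N) (hN5 : N ≤ 5) : K N *ᵥ r N = 1 := by
  rw [r_eq_A_mulVec_one, mulVec_mulVec, K_mul_A hN3 hN5, one_mulVec]

/-- With a = RU, R K R (U - 1) = R(Ka - Kr) and Kr = 1. In terms of a the force no longer contains
r. -/
theorem mul_M_mulVec_sub_one {N : ℕ} (hN3 : 3 ≤ N) (hN5 : N ≤ 5) (U : Fin N → ℝ) (j : Fin N) :
    U j * (M N *ᵥ (fun k => U k - 1)) j
      = (r N j * U j) * ((K N *ᵥ (fun k => r N k * U k)) j - 1) := by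
  have h : diagonal (r N) *ᵥ (fun k => U k - 1) = (fun k => r N k * U k) - r N := by
    ext k; simp [mulVec_diagonal, mul_sub]
  rw [M, ← mulVec_mulVec, ← mulVec_mulVec, h, mulVec_sub, K_mulVec_r hN3 hN5, mulVec_diagonal]
  simp only [Pi.sub_apply, Pi.one_apply]
  ring

theorem dot_K_comm {N : ℕ} (x y : Fin N → ℝ) : x ⬝ᵥ K N *ᵥ y = y ⬝ᵥ K N *ᵥ x := by
  rw [dotProduct_mulVec, ← mulVec_transpose, K_transpose, dotProduct_comm]

theorem abs_K_mulVec_le {N : ℕ} (x : Fin N → ℝ) (j : Fin N) :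
    |(K N *ᵥ x) j| ≤ 2 * ∑ k, |x k| := by
  rw [mulVec, dotProduct, Finset.mul_sum]
  refine (Finset.abs_sum_le_sum_abs _ _).trans (Finset.sum_le_sum fun k _ => ?_)
  rw [abs_mul]
  exact mul_le_mul_of_nonneg_right (abs_K_le j k) (abs_nonneg _)

theorem sq_K_mulVec_le {N : ℕ} (x : Fin N → ℝ) (j : Fin N) :
    (K N *ᵥ x) j ^ 2 ≤ 4 * N * ∑ k, x k ^ 2 := by
  have h1 : (K N *ᵥ x) j ^ 2 ≤ (2 * ∑ k, |x k|) ^ 2 :=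
    sq_le_sq' (by linarith [neg_abs_le ((K N *ᵥ x) j), abs_K_mulVec_le x j])
      ((le_abs_self _).trans (abs_K_mulVec_le x j))
  have h2 := sq_sum_le_card_mul_sum_sq (s := Finset.univ) (f := fun k => |x k|)
  simp only [sq_abs, Finset.card_univ, Fintype.card_fin] at h2
  nlinarith

/-- With y = Ax the form is yᵀKy, while x = Ky gives |x|² ≤ 4N²|y|² ≤ 100|y|². The constant is 15 ·
100. -/
theorem A_coercive {N : ℕ} (hN3 : 3 ≤ N) (hN5 : N ≤ 5) (x : Fin N → ℝ) :
    1 / 1500 * ∑ j, x j ^ 2 ≤ x ⬝ᵥ A N *ᵥ x := by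
  set y := A N *ᵥ x with hy
  have hx : x = K N *ᵥ y := by rw [hy, mulVec_mulVec, K_mul_A hN3 hN5, one_mulVec]
  have h1 : ∑ j, x j ^ 2 ≤ 100 * ∑ k, y k ^ 2 := by
    calc ∑ j, x j ^ 2 ≤ ∑ _j : Fin N, 4 * N * ∑ k, y k ^ 2 :=
          Finset.sum_le_sum fun j _ => by
            conv_lhs => rw [hx]
            exact sq_K_mulVec_le y j
      _ = (4 * N * N) * ∑ k, y k ^ 2 := by simp; ring
      _ ≤ 100 * ∑ k, y k ^ 2 := by
          have : (N : ℝ) ≤ 5 := by exact_mod_cast hN5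
          have h0 : (0 : ℝ) ≤ N := Nat.cast_nonneg N
          exact mul_le_mul_of_nonneg_right (by nlinarith) (Finset.sum_nonneg fun _ _ => sq_nonneg _)
  have h2 := K_coercive hN3 hN5 y
  have h3 : x ⬝ᵥ y = y ⬝ᵥ K N *ᵥ y := by rw [← hx, dotProduct_comm]
  rw [h3]; linarith

theorem bvec_eq {N : ℕ} (n : Fin N → ℕ) : bvec n = (4 * Real.pi) • (A N *ᵥ fun k => (n k : ℝ)) := by
  ext j; simp [bvec, mulVec, dotProduct]

/-- All entries of K⁻¹ are positive, so a single vortex in one component makes every b_j positive.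
This strict sign later bounds the means from below. -/
theorem bvec_pos {N : ℕ} (hN3 : 3 ≤ N) (hN5 : N ≤ 5) {n : Fin N → ℕ} (hn : ∃ k, 0 < n k)
    (j : Fin N) : 0 < bvec n j := by
  obtain ⟨k, hk⟩ := hn
  refine mul_pos (by positivity) (Finset.sum_pos' (fun i _ => ?_) ⟨k, Finset.mem_univ k, ?_⟩)
  · exact mul_nonneg (A_pos hN3 hN5 j i).le (Nat.cast_nonneg _)
  · exact mul_pos (A_pos hN3 hN5 j k) (Nat.cast_pos.mpr hk)

theorem bvec_dot_K_mulVec {N : ℕ} (hN3 : 3 ≤ N) (hN5 : N ≤ 5) (n : Fin N → ℕ) (y : Fin N → ℝ) :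
    bvec n ⬝ᵥ K N *ᵥ y = 4 * Real.pi * ∑ j, n j * y j := by
  rw [bvec_eq, dot_K_comm, mulVec_smul, mulVec_mulVec, K_mul_A hN3 hN5, one_mulVec,
    dotProduct_smul, dotProduct_comm]
  rfl

/-! ### The linear complementarity problem for the Cartan matrix -/

/-- The solution set of the variational inequality of `½ ψᵀKψ - ξᵀψ` on the positive cone. -/
structure IsCompl {N : ℕ} (ξ ψ : Fin N → ℝ) : Prop where
  nonneg : ∀ j, 0 ≤ ψ j
  var_ineq : ∀ χ : Fin N → ℝ, (∀ j, 0 ≤ χ j) → 0 ≤ (χ - ψ) ⬝ᵥ (K N *ᵥ ψ - ξ)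

/-- The strictly positive quadratic form makes the functional coercive, so it has a minimiser on the
closed cone; the variational inequality is the first-order condition along segments inside the cone.
-/
theorem exists_isCompl {N : ℕ} (hN3 : 3 ≤ N) (hN5 : N ≤ 5) (ξ : Fin N → ℝ) :
    ∃ ψ, IsCompl ξ ψ := by
  set J : (Fin N → ℝ) → ℝ := fun ψ => 1 / 2 * (ψ ⬝ᵥ K N *ᵥ ψ) - ξ ⬝ᵥ ψ with hJ
  have hcont : Continuous J := by
    simp only [hJ, dotProduct, mulVec]; fun_prop
  set S : Set (Fin N → ℝ) := {ψ | ∀ j, 0 ≤ ψ j} with hS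
  have hclosed : IsClosed S := by
    have : S = ⋂ j, {ψ | 0 ≤ ψ j} := by ext; simp [hS]
    rw [this]
    exact isClosed_iInter fun j => isClosed_le continuous_const (continuous_apply j)
  -- Coercivity gives |ψ|²/30 in `J`; Young's inequality spends half of it on ξᵀψ, leaving |ψ|² ≤
  -- 900|ξ|² where `J ≤ 0`. The point 0 is in that set, so minimisation takes place in a ball.
  have hcoer : ∀ ψ : Fin N → ℝ, J ψ ≤ 0 → ψ ∈ Metric.closedBall (0 : Fin N → ℝ) (30 * (1 + ∑ j, ξ j ^ 2)) := by
    intro ψ hψ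
    have h1 := K_coercive hN3 hN5 ψ
    have h2 : ξ ⬝ᵥ ψ ≤ ∑ j, (1 / 60 * ψ j ^ 2 + 15 * ξ j ^ 2) :=
      Finset.sum_le_sum fun j _ => by nlinarith [sq_nonneg (1 / 30 * ψ j - ξ j)]
    rw [Finset.sum_add_distrib, ← Finset.mul_sum, ← Finset.mul_sum] at h2
    have h3 : ∑ j, ψ j ^ 2 ≤ 900 * ∑ j, ξ j ^ 2 := by simp only [hJ] at hψ; linarith
    have h0 : 0 ≤ ∑ j, ξ j ^ 2 := Finset.sum_nonneg fun _ _ => sq_nonneg _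
    rw [mem_closedBall_zero_iff, pi_norm_le_iff_of_nonneg (by positivity)]
    intro j
    have h4 : ψ j ^ 2 ≤ ∑ j, ψ j ^ 2 :=
      Finset.single_le_sum (f := fun j => ψ j ^ 2) (fun _ _ => sq_nonneg _) (Finset.mem_univ j)
    rw [Real.norm_eq_abs]
    exact abs_le_of_sq_le_sq (by nlinarith) (by positivity)
  obtain ⟨ψ, hψS, hψ⟩ := hcont.continuousOn.exists_isMinOn' (s := S) hclosed (x₀ := 0)
    (by simp [hS]) (by
      filter_upwards [mem_inf_of_left (isCompact_closedBall (0 : Fin N → ℝ)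
        (30 * (1 + ∑ j, ξ j ^ 2))).compl_mem_cocompact] with ψ hψ
      by_contra hlt
      have : J 0 = 0 := by simp [hJ]
      exact hψ (hcoer ψ (by linarith [not_le.mp hlt])))
  refine ⟨ψ, hψS, fun χ hχ => ?_⟩
  -- This is the increment of `J` along the segment from ψ to χ, divided by t.
  have key : ∀ t : ℝ, 0 < t → t ≤ 1 →
      0 ≤ (χ - ψ) ⬝ᵥ (K N *ᵥ ψ - ξ) + t * (1 / 2 * ((χ - ψ) ⬝ᵥ K N *ᵥ (χ - ψ))) := by
    intro t ht ht1
    have hmem : ψ + t • (χ - ψ) ∈ S := fun j => by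
      have h1 := hψS j
      have h2 := hχ j
      simp only [Pi.add_apply, Pi.smul_apply, Pi.sub_apply, smul_eq_mul]
      nlinarith
    have hle : J ψ ≤ J (ψ + t • (χ - ψ)) := hψ hmem
    have hexp : J (ψ + t • (χ - ψ)) - J ψ = t * ((χ - ψ) ⬝ᵥ (K N *ᵥ ψ - ξ)
        + t * (1 / 2 * ((χ - ψ) ⬝ᵥ K N *ᵥ (χ - ψ)))) := by
      simp only [hJ]
      rw [mulVec_add, dotProduct_add, add_dotProduct, add_dotProduct, mulVec_smul, smul_dotProduct,
        smul_dotProduct, dotProduct_smul, dotProduct_smul, dotProduct_add, dotProduct_smul,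
        dot_K_comm ψ (χ - ψ), dotProduct_sub (χ - ψ), dotProduct_comm ξ (χ - ψ)]
      simp only [smul_eq_mul]; ring
    exact nonneg_of_mul_nonneg_right (by linarith) ht
  have hlim : Tendsto (fun t : ℝ => (χ - ψ) ⬝ᵥ (K N *ᵥ ψ - ξ)
      + t * (1 / 2 * ((χ - ψ) ⬝ᵥ K N *ᵥ (χ - ψ)))) (𝓝[>] 0)
      (𝓝 ((χ - ψ) ⬝ᵥ (K N *ᵥ ψ - ξ) + 0 * (1 / 2 * ((χ - ψ) ⬝ᵥ K N *ᵥ (χ - ψ))))) :=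
    (Continuous.tendsto (by fun_prop) 0).mono_left nhdsWithin_le_nhds
  rw [zero_mul, add_zero] at hlim
  refine ge_of_tendsto hlim ?_
  filter_upwards [Ioc_mem_nhdsGT (zero_lt_one' ℝ)] with t ht using key t ht.1 ht.2

namespace IsCompl

variable {N : ℕ} {ξ ψ ξ' ψ' : Fin N → ℝ}

/-- Each variational inequality is tested with the other solution and the two are added. Keeping the
form of K on the left is what later yields a pointwise inequality between gradients. -/
theorem firm (h : IsCompl ξ ψ) (h' : IsCompl ξ' ψ') :
    (ψ - ψ') ⬝ᵥ K N *ᵥ (ψ - ψ') ≤ (ξ - ξ') ⬝ᵥ (ψ - ψ') := by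
  have h1 := h.var_ineq ψ' h'.nonneg
  have h2 := h'.var_ineq ψ h.nonneg
  have e : (ξ - ξ') ⬝ᵥ (ψ - ψ') - (ψ - ψ') ⬝ᵥ K N *ᵥ (ψ - ψ')
      = (ψ' - ψ) ⬝ᵥ (K N *ᵥ ψ - ξ) + (ψ - ψ') ⬝ᵥ (K N *ᵥ ψ' - ξ') := by
    rw [dotProduct_comm, mulVec_sub, ← neg_sub ψ ψ', neg_dotProduct]
    simp only [dotProduct_sub]; ring
  linarith

/-- Adding a unit vector to ψ stays in the cone. -/
theorem le_K_mulVec (h : IsCompl ξ ψ) (j : Fin N) : ξ j ≤ (K N *ᵥ ψ) j := by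
  have h1 := h.var_ineq (ψ + Pi.single j 1) fun i => by
    by_cases hij : i = j
    · subst hij; simpa using add_nonneg (h.nonneg i) zero_le_one
    · simpa [hij] using h.nonneg i
  rw [add_sub_cancel_left, single_one_dotProduct] at h1
  simpa using h1

/-- Setting the j-th coordinate of ψ to zero stays in the cone and gives ψ_j((Kψ)_j - ξ_j) ≤ 0,
where both factors are nonnegative. -/
theorem eq_zero_or (h : IsCompl ξ ψ) (j : Fin N) : ψ j = 0 ∨ (K N *ᵥ ψ) j = ξ j := by
  have h1 := h.var_ineq (Function.update ψ j 0) fun i => by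
    by_cases hij : i = j
    · subst hij; simp
    · simpa [hij] using h.nonneg i
  have e : Function.update ψ j 0 - ψ = Pi.single j (-ψ j) := by
    ext i
    by_cases hij : i = j
    · subst hij; simp
    · simp [hij]
  rw [e, single_dotProduct] at h1
  have h2 := h.le_K_mulVec j
  have h3 := h.nonneg j
  rcases h3.eq_or_lt with h4 | h4
  · exact Or.inl h4.symm
  · right
    simp only [Pi.sub_apply] at h1
    nlinarith

/-- The off-diagonal entries of K are nonpositive and ψ ≥ 0, so only the diagonal contributes
positively. -/
theorem K_mulVec_le (h : IsCompl ξ ψ) (j : Fin N) : (K N *ᵥ ψ) j ≤ 2 * ψ j := by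
  rw [mulVec, dotProduct, ← Finset.add_sum_erase _ _ (Finset.mem_univ j), K_diag]
  have : ∑ k ∈ Finset.univ.erase j, K N j k * ψ k ≤ 0 :=
    Finset.sum_nonpos fun k hk =>
      mul_nonpos_of_nonpos_of_nonneg (K_off_diag (Finset.ne_of_mem_erase hk).symm) (h.nonneg k)
  linarith

theorem le_two_mul (h : IsCompl ξ ψ) (j : Fin N) : ξ j ≤ 2 * ψ j :=
  (h.le_K_mulVec j).trans (h.K_mulVec_le j)

/-- The choice χ = 0 gives ψᵀKψ ≤ ψᵀξ ≤ ψᵀξ⁺, and Young's inequality absorbs half of the coercivity;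
225 = 15². Since only ξ⁺ enters, exp ξ controls ψ and no lower bound on ξ is needed. -/
theorem sum_sq_le (hN3 : 3 ≤ N) (hN5 : N ≤ 5) (h : IsCompl ξ ψ) :
    ∑ j, ψ j ^ 2 ≤ 225 * ∑ j, (max (ξ j) 0) ^ 2 := by
  have h1 := h.var_ineq 0 fun _ => le_rfl
  rw [zero_sub, neg_dotProduct, dotProduct_sub] at h1
  have h2 := K_coercive hN3 hN5 ψ
  have h3 : ψ ⬝ᵥ ξ ≤ ∑ j, (1 / 30 * ψ j ^ 2 + 15 / 2 * (max (ξ j) 0) ^ 2) :=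
    Finset.sum_le_sum fun j _ => by
      have := mul_le_mul_of_nonneg_left (le_max_left (ξ j) 0) (h.nonneg j)
      nlinarith [sq_nonneg (1 / 15 * ψ j - max (ξ j) 0)]
  rw [Finset.sum_add_distrib, ← Finset.mul_sum, ← Finset.mul_sum] at h3
  linarith

theorem sum_sq_sub_le (hN3 : 3 ≤ N) (hN5 : N ≤ 5) (h : IsCompl ξ ψ) (h' : IsCompl ξ' ψ') :
    ∑ j, (ψ j - ψ' j) ^ 2 ≤ 225 * ∑ j, (ξ j - ξ' j) ^ 2 := by
  have h1 := h.firm h'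
  have h2 := K_coercive hN3 hN5 (ψ - ψ')
  have h3 : (ξ - ξ') ⬝ᵥ (ψ - ψ') ≤ ∑ j, (1 / 30 * (ψ j - ψ' j) ^ 2 + 15 / 2 * (ξ j - ξ' j) ^ 2) :=
    Finset.sum_le_sum fun j _ => by
      simp only [Pi.sub_apply]
      nlinarith [sq_nonneg (1 / 15 * (ψ j - ψ' j) - (ξ j - ξ' j))]
  rw [Finset.sum_add_distrib, ← Finset.mul_sum, ← Finset.mul_sum] at h3
  simp only [Pi.sub_apply] at h2
  linarith

/-- Lower bound for the pairing of `Kψ` with the nonlinearity `a ∘ (Ka - 1)`, `a = exp ξ`. -/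
theorem pairing_lower_bound (hN3 : 3 ≤ N) (hN5 : N ≤ 5) (h : IsCompl ξ ψ) :
    -(500 * (1 + ∑ j, Real.exp (ξ j) ^ 2)) ≤
      ∑ j, (K N *ᵥ ψ) j * (Real.exp (ξ j) * ((K N *ᵥ fun k => Real.exp (ξ k)) j - 1)) := by
  set a : Fin N → ℝ := fun j => Real.exp (ξ j) with ha
  have hapos : ∀ j, 0 < a j := fun j => Real.exp_pos _
  -- Here t ≥ 1 dominates every a_j. The idea is to replace (Kψ)_j by log t, the same number for all
  -- j: the main parts then add up to log t · aᵀKa ≥ 0, and no error of size t² log t remains.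
  set t : ℝ := 1 + ∑ j, a j with ht
  have hsum : 0 ≤ ∑ j, a j := Finset.sum_nonneg fun j _ => (hapos j).le
  have ht1 : 1 ≤ t := by linarith
  have hajt : ∀ j, a j ≤ t := fun j => by
    have := Finset.single_le_sum (f := a) (fun i _ => (hapos i).le) (Finset.mem_univ j)
    linarith
  have hK : ∀ j, |(K N *ᵥ a) j| ≤ 2 * t := fun j => by
    have := abs_K_mulVec_le a j
    simp only [abs_of_pos (hapos _)] at this
    linarith
  -- each term differs from `log t * a_j (K a)_j` by at most a multiple of `t ^ 2`
  have hterm : ∀ j, Real.log t * (a j * (K N *ᵥ a) j) - 6 * t ^ 2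
      ≤ (K N *ᵥ ψ) j * (a j * ((K N *ᵥ a) j - 1)) := by
    intro j
    have hxlog : ∀ s : ℝ, 0 < s → s ≤ 1 → |Real.log s * s| ≤ 1 := fun s hs hs1 => by
      exact (Real.abs_log_mul_self_lt s hs hs1).le
    -- With s = a_j / t in (0, 1] the product is t · s log s, and |s log s| ≤ 1.
    have h1 : |(ξ j - Real.log t) * a j| ≤ t := by
      have e : ξ j - Real.log t = Real.log (a j / t) := by
        rw [Real.log_div (hapos j).ne' (by linarith), ha, Real.log_exp]
      have := hxlog (a j / t) (div_pos (hapos j) (by linarith)) (div_le_one_of_le₀ (hajt j) (by linarith))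
      rw [e]
      calc |Real.log (a j / t) * a j| = |Real.log (a j / t) * (a j / t)| * t := by
            rw [← abs_of_pos (show 0 < t by linarith), ← abs_mul, abs_of_pos (show 0 < t by linarith)]
            congr 1; field_simp
        _ ≤ 1 * t := by gcongr
        _ = t := one_mul t
    -- By complementarity either the first factor vanishes, or ψ_j = 0 and ξ_j ≤ (Kψ)_j ≤ 0. In the
    -- latter case the product is at most |ξ_j| exp ξ_j ≤ 1.
    have h2 : |((K N *ᵥ ψ) j - ξ j) * a j| ≤ 1 := by
      rcases h.eq_zero_or j with h0 | h0
      · have hle := h.K_mulVec_le j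
        have hge := h.le_K_mulVec j
        rw [h0, mul_zero] at hle
        have hξ : ξ j ≤ 0 := hge.trans hle
        have h3 := hxlog (a j) (hapos j) (Real.exp_le_one_iff.mpr hξ)
        rw [ha, Real.log_exp] at h3
        rw [abs_mul] at h3 ⊢
        refine le_trans (mul_le_mul_of_nonneg_right ?_ (abs_nonneg _)) h3
        rw [abs_of_nonneg (by linarith), abs_of_nonpos hξ]; linarith
      · rw [h0]; simp
    have h3 : |(K N *ᵥ a) j - 1| ≤ 2 * t + 1 := (abs_sub _ _).trans (by simpa using hK j)
    have hlog : Real.log t ≤ t := (Real.log_le_sub_one_of_pos (by linarith)).trans (by linarith)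
    have hlog0 : 0 ≤ Real.log t := Real.log_nonneg ht1
    have e : (K N *ᵥ ψ) j * (a j * ((K N *ᵥ a) j - 1))
        = Real.log t * (a j * (K N *ᵥ a) j) - Real.log t * a j
          + (((K N *ᵥ ψ) j - ξ j) * a j + (ξ j - Real.log t) * a j) * ((K N *ᵥ a) j - 1) := by ring
    have h4 : |(((K N *ᵥ ψ) j - ξ j) * a j + (ξ j - Real.log t) * a j) * ((K N *ᵥ a) j - 1)|
        ≤ (1 + t) * (2 * t + 1) := by
      rw [abs_mul]
      exact mul_le_mul ((abs_add_le _ _).trans (add_le_add h2 h1)) h3 (abs_nonneg _) (by linarith)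
    have h5 := (abs_le.mp h4).1
    have h6 : Real.log t * a j ≤ (t - 1) * t :=
      mul_le_mul (Real.log_le_sub_one_of_pos (by linarith)) (hajt j) (hapos j).le (by linarith)
    rw [e]
    nlinarith [mul_self_nonneg (t - 1)]
  have hsum' : Real.log t * (a ⬝ᵥ K N *ᵥ a) - N * (6 * t ^ 2)
      ≤ ∑ j, (K N *ᵥ ψ) j * (a j * ((K N *ᵥ a) j - 1)) := by
    refine le_trans (le_of_eq ?_) (Finset.sum_le_sum fun j _ => hterm j)
    rw [Finset.sum_sub_distrib, ← Finset.mul_sum]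
    simp [dotProduct]
  have hpos : 0 ≤ Real.log t * (a ⬝ᵥ K N *ᵥ a) :=
    mul_nonneg (Real.log_nonneg ht1) ((mul_nonneg (by norm_num)
      (Finset.sum_nonneg fun j _ => sq_nonneg (a j))).trans (K_coercive hN3 hN5 a))
  have hN : (N : ℝ) ≤ 5 := by exact_mod_cast hN5
  -- From t² ≤ 2 + 2(∑ a_j)² and N ≤ 5. The total error 30t² is then at most 60 + 300 ∑ a_j².
  have ht2 : t ^ 2 ≤ 2 + 10 * ∑ j, a j ^ 2 := by
    have h2 := sq_sum_le_card_mul_sum_sq (s := Finset.univ) (f := a)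
    simp only [Finset.card_univ, Fintype.card_fin] at h2
    have h0 : 0 ≤ ∑ j, a j ^ 2 := Finset.sum_nonneg fun _ _ => sq_nonneg _
    rw [ht]
    nlinarith [sq_nonneg (1 - ∑ j, a j)]
  have h0 : 0 ≤ ∑ j, a j ^ 2 := Finset.sum_nonneg fun _ _ => sq_nonneg _
  have : N * (6 * t ^ 2) ≤ 5 * (6 * t ^ 2) := by gcongr
  linarith

end IsCompl

end

section

/-! ### Periodic functions on the plane -/

/-- Doubly periodic functions. -/
def IsPeriodic {E : Type*} (e : Module.Basis (Fin 2) ℝ Plane) (f : Plane → E) : Prop :=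
  ∀ (k : Fin 2) (x : Plane), f (x + e k) = f x

variable {e : Module.Basis (Fin 2) ℝ Plane}

theorem IsPeriodic.lattice_add {E : Type*} {f : Plane → E} (hf : IsPeriodic e f) {l : Plane}
    (hl : l ∈ Submodule.span ℤ (Set.range e)) (x : Plane) : f (l + x) = f x := by
  induction hl using Submodule.span_induction generalizing x with
  | mem y hy => obtain ⟨k, rfl⟩ := hy; rw [add_comm]; exact hf k x
  | zero => rw [zero_add]
  | add y z _ _ hy hz => rw [add_assoc, hy, hz]
  | smul n y _ hy =>
    have hnat : ∀ (m : ℕ) (x : Plane), f ((m : ℤ) • y + x) = f x := by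
      intro m
      induction m with
      | zero => intro x; simp
      | succ m ih => intro x; rw [Nat.cast_succ, add_smul, one_smul, add_assoc, ih, hy]
    rcases Int.eq_nat_or_neg n with ⟨m, rfl | rfl⟩
    · exact hnat m x
    · rw [← hnat m (-(m : ℤ) • y + x), ← add_assoc, ← add_smul, add_neg_cancel, zero_smul, zero_add]

theorem IsPeriodic.fract {E : Type*} {f : Plane → E} (hf : IsPeriodic e f) (x : Plane) :
    f (ZSpan.fract e x) = f x := by
  rw [ZSpan.fract_apply, sub_eq_neg_add]
  exact hf.lattice_add (neg_mem (ZSpan.floor e x).2) x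

theorem IsPeriodic.exists_bound {f : Plane → ℝ} (hf : IsPeriodic e f) (hc : Continuous f) :
    ∃ C, ∀ x, |f x| ≤ C := by
  obtain ⟨C, hC⟩ := (ZSpan.fundamentalDomain_isBounded e).isCompact_closure.exists_bound_of_continuousOn
    hc.continuousOn
  refine ⟨C, fun x => ?_⟩
  rw [← hf.fract x]
  exact hC _ (subset_closure (ZSpan.fract_mem_fundamentalDomain e x))

theorem isAddFundamentalDomain_cell (e : Module.Basis (Fin 2) ℝ Plane) :
    IsAddFundamentalDomain (Submodule.span ℤ (Set.range e)) (cell e) volume :=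
  ZSpan.isAddFundamentalDomain e volume

instance vaddInvariantMeasure_lattice (e : Module.Basis (Fin 2) ℝ Plane) :
    VAddInvariantMeasure (Submodule.span ℤ (Set.range e)) Plane volume :=
  ⟨fun c s _ => measure_preimage_add volume (c : Plane) s⟩

-- A translate of a fundamental domain is again one, and a lattice-invariant function has the same
-- integral over both.
open scoped Pointwise in
theorem IsPeriodic.integral_comp_add {E : Type*} [NormedAddCommGroup E] [NormedSpace ℝ E]
    {f : Plane → E} (hf : IsPeriodic e f) (h : Plane) :
    ∫ x in cell e, f (x + h) = ∫ x in cell e, f x := by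
  have h1 : ∫ x in cell e, f (x + h) = ∫ x in h +ᵥ cell e, f x := by
    have hmp : MeasurePreserving (fun x : Plane => x + h) volume volume :=
      measurePreserving_add_right volume h
    have hemb : MeasurableEmbedding (fun x : Plane => x + h) := measurableEmbedding_addRight h
    have himg : h +ᵥ cell e = (fun x : Plane => x + h) '' cell e := by
      rw [← Set.image_vadd]; simp only [vadd_eq_add, add_comm]
    rw [himg, hmp.setIntegral_image_emb hemb]
  rw [h1]
  have hd := isAddFundamentalDomain_cell e
  have hd' : IsAddFundamentalDomain (Submodule.span ℤ (Set.range e)) (h +ᵥ cell e) volume :=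
    hd.vadd_of_comm h
  exact hd'.setIntegral_eq hd fun g x => hf.lattice_add g.2 x

theorem area_pos (e : Module.Basis (Fin 2) ℝ Plane) : 0 < area e := by
  rw [area, Measure.real, ENNReal.toReal_pos_iff]
  exact ⟨pos_iff_ne_zero.mpr (ZSpan.measure_fundamentalDomain_ne_zero e),
    (ZSpan.fundamentalDomain_isBounded e).measure_lt_top⟩

/-- Lipschitz doubly periodic functions. -/
structure IsLipPer (e : Module.Basis (Fin 2) ℝ Plane) (h : Plane → ℝ) : Prop where
  lip : ∃ C, LipschitzWith C h
  periodic : IsPeriodic e h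

namespace IsLipPer

variable {h g : Plane → ℝ}

theorem continuous (hh : IsLipPer e h) : Continuous h := hh.lip.choose_spec.continuous

theorem ae_differentiableAt (hh : IsLipPer e h) : ∀ᵐ x, DifferentiableAt ℝ h x :=
  hh.lip.choose_spec.ae_differentiableAt

theorem exists_bound (hh : IsLipPer e h) : ∃ C, ∀ x, |h x| ≤ C :=
  hh.periodic.exists_bound hh.continuous

theorem mul (hh : IsLipPer e h) (hg : IsLipPer e g) : IsLipPer e (fun x => h x * g x) := by
  obtain ⟨C, hC⟩ := hh.exists_bound
  obtain ⟨D, hD⟩ := hg.exists_bound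
  obtain ⟨c, hc⟩ := hh.lip
  obtain ⟨d, hd⟩ := hg.lip
  refine ⟨⟨Real.toNNReal (C * d + D * c), LipschitzWith.of_dist_le' fun x y => ?_⟩, fun k x => ?_⟩
  · have h1 := hc.dist_le_mul x y
    have h2 := hd.dist_le_mul x y
    rw [Real.dist_eq] at h1 h2 ⊢
    have e1 : h x * g x - h y * g y = h x * (g x - g y) + (h x - h y) * g y := by ring
    rw [e1]
    refine (abs_add_le _ _).trans ?_
    rw [abs_mul, abs_mul]
    have h3 : |h x| * |g x - g y| ≤ C * (d * dist x y) :=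
      mul_le_mul (hC x) h2 (abs_nonneg _) ((abs_nonneg _).trans (hC x))
    have h4 : |h x - h y| * |g y| ≤ (c * dist x y) * D :=
      mul_le_mul h1 (hD y) (abs_nonneg _) (by positivity)
    linarith
  · simp only [hh.periodic k x, hg.periodic k x]

theorem partialDeriv_eq_lim (hx : DifferentiableAt ℝ h x) (i : Fin 2) :
    HasDerivAt (fun t : ℝ => h (x + t • EuclideanSpace.single i 1)) (partialDeriv i h x) 0 := by
  have h1 : HasFDerivAt h (fderiv ℝ h x) (x + (0 : ℝ) • EuclideanSpace.single i (1 : ℝ)) := by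
    simpa using hx.hasFDerivAt
  have h2 : HasDerivAt (fun t : ℝ => x + t • EuclideanSpace.single i (1 : ℝ))
      (EuclideanSpace.single i 1) 0 := by
    simpa using ((hasDerivAt_id (0 : ℝ)).smul_const (EuclideanSpace.single i (1 : ℝ))).const_add x
  exact h1.comp_hasDerivAt 0 h2

theorem abs_partialDeriv_le {C : NNReal} (hC : LipschitzWith C h) (i : Fin 2) (x : Plane) :
    |partialDeriv i h x| ≤ C := by
  have h1 : ‖fderiv ℝ h x‖ ≤ C := norm_fderiv_le_of_lipschitz ℝ hC
  have := (fderiv ℝ h x).le_opNorm (EuclideanSpace.single i (1 : ℝ))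
  rw [PiLp.norm_single, norm_one, mul_one] at this
  exact this.trans h1

theorem measurable_partialDeriv (h : Plane → ℝ) (i : Fin 2) : Measurable (partialDeriv i h) :=
  measurable_fderiv_apply_const ℝ h _

/-- Difference quotients of a periodic function integrate to zero by translation invariance. The
Lipschitz constant dominates them, and by Rademacher's theorem they converge almost everywhere. -/
theorem integral_partialDeriv (hh : IsLipPer e h) (i : Fin 2) :
    ∫ x in cell e, partialDeriv i h x = 0 := by
  obtain ⟨C, hC⟩ := hh.lip
  set s : Plane := EuclideanSpace.single i (1 : ℝ) with hs
  have hs1 : ‖s‖ = 1 := by rw [hs, PiLp.norm_single, norm_one]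
  set F : ℕ → Plane → ℝ := fun n x =>
    ((1 / ((n : ℝ) + 1)) : ℝ)⁻¹ * (h (x + (1 / ((n : ℝ) + 1) : ℝ) • s) - h x) with hF
  have hcont : ∀ t : ℝ, Continuous fun x => h (x + t • s) := fun t =>
    hh.continuous.comp (by fun_prop)
  have hint : ∀ t : ℝ, Integrable (fun x => h (x + t • s)) (cellMeasure e) := fun t => by
    obtain ⟨B, hB⟩ := hh.exists_bound
    exact Integrable.of_bound (hcont t).aestronglyMeasurable B (ae_of_all _ fun x => hB _)
  have hF0 : ∀ n, ∫ x in cell e, F n x = 0 := fun n => by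
    have h0 := hint 0
    simp only [zero_smul, add_zero] at h0
    rw [hF, integral_const_mul, integral_sub (hint _) h0, hh.periodic.integral_comp_add, sub_self,
      mul_zero]
  have hlim : Tendsto (fun n => ∫ x in cell e, F n x) atTop
      (𝓝 (∫ x in cell e, partialDeriv i h x)) := by
    refine tendsto_integral_of_dominated_convergence (fun _ => (C : ℝ)) (fun n => ?_)
      (integrable_const _) (fun n => ae_of_all _ fun x => ?_) ?_
    · exact (((hcont _).sub hh.continuous).const_mul _).aestronglyMeasurable
    · have h1 := hC.dist_le_mul (x + (1 / ((n : ℝ) + 1) : ℝ) • s) x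
      have hpos : (0 : ℝ) < 1 / ((n : ℝ) + 1) := by positivity
      rw [dist_self_add_left, norm_smul, hs1, mul_one, Real.norm_eq_abs, abs_of_pos hpos,
        Real.dist_eq] at h1
      rw [hF, Real.norm_eq_abs, abs_mul, abs_of_pos (inv_pos.mpr hpos), inv_mul_le_iff₀ hpos]
      linarith
    · filter_upwards [ae_restrict_of_ae hh.ae_differentiableAt] with x hx
      have h1 := (hasDerivAt_iff_tendsto_slope_zero.mp (partialDeriv_eq_lim hx i))
      have h2 : Tendsto (fun n : ℕ => (1 / ((n : ℝ) + 1) : ℝ)) atTop (𝓝[≠] 0) :=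
        tendsto_nhdsWithin_iff.mpr ⟨tendsto_one_div_add_atTop_nhds_zero_nat,
          Eventually.of_forall fun n => by
            have : (0 : ℝ) < 1 / ((n : ℝ) + 1) := by positivity
            exact this.ne'⟩
      have h3 := h1.comp h2
      refine h3.congr fun n => ?_
      simp [hF, hs]
  simp only [hF0] at hlim
  exact tendsto_nhds_unique hlim tendsto_const_nhds

theorem memLp (hh : IsLipPer e h) (p : ENNReal) : MemLp h p (cellMeasure e) := by
  obtain ⟨B, hB⟩ := hh.exists_bound
  exact MemLp.of_bound hh.continuous.aestronglyMeasurable B (ae_of_all _ hB)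

theorem memLp_partialDeriv (hh : IsLipPer e h) (i : Fin 2) (p : ENNReal) :
    MemLp (partialDeriv i h) p (cellMeasure e) := by
  obtain ⟨C, hC⟩ := hh.lip
  exact MemLp.of_bound (measurable_partialDeriv h i).aestronglyMeasurable C
    (ae_of_all _ (abs_partialDeriv_le hC i))

/-- Integration by parts on the period cell. -/
theorem integral_mul_partialDeriv (hh : IsLipPer e h) (hg : IsLipPer e g) (i : Fin 2) :
    ∫ x in cell e, h x * partialDeriv i g x = -∫ x in cell e, partialDeriv i h x * g x := by
  have h1 := (hh.mul hg).integral_partialDeriv i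
  have h2 : ∀ᵐ x ∂(cellMeasure e), partialDeriv i (fun x => h x * g x) x
      = h x * partialDeriv i g x + partialDeriv i h x * g x := by
    filter_upwards [ae_restrict_of_ae hh.ae_differentiableAt,
      ae_restrict_of_ae hg.ae_differentiableAt] with x hx hx'
    simp only [partialDeriv]
    rw [fderiv_fun_mul hx hx']
    simp [mul_comm]
  rw [integral_congr_ae h2, integral_add] at h1
  · linarith
  · exact (hh.memLp 2).integrable_mul (hg.memLp_partialDeriv i 2)
  · exact (hh.memLp_partialDeriv i 2).integrable_mul (hg.memLp 2)

end IsLipPer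

theorem IsPeriodic.partialDeriv {f : Plane → ℝ} (hf : IsPeriodic e f) (i : Fin 2) :
    IsPeriodic e (partialDeriv i f) := by
  intro k x
  simp only [ChernSimons.partialDeriv]
  rw [← fderiv_comp_add_right]
  congr 2
  ext y
  exact hf k y

theorem IsTest.isPeriodic {φ : Plane → ℝ} (h : IsTest e φ) : IsPeriodic e φ := h.periodic

theorem IsTest.partialDeriv {φ : Plane → ℝ} (h : IsTest e φ) (i : Fin 2) :
    IsTest e (partialDeriv i φ) where
  smooth := (h.smooth.fderiv_right (m := ∞) (by simp)).clm_apply contDiff_const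
  periodic := h.isPeriodic.partialDeriv i

theorem IsTest.isLipPer {φ : Plane → ℝ} (h : IsTest e φ) : IsLipPer e φ := by
  refine ⟨?_, h.periodic⟩
  have hper : IsPeriodic e fun x => ‖fderiv ℝ φ x‖ := fun k x => by
    beta_reduce
    rw [← fderiv_comp_add_right]
    congr 2
    ext y
    exact h.periodic k y
  obtain ⟨C, hC⟩ := hper.exists_bound (h.smooth.continuous_fderiv (by simp)).norm
  refine ⟨Real.toNNReal C, lipschitzWith_of_nnnorm_fderiv_le (h.smooth.differentiable (by simp))
    fun x => ?_⟩
  rw [← NNReal.coe_le_coe, coe_nnnorm]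
  exact ((le_abs_self _).trans (hC x)).trans (Real.le_coe_toNNReal C)

theorem IsLipPer.isWeakPartial {h : Plane → ℝ} (hh : IsLipPer e h) (i : Fin 2) :
    IsWeakPartial e i h (ChernSimons.partialDeriv i h) :=
  fun _ hφ => hh.integral_mul_partialDeriv hφ.isLipPer i

theorem IsWeakPartial.congr {i : Fin 2} {f g f' g' : Plane → ℝ} (h : IsWeakPartial e i f g)
    (hf : f' =ᵐ[cellMeasure e] f) (hg : g' =ᵐ[cellMeasure e] g) : IsWeakPartial e i f' g' := by
  intro φ hφ
  have h1 : ∫ x in cell e, f' x * ChernSimons.partialDeriv i φ x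
      = ∫ x in cell e, f x * ChernSimons.partialDeriv i φ x :=
    integral_congr_ae (hf.mul (ae_eq_refl (ChernSimons.partialDeriv i φ)))
  have h2 : ∫ x in cell e, g' x * φ x = ∫ x in cell e, g x * φ x :=
    integral_congr_ae (hg.mul (ae_eq_refl φ))
  rw [h1, h2]
  exact h φ hφ

/-- The element of `W12` with prescribed function and weak gradient. -/
def W12.mk' {f : Plane → ℝ} {g : Fin 2 → Plane → ℝ} (hf : MemLp f 2 (cellMeasure e))
    (hg : ∀ i, MemLp (g i) 2 (cellMeasure e)) (h : ∀ i, IsWeakPartial e i f (g i)) : W12 e :=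
  ⟨WithLp.toLp 2 (hf.toLp f, WithLp.toLp 2 fun i => (hg i).toLp (g i)), fun i =>
    (h i).congr hf.coeFn_toLp (hg i).coeFn_toLp⟩

/-- A Lipschitz periodic function as an element of `W12`. -/
def IsLipPer.toW12 {h : Plane → ℝ} (hh : IsLipPer e h) : W12 e :=
  W12.mk' (hh.memLp 2) (fun i => hh.memLp_partialDeriv i 2) hh.isWeakPartial

theorem IsLipPer.toFun_toW12 {h : Plane → ℝ} (hh : IsLipPer e h) :
    W12.toFun hh.toW12 =ᵐ[cellMeasure e] h := (hh.memLp 2).coeFn_toLp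

theorem IsLipPer.grad_toW12 {h : Plane → ℝ} (hh : IsLipPer e h) (i : Fin 2) :
    W12.grad hh.toW12 i =ᵐ[cellMeasure e] ChernSimons.partialDeriv i h :=
  (hh.memLp_partialDeriv i 2).coeFn_toLp

end

section

/-! ### Characters of the flat torus -/

variable {e : Module.Basis (Fin 2) ℝ Plane}

/-- The phase `2π ∑ⱼ kⱼ xⱼ`, where `xⱼ` are the lattice coordinates of `x`. -/
def phase (e : Module.Basis (Fin 2) ℝ Plane) (k : Fin 2 → ℤ) : Plane →L[ℝ] ℝ :=
  LinearMap.toContinuousLinearMap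
    (∑ j, (2 * Real.pi * (k j : ℝ)) • (e.coord j))

theorem phase_apply (e : Module.Basis (Fin 2) ℝ Plane) (k : Fin 2 → ℤ) (x : Plane) :
    phase e k x = ∑ j, 2 * Real.pi * (k j : ℝ) * e.repr x j := by
  simp [phase]

/-- The wave vector of the character with index `k`. -/
def freq (e : Module.Basis (Fin 2) ℝ Plane) (k : Fin 2 → ℤ) (i : Fin 2) : ℝ :=
  phase e k (EuclideanSpace.single i 1)

theorem phase_basis (e : Module.Basis (Fin 2) ℝ Plane) (k : Fin 2 → ℤ) (j : Fin 2) :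
    phase e k (e j) = 2 * Real.pi * k j := by
  rw [phase_apply]; simp [Finsupp.single_apply]

theorem phase_add_index (k l : Fin 2 → ℤ) (x : Plane) :
    phase e (k + l) x = phase e k x + phase e l x := by
  simp only [phase_apply, ← Finset.sum_add_distrib, Pi.add_apply]
  refine Finset.sum_congr rfl fun j _ => ?_
  push_cast; ring

theorem phase_neg_index (k : Fin 2 → ℤ) (x : Plane) : phase e (-k) x = -phase e k x := by
  simp only [phase_apply, ← Finset.sum_neg_distrib, Pi.neg_apply]
  refine Finset.sum_congr rfl fun j _ => ?_
  push_cast; ring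

theorem phase_zero_index (x : Plane) : phase e 0 x = 0 := by simp [phase_apply]

theorem phase_sub_index (k l : Fin 2 → ℤ) (x : Plane) :
    phase e (k - l) x = phase e k x - phase e l x := by
  rw [sub_eq_add_neg, phase_add_index, phase_neg_index, sub_eq_add_neg]

/-- The character `exp (i phase)`. -/
def char (e : Module.Basis (Fin 2) ℝ Plane) (k : Fin 2 → ℤ) (x : Plane) : ℂ :=
  Complex.exp (phase e k x * Complex.I)

theorem char_add_index (k l : Fin 2 → ℤ) (x : Plane) :
    char e (k + l) x = char e k x * char e l x := by
  rw [char, char, char, ← Complex.exp_add, phase_add_index]; push_cast; ring_nf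

theorem char_zero_index (x : Plane) : char e 0 x = 1 := by simp [char, phase_zero_index]

theorem char_add (k : Fin 2 → ℤ) (x y : Plane) :
    char e k (x + y) = char e k x * char e k y := by
  rw [char, char, char, ← Complex.exp_add, map_add]; push_cast; ring_nf

theorem norm_char (k : Fin 2 → ℤ) (x : Plane) : ‖char e k x‖ = 1 :=
  Complex.norm_exp_ofReal_mul_I _

theorem conj_char (k : Fin 2 → ℤ) (x : Plane) :
    (starRingEnd ℂ) (char e k x) = char e (-k) x := by
  rw [char, char, ← Complex.exp_conj, phase_neg_index]
  simp

theorem continuous_char (k : Fin 2 → ℤ) : Continuous (char e k) := by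
  unfold char; fun_prop

theorem char_periodic (k : Fin 2 → ℤ) : IsPeriodic e (char e k) := by
  intro j x
  rw [char_add]
  have : char e k (e j) = 1 := by
    rw [char, phase_basis, Complex.exp_eq_one_iff]
    exact ⟨k j, by push_cast; ring⟩
  rw [this, mul_one]

theorem integral_char (k : Fin 2 → ℤ) :
    ∫ x in cell e, char e k x = if k = 0 then (area e : ℂ) else 0 := by
  split_ifs with h
  · subst h
    simp only [char_zero_index]
    rw [integral_const]
    simp [area]
  · obtain ⟨j, hj⟩ : ∃ j, k j ≠ 0 := by
      by_contra hcon
      push Not at hcon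
      exact h (funext hcon)
    -- Translation by e_j / (2k_j) multiplies the character by -1 but leaves its integral unchanged.
    have h1 := (char_periodic (e := e) k).integral_comp_add ((1 / (2 * (k j : ℝ))) • e j)
    have h2 : char e k ((1 / (2 * (k j : ℝ))) • e j) = -1 := by
      have hk : (k j : ℝ) ≠ 0 := by exact_mod_cast hj
      have : phase e k ((1 / (2 * (k j : ℝ))) • e j) = Real.pi := by
        rw [map_smul, phase_basis, smul_eq_mul]; field_simp
      rw [char, this, Complex.exp_pi_mul_I]
    simp only [char_add, h2, mul_neg, mul_one, integral_neg] at h1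
    exact self_eq_neg.mp h1.symm

theorem integral_char_mul_char (k l : Fin 2 → ℤ) :
    ∫ x in cell e, char e k x * char e (-l) x = if k = l then (area e : ℂ) else 0 := by
  simp only [← char_add_index]
  rw [integral_char, ← sub_eq_add_neg]
  simp only [sub_eq_zero]

theorem integrable_mul_char {f : Plane → ℝ} (hf : IntegrableOn f (cell e)) (k : Fin 2 → ℤ) :
    Integrable (fun x => (f x : ℂ) * char e k x) (cellMeasure e) :=
  hf.ofReal.mul_bdd (c := 1) (continuous_char k).aestronglyMeasurable
    (ae_of_all _ fun x => (norm_char k x).le)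

/-! ### Uniqueness of Fourier coefficients -/

/-- The projection of the plane to the standard torus. -/
def toTorus (e : Module.Basis (Fin 2) ℝ Plane) (x : Plane) : UnitAddTorus (Fin 2) :=
  fun j => ((e.repr x j : ℝ) : UnitAddCircle)

theorem continuous_toTorus : Continuous (toTorus e) := by
  refine continuous_pi fun j => (AddCircle.continuous_mk' (1 : ℝ)).comp ?_
  exact (e.coord j).continuous_of_finiteDimensional

theorem mFourier_toTorus (k : Fin 2 → ℤ) (x : Plane) :
    UnitAddTorus.mFourier k (toTorus e x) = char e k x := by
  simp only [UnitAddTorus.mFourier, toTorus, ContinuousMap.coe_mk, fourier_coe_apply, char,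
    phase_apply]
  rw [← Complex.exp_sum]
  congr 1
  push_cast
  rw [Finset.sum_mul]
  refine Finset.sum_congr rfl fun j _ => ?_
  simp; ring

theorem injOn_toTorus : Set.InjOn (toTorus e) (cell e) := by
  intro x hx y hy hxy
  refine e.repr.injective (Finsupp.ext fun j => ?_)
  have h := congrFun hxy j
  have hx' := (ZSpan.mem_fundamentalDomain e).mp hx j
  have hy' := (ZSpan.mem_fundamentalDomain e).mp hy j
  exact (AddCircle.coe_eq_coe_iff_of_mem_Ico (p := (1 : ℝ)) (a := 0) (by simpa using hx')
    (by simpa using hy')).mp h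

/-- The integral is a bounded functional of g in the uniform norm, it vanishes on the characters,
and their span is dense. -/
theorem integral_comp_toTorus_eq_zero {f : Plane → ℝ} (hf : IntegrableOn f (cell e))
    (h : ∀ k, ∫ x in cell e, (f x : ℂ) * char e k x = 0) (g : C(UnitAddTorus (Fin 2), ℂ)) :
    ∫ x in cell e, (f x : ℂ) * g (toTorus e x) = 0 := by
  have hint : ∀ g : C(UnitAddTorus (Fin 2), ℂ),
      Integrable (fun x => (f x : ℂ) * g (toTorus e x)) (cellMeasure e) := fun g =>
    hf.ofReal.mul_bdd (c := ‖g‖) (g.continuous.comp continuous_toTorus).aestronglyMeasurable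
      (ae_of_all _ fun x => g.norm_coe_le_norm _)
  let Λ : C(UnitAddTorus (Fin 2), ℂ) →ₗ[ℂ] ℂ :=
    { toFun := fun g => ∫ x in cell e, (f x : ℂ) * g (toTorus e x)
      map_add' := fun g g' => by
        simp only [ContinuousMap.add_apply, mul_add]
        exact integral_add (hint g) (hint g')
      map_smul' := fun c g => by
        simp only [ContinuousMap.smul_apply, smul_eq_mul, RingHom.id_apply]
        rw [← integral_const_mul]
        congr 1; ext x; ring }
  let Λ' := Λ.mkContinuous (∫ x in cell e, |f x|) fun g => by
    refine (norm_integral_le_integral_norm _).trans ?_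
    rw [← integral_mul_const]
    refine integral_mono (hint g).norm (hf.abs.mul_const _) fun x => ?_
    simp only [norm_mul, Complex.norm_real, Real.norm_eq_abs]
    exact mul_le_mul_of_nonneg_left (g.norm_coe_le_norm _) (abs_nonneg _)
  have hzero : Λ' = 0 := by
    refine ContinuousLinearMap.ext_on (s := Set.range (UnitAddTorus.mFourier (d := Fin 2))) ?_ ?_
    · exact (Submodule.dense_iff_topologicalClosure_eq_top).mpr UnitAddTorus.span_mFourier_closure_eq_top
    · rintro _ ⟨k, rfl⟩
      change ∫ x in cell e, (f x : ℂ) * UnitAddTorus.mFourier k (toTorus e x) = 0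
      simp only [mFourier_toTorus]
      exact h k
  exact congrArg (fun T => T g) hzero

/-- An integrable function on the torus is determined by its Fourier coefficients. -/
theorem ae_eq_zero_of_integral_mul_char_eq_zero {f : Plane → ℝ} (hf : IntegrableOn f (cell e))
    (h : ∀ k, ∫ x in cell e, (f x : ℂ) * char e k x = 0) : f =ᵐ[cellMeasure e] 0 := by
  have hreal : ∀ g : BoundedContinuousFunction (UnitAddTorus (Fin 2)) ℝ,
      ∫ x in cell e, f x * g (toTorus e x) = 0 := by
    intro g
    have h1 := integral_comp_toTorus_eq_zero hf h
      ⟨fun t => (g t : ℂ), Complex.continuous_ofReal.comp g.continuous⟩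
    simp only [ContinuousMap.coe_mk, ← Complex.ofReal_mul] at h1
    rw [integral_complex_ofReal] at h1
    exact_mod_cast h1
  have hmeasT : Measurable (toTorus e) := continuous_toTorus.measurable
  -- `ENNReal.ofReal` truncates at zero, so ν f and ν (-f) are the images of f⁺dx and f⁻dx. They
  -- integrate continuous functions equally, hence coincide as finite measures.
  let ν : (Plane → ℝ) → Measure (UnitAddTorus (Fin 2)) := fun f =>
    Measure.map (toTorus e) ((cellMeasure e).withDensity fun x => ENNReal.ofReal (f x))
  have hfin : ∀ f : Plane → ℝ, IntegrableOn f (cell e) → IsFiniteMeasure (ν f) := fun f hf => by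
    have : IsFiniteMeasure ((cellMeasure e).withDensity fun x => ENNReal.ofReal (f x)) :=
      isFiniteMeasure_withDensity_ofReal hf.2
    exact Measure.isFiniteMeasure_map _ _
  have hintν : ∀ f : Plane → ℝ, IntegrableOn f (cell e) →
      ∀ g : BoundedContinuousFunction (UnitAddTorus (Fin 2)) ℝ,
      ∫ t, g t ∂(ν f) = ∫ x in cell e, max (f x) 0 * g (toTorus e x) := fun f hf g => by
    rw [integral_map hmeasT.aemeasurable g.continuous.aestronglyMeasurable,
      integral_withDensity_eq_integral_toReal_smul₀ hf.1.aemeasurable.ennreal_ofReal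
        (ae_of_all _ fun x => ENNReal.ofReal_lt_top)]
    simp [ENNReal.toReal_ofReal']
  have := hfin f hf
  have := hfin (fun x => -f x) hf.neg
  have hν : ν f = ν fun x => -f x := by
    refine ext_of_forall_integral_eq_of_IsFiniteMeasure fun g => ?_
    rw [hintν f hf g, hintν (fun x => -f x) hf.neg g, ← sub_eq_zero, ← integral_sub]
    · simp only [← sub_mul, max_zero_sub_max_neg_zero_eq_self]
      exact hreal g
    · exact (hf.pos_part).mul_bdd (c := ‖g‖) (g.continuous.comp continuous_toTorus).aestronglyMeasurable
        (ae_of_all _ fun x => g.norm_coe_le_norm _)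
    · exact (hf.neg.pos_part).mul_bdd (c := ‖g‖)
        (g.continuous.comp continuous_toTorus).aestronglyMeasurable
        (ae_of_all _ fun x => g.norm_coe_le_norm _)
  refine hf.ae_eq_zero_of_forall_setIntegral_eq_zero fun B hB _ => ?_
  have hcell := ZSpan.fundamentalDomain_measurableSet e
  -- The projection is injective on the cell, so images of Borel sets are Borel (Lusin–Souslin) and
  -- equality of the image measures can be read back on every B.
  have hT : MeasurableSet (toTorus e '' (B ∩ cell e)) :=
    (hB.inter hcell).image_of_measurable_injOn hmeasT (injOn_toTorus.mono Set.inter_subset_right)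
  have hpre : toTorus e ⁻¹' (toTorus e '' (B ∩ cell e)) ∩ cell e = B ∩ cell e := by
    ext x
    constructor
    · rintro ⟨⟨y, hy, hyx⟩, hx⟩
      rwa [injOn_toTorus hy.2 hx hyx] at hy
    · intro hx
      exact ⟨⟨x, hx, rfl⟩, hx.2⟩
  have hval : ∀ f : Plane → ℝ, ν f (toTorus e '' (B ∩ cell e))
      = ∫⁻ x in B, ENNReal.ofReal (f x) ∂(cellMeasure e) := fun f => by
    rw [Measure.map_apply hmeasT hT, withDensity_apply _ (hmeasT hT), cellMeasure,
      Measure.restrict_restrict (hmeasT hT), Measure.restrict_restrict hB, hpre]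
  have hEq : ∫⁻ x in B, ENNReal.ofReal (f x) ∂(cellMeasure e)
      = ∫⁻ x in B, ENNReal.ofReal (-f x) ∂(cellMeasure e) := by
    rw [← hval f, hν, hval fun x => -f x]
  rw [integral_eq_lintegral_pos_part_sub_lintegral_neg_part
    (Integrable.restrict (s := B) hf), hEq, sub_self]

end

section

/-! ### Parseval's identity and Fejér sums -/

variable {e : Module.Basis (Fin 2) ℝ Plane}

/-- The (unnormalized) Fourier coefficients of a function on the torus. -/
def coef (e : Module.Basis (Fin 2) ℝ Plane) (f : Plane → ℝ) (k : Fin 2 → ℤ) : ℂ :=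
  ∫ x in cell e, (f x : ℂ) * char e (-k) x

theorem memLp_char (k : Fin 2 → ℤ) : MemLp (char e k) 2 (cellMeasure e) :=
  MemLp.of_bound (continuous_char k).aestronglyMeasurable 1 (ae_of_all _ fun x => (norm_char k x).le)

/-- The normalized characters in `L²`. -/
def charLp (e : Module.Basis (Fin 2) ℝ Plane) (k : Fin 2 → ℤ) : Lp ℂ 2 (cellMeasure e) :=
  ((Real.sqrt (area e))⁻¹ : ℂ) • (memLp_char (e := e) k).toLp (char e k)

theorem inner_toLp_char (k : Fin 2 → ℤ) (F : Lp ℂ 2 (cellMeasure e)) :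
    inner ℂ ((memLp_char (e := e) k).toLp (char e k)) F = ∫ x in cell e, F x * char e (-k) x := by
  rw [L2.inner_def]
  refine integral_congr_ae ?_
  filter_upwards [(memLp_char (e := e) k).coeFn_toLp] with x hx
  rw [hx, RCLike.inner_apply, conj_char]

theorem inv_sqrt_area_mul_self :
    ((Real.sqrt (area e))⁻¹ : ℂ) * (((Real.sqrt (area e))⁻¹ : ℂ) * (area e : ℂ)) = 1 := by
  have h : Real.sqrt (area e) ≠ 0 := (Real.sqrt_pos.mpr (area_pos e)).ne'
  have h2 : (area e : ℂ) = (Real.sqrt (area e) : ℂ) * (Real.sqrt (area e) : ℂ) := by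
    rw [← Complex.ofReal_mul, Real.mul_self_sqrt (area_pos e).le]
  have h3 : (Real.sqrt (area e) : ℂ) ≠ 0 := by exact_mod_cast h
  rw [h2]; field_simp

theorem orthonormal_charLp : Orthonormal ℂ (charLp e) := by
  rw [orthonormal_iff_ite]
  intro k l
  rw [charLp, charLp, inner_smul_left, inner_smul_right, inner_toLp_char]
  have h1 : ∫ x in cell e, (memLp_char (e := e) l).toLp (char e l) x * char e (-k) x
      = ∫ x in cell e, char e l x * char e (-k) x := by
    refine integral_congr_ae ?_
    filter_upwards [(memLp_char (e := e) l).coeFn_toLp] with x hx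
    rw [hx]
  rw [h1, integral_char_mul_char]
  by_cases h : k = l
  · subst h
    rw [if_pos rfl, if_pos rfl, ← Complex.ofReal_inv, Complex.conj_ofReal, Complex.ofReal_inv]
    exact inv_sqrt_area_mul_self
  · rw [if_neg h, if_neg (Ne.symm h), mul_zero, mul_zero]

/-- As k runs over a set stable under negation, the conjugate of F has vanishing coefficients as
well; the uniqueness theorem for real functions applies to real and imaginary parts. -/
theorem integral_mul_char_eq_zero_of_orthogonal {F : Lp ℂ 2 (cellMeasure e)}
    (h : ∀ k, ∫ x in cell e, F x * char e (-k) x = 0) : F = 0 := by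
  have hFi : Integrable F (cellMeasure e) := (Lp.memLp F).integrable (by norm_num)
  have hint : ∀ k, Integrable (fun x => F x * char e k x) (cellMeasure e) := fun k =>
    hFi.mul_bdd (c := 1) (continuous_char k).aestronglyMeasurable
      (ae_of_all _ fun x => (norm_char k x).le)
  have hint' : ∀ k, Integrable (fun x => (starRingEnd ℂ) (F x) * char e k x) (cellMeasure e) :=
    fun k => (Complex.conjCLE.toContinuousLinearMap.integrable_comp hFi).mul_bdd (c := 1)
      (continuous_char k).aestronglyMeasurable (ae_of_all _ fun x => (norm_char k x).le)
  have h1 : ∀ k, ∫ x in cell e, F x * char e k x = 0 := fun k => by simpa using h (-k)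
  have h2 : ∀ k, ∫ x in cell e, (starRingEnd ℂ) (F x) * char e k x = 0 := fun k => by
    have h3 := congrArg (starRingEnd ℂ) (h1 (-k))
    rw [← integral_conj, map_zero] at h3
    simpa only [map_mul, conj_char, neg_neg] using h3
  have hre : (fun x => (F x).re) =ᵐ[cellMeasure e] 0 := by
    refine ae_eq_zero_of_integral_mul_char_eq_zero hFi.re fun k => ?_
    have h3 : ∀ x, (((F x).re : ℝ) : ℂ) * char e k x
        = 2⁻¹ * (F x * char e k x + (starRingEnd ℂ) (F x) * char e k x) := fun x => by
      rw [← add_mul, Complex.add_conj]; push_cast; ring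
    simp only [h3]
    rw [integral_const_mul, integral_add (hint k) (hint' k), h1, h2]; simp
  have him : (fun x => (F x).im) =ᵐ[cellMeasure e] 0 := by
    refine ae_eq_zero_of_integral_mul_char_eq_zero hFi.im fun k => ?_
    have h3 : ∀ x, (((F x).im : ℝ) : ℂ) * char e k x
        = (2 * Complex.I)⁻¹ * (F x * char e k x - (starRingEnd ℂ) (F x) * char e k x) := fun x => by
      rw [← sub_mul, Complex.sub_conj]
      have : Complex.I ≠ 0 := Complex.I_ne_zero
      push_cast; field_simp
    simp only [h3]
    rw [integral_const_mul, integral_sub (hint k) (hint' k), h1, h2]; simp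
  rw [Lp.eq_zero_iff_ae_eq_zero]
  filter_upwards [hre, him] with x hx hx'
  exact Complex.ext hx hx'

/-- The Fourier basis of `L²`. -/
def charBasis (e : Module.Basis (Fin 2) ℝ Plane) :
    HilbertBasis (Fin 2 → ℤ) ℂ (Lp ℂ 2 (cellMeasure e)) :=
  HilbertBasis.mkOfOrthogonalEqBot (orthonormal_charLp (e := e)) (by
    rw [Submodule.eq_bot_iff]
    intro F hF
    refine integral_mul_char_eq_zero_of_orthogonal fun k => ?_
    have h1 := (Submodule.mem_orthogonal _ _).mp hF (charLp e k)
      (Submodule.subset_span (Set.mem_range_self k))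
    rw [charLp, inner_smul_left, inner_toLp_char] at h1
    refine (mul_eq_zero.mp h1).resolve_left ?_
    have h : Real.sqrt (area e) ≠ 0 := (Real.sqrt_pos.mpr (area_pos e)).ne'
    simpa using h)

/-- The area on the right is there because the coefficients are not normalised. -/
theorem parseval {f : Plane → ℝ} (hf : MemLp f 2 (cellMeasure e)) :
    HasSum (fun k => ‖coef e f k‖ ^ 2) (area e * ∫ x in cell e, f x ^ 2) := by
  have hF : MemLp (fun x => (f x : ℂ)) 2 (cellMeasure e) := hf.ofReal
  set F := hF.toLp _ with hFdef
  have h1 := (charBasis e).hasSum_inner_mul_inner F F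
  have hcoef : ∀ k, inner ℂ (charBasis e k) F = ((Real.sqrt (area e))⁻¹ : ℂ) * coef e f k := by
    intro k
    rw [charBasis, HilbertBasis.coe_mkOfOrthogonalEqBot, charLp, inner_smul_left, inner_toLp_char,
      ← Complex.ofReal_inv, Complex.conj_ofReal, coef]
    congr 1
    refine integral_congr_ae ?_
    filter_upwards [hF.coeFn_toLp] with x hx
    rw [hx]
  have h2 : ∀ k, inner ℂ F (charBasis e k) * inner ℂ (charBasis e k) F
      = (((area e)⁻¹ * ‖coef e f k‖ ^ 2 : ℝ) : ℂ) := by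
    intro k
    rw [← inner_conj_symm, hcoef, Complex.conj_mul', ← Complex.ofReal_pow, norm_mul, mul_pow,
      ← Complex.ofReal_inv, Complex.norm_real, Real.norm_eq_abs, sq_abs, inv_pow, Real.sq_sqrt (area_pos e).le]
  have h3 : inner ℂ F F = ((∫ x in cell e, f x ^ 2 : ℝ) : ℂ) := by
    rw [L2.inner_def, ← integral_complex_ofReal]
    refine integral_congr_ae ?_
    filter_upwards [hF.coeFn_toLp] with x hx
    rw [hx, RCLike.inner_apply, Complex.conj_ofReal]
    push_cast; ring
  simp only [h2, h3] at h1
  have h4 := (Complex.hasSum_ofReal.mp h1).mul_left (area e)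
  refine h4.congr_fun fun k => ?_
  rw [← mul_assoc, mul_inv_cancel₀ (area_pos e).ne', one_mul]

/-- The index box of the Fejér sums. -/
def box (n : ℕ) : Finset (Fin 2 → ℤ) := Fintype.piFinset fun _ => Finset.Ico 0 ((n : ℤ) + 1)

theorem card_box (n : ℕ) : ((box n).card : ℝ) = ((n : ℝ) + 1) ^ 2 := by
  simp only [box, Fintype.card_piFinset, Int.card_Ico, sub_zero, Finset.prod_const,
    Finset.card_univ, Fintype.card_fin]
  rw [show ((n : ℤ) + 1).toNat = n + 1 by omega]
  push_cast; rfl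

def cosCoef (e : Module.Basis (Fin 2) ℝ Plane) (f : Plane → ℝ) (k : Fin 2 → ℤ) : ℝ :=
  ∫ x in cell e, f x * Real.cos (phase e k x)

def sinCoef (e : Module.Basis (Fin 2) ℝ Plane) (f : Plane → ℝ) (k : Fin 2 → ℤ) : ℝ :=
  ∫ x in cell e, f x * Real.sin (phase e k x)

theorem integrable_mul_continuous_periodic {f g : Plane → ℝ} (hf : IntegrableOn f (cell e))
    (hg : Continuous g) (hper : IsPeriodic e g) :
    Integrable (fun x => f x * g x) (cellMeasure e) := by
  obtain ⟨C, hC⟩ := hper.exists_bound hg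
  exact hf.mul_bdd (c := C) hg.aestronglyMeasurable (ae_of_all _ hC)

theorem cos_phase_eq (k : Fin 2 → ℤ) (x : Plane) : Real.cos (phase e k x) = (char e k x).re := by
  rw [char, Complex.exp_ofReal_mul_I_re]

theorem sin_phase_eq (k : Fin 2 → ℤ) (x : Plane) : Real.sin (phase e k x) = (char e k x).im := by
  rw [char, Complex.exp_ofReal_mul_I_im]

theorem isTest_cos_phase (k : Fin 2 → ℤ) : IsTest e fun x => Real.cos (phase e k x) where
  smooth := Real.contDiff_cos.comp (phase e k).contDiff
  periodic j x := by simp only [cos_phase_eq]; rw [char_periodic k j x]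

theorem isTest_sin_phase (k : Fin 2 → ℤ) : IsTest e fun x => Real.sin (phase e k x) where
  smooth := Real.contDiff_sin.comp (phase e k).contDiff
  periodic j x := by simp only [sin_phase_eq]; rw [char_periodic k j x]

theorem coef_eq {f : Plane → ℝ} (hf : IntegrableOn f (cell e)) (k : Fin 2 → ℤ) :
    coef e f k = cosCoef e f k - sinCoef e f k * Complex.I := by
  have hc := integrable_mul_continuous_periodic hf (isTest_cos_phase k).smooth.continuous
    (isTest_cos_phase k).isPeriodic
  have hs := integrable_mul_continuous_periodic hf (isTest_sin_phase k).smooth.continuous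
    (isTest_sin_phase k).isPeriodic
  rw [coef, cosCoef, sinCoef, ← integral_complex_ofReal, ← integral_complex_ofReal,
    ← integral_mul_const, ← integral_sub hc.ofReal (hs.ofReal.mul_const _)]
  congr 1; ext x
  rw [char, phase_neg_index, Complex.exp_mul_I]
  push_cast
  rw [Complex.cos_neg, Complex.sin_neg]
  ring

/-- The Fejér sums of a function on the torus. -/
def fejer (e : Module.Basis (Fin 2) ℝ Plane) (f : Plane → ℝ) (n : ℕ) (x : Plane) : ℝ :=
  (((n : ℝ) + 1) ^ 2 * area e)⁻¹ * ∑ j ∈ box n, ∑ l ∈ box n,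
    (cosCoef e f (j - l) * Real.cos (phase e (j - l) x)
      + sinCoef e f (j - l) * Real.sin (phase e (j - l) x))

theorem isTest_fejer (f : Plane → ℝ) (n : ℕ) : IsTest e (fejer e f n) where
  smooth := by
    refine contDiff_const.mul (ContDiff.sum fun j _ => ContDiff.sum fun l _ => ?_)
    exact (contDiff_const.mul (isTest_cos_phase _).smooth).add
      (contDiff_const.mul (isTest_sin_phase _).smooth)
  periodic k x := by
    simp only [fejer]
    congr 1
    refine Finset.sum_congr rfl fun j _ => Finset.sum_congr rfl fun l _ => ?_
    rw [(isTest_cos_phase (e := e) (j - l)).periodic k x,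
      (isTest_sin_phase (e := e) (j - l)).periodic k x]

theorem cosCoef_neg (f : Plane → ℝ) (k : Fin 2 → ℤ) : cosCoef e f (-k) = cosCoef e f k := by
  simp only [cosCoef, phase_neg_index, Real.cos_neg]

theorem sinCoef_neg (f : Plane → ℝ) (k : Fin 2 → ℤ) : sinCoef e f (-k) = -sinCoef e f k := by
  simp only [sinCoef, phase_neg_index, Real.sin_neg, mul_neg, integral_neg]

/-- The imaginary part of coefficient times character is odd in the index, and the double sum is
symmetric under exchange of j and l, so these parts cancel. -/
theorem fejer_eq_sum_char {f : Plane → ℝ} (hf : IntegrableOn f (cell e)) (n : ℕ) (x : Plane) :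
    (fejer e f n x : ℂ) = ((((n : ℝ) + 1) ^ 2 * area e : ℝ) : ℂ)⁻¹ * ∑ j ∈ box n, ∑ l ∈ box n,
      coef e f (j - l) * char e (j - l) x := by
  have hodd : ∑ j ∈ box n, ∑ l ∈ box n,
      (cosCoef e f (j - l) * Real.sin (phase e (j - l) x)
        - sinCoef e f (j - l) * Real.cos (phase e (j - l) x)) = 0 := by
    have h1 : ∀ k, cosCoef e f (-k) * Real.sin (phase e (-k) x)
        - sinCoef e f (-k) * Real.cos (phase e (-k) x)
        = -(cosCoef e f k * Real.sin (phase e k x) - sinCoef e f k * Real.cos (phase e k x)) := by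
      intro k
      rw [cosCoef_neg, sinCoef_neg, phase_neg_index, Real.sin_neg, Real.cos_neg]; ring
    refine self_eq_neg.mp ?_
    rw [← Finset.sum_neg_distrib]
    simp only [← Finset.sum_neg_distrib, ← h1, neg_sub]
    rw [Finset.sum_comm]
  have hterm : ∀ k, coef e f k * char e k x
      = ((cosCoef e f k * Real.cos (phase e k x) + sinCoef e f k * Real.sin (phase e k x) : ℝ) : ℂ)
        + ((cosCoef e f k * Real.sin (phase e k x)
          - sinCoef e f k * Real.cos (phase e k x) : ℝ) : ℂ) * Complex.I := by
    intro k
    rw [coef_eq hf, char, Complex.exp_mul_I]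
    push_cast
    linear_combination (-(sinCoef e f k : ℂ) * Complex.sin (phase e k x)) * Complex.I_sq
  simp only [hterm, Finset.sum_add_distrib, ← Finset.sum_mul]
  have hodd' : ∑ j ∈ box n, ∑ l ∈ box n,
      ((cosCoef e f (j - l) * Real.sin (phase e (j - l) x)
        - sinCoef e f (j - l) * Real.cos (phase e (j - l) x) : ℝ) : ℂ) = 0 := by
    exact_mod_cast hodd
  rw [hodd', zero_mul, add_zero, fejer]
  push_cast
  rfl

/-- The Fejér weights. -/
def fejerWeight (n : ℕ) (k : Fin 2 → ℤ) : ℝ :=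
  (((box n).filter fun j => j - k ∈ box n).card : ℝ) / ((n : ℝ) + 1) ^ 2

theorem fejerWeight_nonneg (n : ℕ) (k : Fin 2 → ℤ) : 0 ≤ fejerWeight n k := by
  unfold fejerWeight; positivity

theorem fejerWeight_le_one (n : ℕ) (k : Fin 2 → ℤ) : fejerWeight n k ≤ 1 := by
  refine div_le_one_of_le₀ ?_ (by positivity)
  rw [← card_box]
  exact_mod_cast Finset.card_filter_le _ _

/-- The box meets its translate in a smaller box, so for large n the weight is the product of the
factors 1 - |k_i|/(n+1). -/
theorem tendsto_fejerWeight (k : Fin 2 → ℤ) :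
    Tendsto (fun n => fejerWeight n k) atTop (𝓝 1) := by
  have hcard : ∀ n : ℕ, ((box n).filter fun j => j - k ∈ box n).card
      = ∏ i, (min ((n : ℤ) + 1) ((n : ℤ) + 1 + k i) - max 0 (k i)).toNat := by
    intro n
    have : ((box n).filter fun j => j - k ∈ box n)
        = Fintype.piFinset fun i => Finset.Ico (max 0 (k i)) (min ((n : ℤ) + 1) ((n : ℤ) + 1 + k i)) := by
      ext j
      simp only [box, Finset.mem_filter, Fintype.mem_piFinset, Finset.mem_Ico, Pi.sub_apply,
        ← forall_and]
      refine forall_congr' fun i => ?_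
      omega
    rw [this, Fintype.card_piFinset]
    simp
  have hev : ∀ᶠ n : ℕ in atTop, fejerWeight n k = ∏ i, (1 - |(k i : ℝ)| * (1 / ((n : ℝ) + 1))) := by
    filter_upwards [eventually_ge_atTop (∑ i, (k i).natAbs)] with n hn
    have hle : ∀ i, (k i).natAbs ≤ n := fun i =>
      (Finset.single_le_sum (f := fun i => (k i).natAbs) (fun _ _ => Nat.zero_le _)
        (Finset.mem_univ i)).trans hn
    have hprod : ((n : ℝ) + 1) ^ 2 = ∏ _i : Fin 2, ((n : ℝ) + 1) := by simp
    rw [fejerWeight, hcard, hprod]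
    push_cast
    rw [← Finset.prod_div_distrib]
    refine Finset.prod_congr rfl fun i _ => ?_
    have h1 : (((min ((n : ℤ) + 1) ((n : ℤ) + 1 + k i) - max 0 (k i)).toNat : ℤ))
        = (n : ℤ) + 1 - |k i| := by
      have := hle i
      rcases le_total 0 (k i) with h | h
      · rw [abs_of_nonneg h]; omega
      · rw [abs_of_nonpos h]; omega
    have h2 : (((min ((n : ℤ) + 1) ((n : ℤ) + 1 + k i) - max 0 (k i)).toNat : ℝ))
        = (n : ℝ) + 1 - |(k i : ℝ)| := by exact_mod_cast h1
    rw [h2]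
    have : (n : ℝ) + 1 ≠ 0 := by positivity
    field_simp
  have hlim : Tendsto (fun n : ℕ => ∏ i, (1 - |(k i : ℝ)| * (1 / ((n : ℝ) + 1)))) atTop
      (𝓝 (∏ i : Fin 2, (1 - |(k i : ℝ)| * 0))) :=
    tendsto_finsetProd _ fun i _ =>
      (tendsto_one_div_add_atTop_nhds_zero_nat.const_mul _).const_sub _
  simp only [mul_zero, sub_zero, Finset.prod_const_one] at hlim
  exact hlim.congr' (hev.mono fun n hn => hn.symm)

theorem coef_fejer {f : Plane → ℝ} (hf : IntegrableOn f (cell e)) (n : ℕ) (k : Fin 2 → ℤ) :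
    coef e (fejer e f n) k = fejerWeight n k * coef e f k := by
  have h0 : (area e : ℂ) ≠ 0 := by exact_mod_cast (area_pos e).ne'
  have hint : ∀ m, Integrable (fun x => coef e f m * (char e m x * char e (-k) x))
      (cellMeasure e) := fun m => by
    simp only [← char_add_index]
    refine Integrable.const_mul ?_ _
    exact Integrable.of_bound (continuous_char _).aestronglyMeasurable 1
      (ae_of_all _ fun x => (norm_char _ x).le)
  rw [coef]
  simp only [fejer_eq_sum_char hf, mul_assoc, Finset.sum_mul]
  rw [integral_const_mul, integral_finsetSum _ fun j _ => integrable_finsetSum _ fun l _ => hint _]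
  simp only [integral_finsetSum _ fun l _ => hint _, integral_const_mul, integral_char_mul_char]
  have h1 : ∀ j, ∑ l ∈ box n, coef e f (j - l) * (if j - l = k then (area e : ℂ) else 0)
      = if j - k ∈ box n then coef e f k * area e else 0 := by
    intro j
    have : ∀ l, coef e f (j - l) * (if j - l = k then (area e : ℂ) else 0)
        = if l = j - k then coef e f k * area e else 0 := by
      intro l
      by_cases h : j - l = k
      · rw [if_pos h, if_pos (by rw [← h]; abel), h]
      · rw [if_neg h, if_neg (fun h' => h (by rw [h']; abel)), mul_zero]
    simp only [this, Finset.sum_ite_eq']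
  simp only [h1]
  rw [← Finset.sum_filter, Finset.sum_const, nsmul_eq_mul, fejerWeight]
  push_cast
  field_simp

theorem coef_sub {f g : Plane → ℝ} (hf : IntegrableOn f (cell e)) (hg : IntegrableOn g (cell e))
    (k : Fin 2 → ℤ) : coef e (fun x => f x - g x) k = coef e f k - coef e g k := by
  rw [coef, coef, coef, ← integral_sub (integrable_mul_char hf _) (integrable_mul_char hg _)]
  congr 1; ext x; push_cast; ring

theorem MemLp.integrableOn_cell {f : Plane → ℝ} (hf : MemLp f 2 (cellMeasure e)) :
    IntegrableOn f (cell e) := hf.integrable (by norm_num)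

/-- Fejér sums converge in `L²`. -/
theorem tendsto_integral_sub_fejer_sq {f : Plane → ℝ} (hf : MemLp f 2 (cellMeasure e)) :
    Tendsto (fun n => ∫ x in cell e, (f x - fejer e f n x) ^ 2) atTop (𝓝 0) := by
  have hfi := MemLp.integrableOn_cell hf
  have hfej : ∀ n, MemLp (fejer e f n) 2 (cellMeasure e) := fun n =>
    (isTest_fejer f n).isLipPer.memLp 2
  have h1 : ∀ n, ∫ x in cell e, (f x - fejer e f n x) ^ 2
      = (area e)⁻¹ * ∑' k, (1 - fejerWeight n k) ^ 2 * ‖coef e f k‖ ^ 2 := by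
    intro n
    have h2 := (parseval (hf.sub (hfej n))).tsum_eq
    simp only [Pi.sub_def] at h2
    have h3 : ∀ k, ‖coef e (fun x => f x - fejer e f n x) k‖ ^ 2
        = (1 - fejerWeight n k) ^ 2 * ‖coef e f k‖ ^ 2 := by
      intro k
      rw [coef_sub hfi (MemLp.integrableOn_cell (hfej n)), coef_fejer hfi]
      have : coef e f k - fejerWeight n k * coef e f k
          = ((1 - fejerWeight n k : ℝ) : ℂ) * coef e f k := by push_cast; ring
      rw [this, norm_mul, mul_pow, Complex.norm_real, Real.norm_eq_abs, sq_abs]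
    simp only [h3] at h2
    rw [h2, ← mul_assoc, inv_mul_cancel₀ (area_pos e).ne', one_mul]
  simp only [h1]
  -- Dominated convergence for series: the factors lie in [0, 1] and tend to 0, and the Parseval
  -- series of f is the majorant.
  have h4 : Tendsto (fun n => ∑' k, (1 - fejerWeight n k) ^ 2 * ‖coef e f k‖ ^ 2) atTop
      (𝓝 (∑' k : Fin 2 → ℤ, (1 - 1) ^ 2 * ‖coef e f k‖ ^ 2)) := by
    refine tendsto_tsum_of_dominated_convergence (parseval hf).summable (fun k => ?_)
      (Eventually.of_forall fun n k => ?_)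
    · exact (((tendsto_fejerWeight k).const_sub 1).pow 2).mul_const _
    · have h5 := fejerWeight_nonneg n k
      have h6 := fejerWeight_le_one n k
      rw [Real.norm_eq_abs, abs_of_nonneg (by positivity)]
      exact mul_le_of_le_one_left (by positivity) (by nlinarith)
  simpa using h4.const_mul (area e)⁻¹

end

section

/-! ### Fourier analysis of Sobolev functions -/

variable {e : Module.Basis (Fin 2) ℝ Plane}

theorem partialDeriv_cos_phase (k : Fin 2 → ℤ) (i : Fin 2) (x : Plane) :
    partialDeriv i (fun x => Real.cos (phase e k x)) x
      = -(freq e k i * Real.sin (phase e k x)) := by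
  rw [partialDeriv, fderiv_cos (phase e k).differentiableAt, ContinuousLinearMap.fderiv]
  simp only [_root_.smul_apply, smul_eq_mul, freq]; ring

theorem partialDeriv_sin_phase (k : Fin 2 → ℤ) (i : Fin 2) (x : Plane) :
    partialDeriv i (fun x => Real.sin (phase e k x)) x
      = freq e k i * Real.cos (phase e k x) := by
  rw [partialDeriv, fderiv_sin (phase e k).differentiableAt, ContinuousLinearMap.fderiv]
  simp only [_root_.smul_apply, smul_eq_mul, freq]; ring

/-- Trigonometric polynomials with Fejér type summation. -/
def trigSum (e : Module.Basis (Fin 2) ℝ Plane) (n : ℕ) (a b : (Fin 2 → ℤ) → ℝ) (x : Plane) : ℝ :=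
  (((n : ℝ) + 1) ^ 2 * area e)⁻¹ * ∑ j ∈ box n, ∑ l ∈ box n,
    (a (j - l) * Real.cos (phase e (j - l) x) + b (j - l) * Real.sin (phase e (j - l) x))

theorem fejer_eq_trigSum (f : Plane → ℝ) (n : ℕ) :
    fejer e f n = trigSum e n (cosCoef e f) (sinCoef e f) := rfl

theorem partialDeriv_trigSum (n : ℕ) (a b : (Fin 2 → ℤ) → ℝ) (i : Fin 2) :
    partialDeriv i (trigSum e n a b)
      = trigSum e n (fun k => freq e k i * b k) (fun k => -(freq e k i * a k)) := by
  ext x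
  have hc : ∀ k, HasFDerivAt (fun x => Real.cos (phase e k x))
      (fderiv ℝ (fun x => Real.cos (phase e k x)) x) x := fun k =>
    ((isTest_cos_phase k).smooth.differentiable (by simp) x).hasFDerivAt
  have hs : ∀ k, HasFDerivAt (fun x => Real.sin (phase e k x))
      (fderiv ℝ (fun x => Real.sin (phase e k x)) x) x := fun k =>
    ((isTest_sin_phase k).smooth.differentiable (by simp) x).hasFDerivAt
  have h : HasFDerivAt (trigSum e n a b) ((((n : ℝ) + 1) ^ 2 * area e)⁻¹ • ∑ j ∈ box n, ∑ l ∈ box n,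
      (a (j - l) • fderiv ℝ (fun x => Real.cos (phase e (j - l) x)) x
        + b (j - l) • fderiv ℝ (fun x => Real.sin (phase e (j - l) x)) x)) x := by
    refine HasFDerivAt.const_mul (HasFDerivAt.fun_sum fun j _ => HasFDerivAt.fun_sum fun l _ => ?_) _
    exact ((hc _).const_mul _).add ((hs _).const_mul _)
  rw [partialDeriv, h.fderiv]
  simp only [_root_.smul_apply, _root_.sum_apply, _root_.add_apply, smul_eq_mul, trigSum]
  congr 1
  refine Finset.sum_congr rfl fun j _ => Finset.sum_congr rfl fun l _ => ?_
  have h1 := partialDeriv_cos_phase (e := e) (j - l) i x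
  have h2 := partialDeriv_sin_phase (e := e) (j - l) i x
  rw [partialDeriv] at h1 h2
  rw [h1, h2]; ring

theorem IsWeakPartial.cosCoef_eq {i : Fin 2} {f g : Plane → ℝ} (h : IsWeakPartial e i f g)
    (k : Fin 2 → ℤ) : cosCoef e g k = freq e k i * sinCoef e f k := by
  have h1 := h _ (isTest_cos_phase k)
  simp only [partialDeriv_cos_phase] at h1
  rw [cosCoef, sinCoef, ← integral_const_mul, ← neg_neg (∫ x in cell e, g x * _), ← h1,
    ← integral_neg]
  congr 1; ext x; ring

theorem IsWeakPartial.sinCoef_eq {i : Fin 2} {f g : Plane → ℝ} (h : IsWeakPartial e i f g)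
    (k : Fin 2 → ℤ) : sinCoef e g k = -(freq e k i * cosCoef e f k) := by
  have h1 := h _ (isTest_sin_phase k)
  simp only [partialDeriv_sin_phase] at h1
  rw [cosCoef, sinCoef, ← integral_const_mul, ← neg_neg (∫ x in cell e, g x * _), ← h1]
  congr 2; ext x; ring

/-- On coefficients both derivatives are multiplication by the wave vector, the weak one by testing
with cosines and sines. Hence one approximation serves a Sobolev function and its gradient at once.
-/
theorem IsWeakPartial.partialDeriv_fejer {i : Fin 2} {f g : Plane → ℝ} (h : IsWeakPartial e i f g)
    (n : ℕ) : partialDeriv i (fejer e f n) = fejer e g n := by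
  rw [fejer_eq_trigSum, fejer_eq_trigSum, partialDeriv_trigSum]
  congr 1
  · ext k; rw [h.cosCoef_eq]
  · ext k; rw [h.sinCoef_eq]

theorem norm_coef_sq {f : Plane → ℝ} (hf : IntegrableOn f (cell e)) (k : Fin 2 → ℤ) :
    ‖coef e f k‖ ^ 2 = cosCoef e f k ^ 2 + sinCoef e f k ^ 2 := by
  rw [coef_eq hf, ← Complex.normSq_eq_norm_sq, Complex.normSq_apply]
  simp; ring

theorem IsWeakPartial.norm_coef_sq {i : Fin 2} {f g : Plane → ℝ} (h : IsWeakPartial e i f g)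
    (hf : IntegrableOn f (cell e)) (hg : IntegrableOn g (cell e)) (k : Fin 2 → ℤ) :
    ‖coef e g k‖ ^ 2 = freq e k i ^ 2 * ‖coef e f k‖ ^ 2 := by
  rw [ChernSimons.norm_coef_sq hf, ChernSimons.norm_coef_sq hg, h.cosCoef_eq, h.sinCoef_eq]; ring

/-- The squared length of the wave vector. -/
def freqSq (e : Module.Basis (Fin 2) ℝ Plane) (k : Fin 2 → ℤ) : ℝ := ∑ i, freq e k i ^ 2

theorem freqSq_nonneg (k : Fin 2 → ℤ) : 0 ≤ freqSq e k := Finset.sum_nonneg fun _ _ => sq_nonneg _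

/-- The wave vector pairs with e_j to 2πk_j, so Cauchy–Schwarz bounds each k_j by its length times
‖e_j‖. -/
theorem exists_norm_sq_le_freqSq (e : Module.Basis (Fin 2) ℝ Plane) :
    ∃ C : ℝ, 0 < C ∧ ∀ k : Fin 2 → ℤ, ‖k‖ ^ 2 ≤ C * freqSq e k := by
  refine ⟨1 + ∑ j, ‖e j‖ ^ 2, by positivity, fun k => ?_⟩
  have hle : ∀ j, ‖k j‖ ≤ Real.sqrt ((1 + ∑ j, ‖e j‖ ^ 2) * freqSq e k) := by
    intro j
    refine Real.le_sqrt_of_sq_le ?_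
    have h1 : phase e k (e j) = ∑ i, (e j) i * freq e k i := by
      have : e j = ∑ i, (e j) i • EuclideanSpace.single i (1 : ℝ) := by
        ext l; fin_cases l <;> simp
      conv_lhs => rw [this, map_sum]
      simp only [map_smul, smul_eq_mul, freq]
    have h2 : (2 * Real.pi * (k j : ℝ)) ^ 2 ≤ ‖e j‖ ^ 2 * freqSq e k := by
      rw [← phase_basis e, h1, EuclideanSpace.real_norm_sq_eq]
      exact Finset.sum_mul_sq_le_sq_mul_sq _ _ _
    have h3 : ‖k j‖ ^ 2 ≤ (2 * Real.pi * (k j : ℝ)) ^ 2 := by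
      rw [Int.norm_eq_abs, sq_abs, mul_pow]
      have : (1 : ℝ) ≤ (2 * Real.pi) ^ 2 := by nlinarith [Real.pi_gt_three]
      exact le_mul_of_one_le_left (sq_nonneg _) this
    have h4 : ‖e j‖ ^ 2 ≤ 1 + ∑ j, ‖e j‖ ^ 2 := by
      have := Finset.single_le_sum (f := fun j => ‖e j‖ ^ 2) (fun _ _ => sq_nonneg _)
        (Finset.mem_univ j)
      linarith
    exact h3.trans (h2.trans (mul_le_mul_of_nonneg_right h4 (freqSq_nonneg k)))
  have h5 := (pi_norm_le_iff_of_nonneg (Real.sqrt_nonneg _)).mpr hle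
  calc ‖k‖ ^ 2 ≤ Real.sqrt ((1 + ∑ j, ‖e j‖ ^ 2) * freqSq e k) ^ 2 := by gcongr
    _ = _ := Real.sq_sqrt (mul_nonneg (by positivity) (freqSq_nonneg k))

theorem one_le_norm_of_ne_zero {k : Fin 2 → ℤ} (hk : k ≠ 0) : 1 ≤ ‖k‖ := by
  obtain ⟨j, hj⟩ := Function.ne_iff.mp hk
  refine le_trans ?_ (norm_le_pi_norm k j)
  rw [Int.norm_eq_abs]
  exact_mod_cast Int.one_le_abs hj

theorem tendsto_freqSq (e : Module.Basis (Fin 2) ℝ Plane) :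
    Tendsto (freqSq e) cofinite atTop := by
  obtain ⟨C, hC, h⟩ := exists_norm_sq_le_freqSq e
  have h1 : Tendsto (fun k : Fin 2 → ℤ => ‖k‖) cofinite atTop := by
    rw [← cocompact_eq_cofinite]; exact tendsto_norm_cocompact_atTop
  have h2 : Tendsto (fun k : Fin 2 → ℤ => C⁻¹ * ‖k‖ ^ 2) cofinite atTop :=
    Tendsto.const_mul_atTop (inv_pos.mpr hC) ((tendsto_pow_atTop two_ne_zero).comp h1)
  refine tendsto_atTop_mono (fun k => ?_) h2
  rw [inv_mul_le_iff₀ hC]; exact h k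

/-- The series of ‖k‖⁻⁴ over a rank-two lattice converges. This puts the background functions in L².
-/
theorem summable_inv_freqSq_sq (e : Module.Basis (Fin 2) ℝ Plane) :
    Summable fun k : Fin 2 → ℤ => (freqSq e k ^ 2)⁻¹ := by
  obtain ⟨C, hC, h⟩ := exists_norm_sq_le_freqSq e
  have h1 := (EisensteinSeries.summable_one_div_norm_rpow (k := 4) (by norm_num)).mul_left (C ^ 2)
  refine Summable.of_norm_bounded_eventually h1 ?_
  filter_upwards [(Set.finite_singleton (0 : Fin 2 → ℤ)).compl_mem_cofinite] with k hk
  have hk0 : 1 ≤ ‖k‖ := one_le_norm_of_ne_zero hk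
  have h2 := h k
  have hpos : 0 < freqSq e k := by
    by_contra hcon
    nlinarith [freqSq_nonneg (e := e) k]
  rw [Real.norm_eq_abs, abs_of_pos (by positivity), Real.rpow_neg (by positivity),
    show (4 : ℝ) = ((4 : ℕ) : ℝ) by norm_num, Real.rpow_natCast, inv_le_comm₀ (by positivity)
      (by positivity), mul_inv, inv_inv, inv_mul_le_iff₀ (by positivity)]
  nlinarith [mul_self_nonneg (‖k‖ ^ 2), mul_le_mul h2 h2 (by positivity) (by positivity)]

/-! ### The Sobolev space -/

namespace W12

theorem memLp_toFun (f : W12 e) : MemLp (W12.toFun f) 2 (cellMeasure e) := Lp.memLp _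

theorem memLp_grad (f : W12 e) (i : Fin 2) : MemLp (W12.grad f i) 2 (cellMeasure e) := Lp.memLp _

theorem isWeakPartial (f : W12 e) (i : Fin 2) : IsWeakPartial e i (W12.toFun f) (W12.grad f i) :=
  f.2 i

theorem toFun_sub (f g : W12 e) :
    W12.toFun (f - g) =ᵐ[cellMeasure e] fun x => W12.toFun f x - W12.toFun g x :=
  Lp.coeFn_sub f.1.fst g.1.fst

theorem toFun_add (f g : W12 e) :
    W12.toFun (f + g) =ᵐ[cellMeasure e] fun x => W12.toFun f x + W12.toFun g x :=
  Lp.coeFn_add f.1.fst g.1.fst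

theorem toFun_smul (c : ℝ) (f : W12 e) :
    W12.toFun (c • f) =ᵐ[cellMeasure e] fun x => c * W12.toFun f x :=
  Lp.coeFn_smul c f.1.fst

end W12

theorem norm_Lp_sq (f : Lp ℝ 2 (cellMeasure e)) : ‖f‖ ^ 2 = ∫ x in cell e, f x ^ 2 := by
  rw [← real_inner_self_eq_norm_sq, L2.inner_def]
  simp only [real_inner_self_eq_norm_sq, Real.norm_eq_abs, sq_abs]

/-- The Dirichlet energy. -/
def dirichlet (f : W12 e) : ℝ := ∑ i, ∫ x in cell e, W12.grad f i x ^ 2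

theorem W12.norm_sq (f : W12 e) :
    ‖f‖ ^ 2 = (∫ x in cell e, W12.toFun f x ^ 2) + dirichlet f := by
  rw [Submodule.coe_norm, WithLp.prod_norm_sq_eq_of_L2, PiLp.norm_sq_eq_of_L2, norm_Lp_sq]
  simp only [norm_Lp_sq, dirichlet]

theorem dirichlet_nonneg (f : W12 e) : 0 ≤ dirichlet f :=
  Finset.sum_nonneg fun _ _ => integral_nonneg fun _ => sq_nonneg _

theorem W12.integral_sq_le (f : W12 e) : ∫ x in cell e, W12.toFun f x ^ 2 ≤ ‖f‖ ^ 2 := by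
  rw [W12.norm_sq]; linarith [dirichlet_nonneg f]

theorem W12.dirichlet_le (f : W12 e) : dirichlet f ≤ ‖f‖ ^ 2 := by
  rw [W12.norm_sq]
  have : 0 ≤ ∫ x in cell e, W12.toFun f x ^ 2 := integral_nonneg fun _ => sq_nonneg _
  linarith

theorem W12.parseval_dirichlet (f : W12 e) :
    HasSum (fun k => freqSq e k * ‖coef e (W12.toFun f) k‖ ^ 2) (area e * dirichlet f) := by
  have h1 : ∀ i ∈ Finset.univ, HasSum (fun k => freq e k i ^ 2 * ‖coef e (W12.toFun f) k‖ ^ 2)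
      (area e * ∫ x in cell e, W12.grad f i x ^ 2) := fun i _ => by
    refine (parseval (W12.memLp_grad f i)).congr_fun fun k => ?_
    exact ((W12.isWeakPartial f i).norm_coef_sq (MemLp.integrableOn_cell (W12.memLp_toFun f))
      (MemLp.integrableOn_cell (W12.memLp_grad f i)) k).symm
  have h2 := hasSum_sum h1
  rw [← Finset.mul_sum] at h2
  refine h2.congr_fun fun k => ?_
  rw [freqSq, Finset.sum_mul]

theorem coef_zero {f : Plane → ℝ} : coef e f 0 = ((∫ x in cell e, f x : ℝ) : ℂ) := by
  simp only [coef, neg_zero, char_zero_index, mul_one]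
  exact integral_complex_ofReal

/-- Poincaré inequality. -/
theorem exists_poincare (e : Module.Basis (Fin 2) ℝ Plane) :
    ∃ C : ℝ, 0 < C ∧ ∀ f : W12 e, ∫ x in cell e, W12.toFun f x = 0 →
      ∫ x in cell e, W12.toFun f x ^ 2 ≤ C * dirichlet f := by
  obtain ⟨C, hC, h⟩ := exists_norm_sq_le_freqSq e
  refine ⟨C, hC, fun f hf => ?_⟩
  have h1 := parseval (W12.memLp_toFun f)
  have h2 := (W12.parseval_dirichlet f).mul_left C
  -- Compared term by term: the mean-zero condition removes k = 0, and every other index has 1 ≤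
  -- ‖k‖² ≤ C · `freqSq e k`.
  have h3 := hasSum_le (fun k => ?_) h1 h2
  · have := area_pos e
    have h4 : area e * ∫ x in cell e, W12.toFun f x ^ 2 ≤ area e * (C * dirichlet f) := by linarith
    exact le_of_mul_le_mul_left h4 this
  · by_cases hk : k = 0
    · subst hk
      rw [coef_zero, hf]; simp
    · rw [← mul_assoc]
      refine le_mul_of_one_le_left (sq_nonneg _) (le_trans ?_ (h k))
      have := one_le_norm_of_ne_zero hk
      nlinarith

/-- Rellich's theorem for vector valued functions on the torus. -/
theorem exists_subseq_cauchy_L2 {N : ℕ} (f : ℕ → Fin N → W12 e) {R : ℝ}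
    (hR : ∀ m j, ‖f m j‖ ≤ R) :
    ∃ σ : ℕ → ℕ, StrictMono σ ∧ ∀ ε > 0, ∃ n₀, ∀ m ≥ n₀, ∀ l ≥ n₀, ∀ j,
      ∫ x in cell e, W12.toFun (f (σ m) j - f (σ l) j) x ^ 2 < ε := by
  have hA := area_pos e
  let c : ℕ → (Fin N × (Fin 2 → ℤ)) → ℂ := fun m q => coef e (W12.toFun (f m q.1)) q.2
  have hR0 : ∀ m j, ‖f m j‖ ^ 2 ≤ R ^ 2 := fun m j => by
    have := hR m j
    gcongr
  have hbd : ∀ m, c m ∈ Set.pi Set.univ fun _ : Fin N × (Fin 2 → ℤ) =>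
      Metric.closedBall (0 : ℂ) (Real.sqrt (area e * R ^ 2)) := by
    intro m q _
    rw [mem_closedBall_zero_iff]
    refine Real.le_sqrt_of_sq_le ?_
    have h1 := parseval (W12.memLp_toFun (f m q.1))
    have h2 := le_hasSum h1 q.2 fun k _ => sq_nonneg _
    refine h2.trans (mul_le_mul_of_nonneg_left ?_ hA.le)
    exact (W12.integral_sq_le (f m q.1)).trans (hR0 m q.1)
  -- The coefficients of all components together lie in a countable product of discs, which is
  -- compact and metrisable; along a subsequence every coefficient converges.
  obtain ⟨c₀, _, σ, hσ, hlim⟩ :=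
    (isCompact_univ_pi fun _ => isCompact_closedBall (0 : ℂ) _).tendsto_subseq hbd
  refine ⟨σ, hσ, fun ε hε => ?_⟩
  -- outside a finite set of frequencies the energy controls the coefficients
  set δ : ℝ := ε / (8 * (R ^ 2 + 1)) with hδ
  have hδpos : 0 < δ := by positivity
  have hfin : {k | ¬ δ⁻¹ ≤ freqSq e k}.Finite := (tendsto_freqSq e).eventually_ge_atTop δ⁻¹
  set S := hfin.toFinset with hS
  have hcomp : ∀ q, CauchySeq fun m => c (σ m) q := fun q =>
    ((tendsto_pi_nhds.mp hlim) q).cauchySeq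
  -- After division by the area the low frequencies contribute at most ε/4 by the choice of η, and
  -- the tail at most ε/2 by the choice of δ, since differences have energy at most 4R².
  set η : ℝ := area e * ε / (4 * (S.card + 1)) with hη
  have hηpos : 0 < η := by positivity
  have hex : ∀ q : Fin N × (Fin 2 → ℤ), ∃ n₀, ∀ m ≥ n₀, ∀ l ≥ n₀,
      ‖c (σ m) q - c (σ l) q‖ ^ 2 < η := fun q => by
    obtain ⟨n₀, h⟩ := Metric.cauchySeq_iff.mp (hcomp q) (Real.sqrt η) (Real.sqrt_pos.mpr hηpos)
    refine ⟨n₀, fun m hm l hl => ?_⟩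
    have h1 := h m hm l hl
    rw [dist_eq_norm] at h1
    have := Real.sq_sqrt hηpos.le
    nlinarith [norm_nonneg (c (σ m) q - c (σ l) q), Real.sqrt_nonneg η]
  choose n₀ hn₀ using hex
  refine ⟨(Finset.univ ×ˢ S).sup n₀, fun m hm l hl j => ?_⟩
  set g := f (σ m) j - f (σ l) j with hg
  have hcoef : ∀ k, coef e (W12.toFun g) k = c (σ m) (j, k) - c (σ l) (j, k) := fun k => by
    rw [← coef_sub (MemLp.integrableOn_cell (W12.memLp_toFun _))
      (MemLp.integrableOn_cell (W12.memLp_toFun _)), coef, coef]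
    refine integral_congr_ae ?_
    filter_upwards [W12.toFun_sub (f (σ m) j) (f (σ l) j)] with x hx
    rw [hg, hx]
  have h1 := parseval (W12.memLp_toFun g)
  have h2 := (W12.parseval_dirichlet g).mul_left δ
  have h3 : HasSum (fun k => if k ∈ S then η else 0) (∑ k ∈ S, η) := by
    have h5 : HasSum (fun k => if k ∈ S then η else 0) (∑ k ∈ S, if k ∈ S then η else 0) :=
      hasSum_sum_of_ne_finset_zero fun k hk => if_neg hk
    rwa [Finset.sum_congr rfl fun k hk => if_pos hk] at h5
  have h4 := hasSum_le (fun k => ?_) h1 (h3.add h2)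
  · have hgn : dirichlet g ≤ 4 * R ^ 2 := by
      refine (W12.dirichlet_le g).trans ?_
      have h5 : ‖g‖ ≤ R + R := (norm_sub_le _ _).trans (add_le_add (hR _ _) (hR _ _))
      nlinarith [norm_nonneg g]
    rw [Finset.sum_const, nsmul_eq_mul] at h4
    have h6 : (S.card : ℝ) * η ≤ area e * (ε / 4) := by
      rw [hη]
      have : (S.card : ℝ) * (area e * ε / (4 * (S.card + 1)))
          = (area e * (ε / 4)) * (S.card / (S.card + 1)) := by field_simp
      rw [this]
      refine mul_le_of_le_one_right (by positivity) (div_le_one_of_le₀ (by linarith) (by positivity))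
    have h7 : δ * dirichlet g ≤ ε / 2 := by
      have : δ * dirichlet g ≤ δ * (4 * (R ^ 2 + 1)) :=
        mul_le_mul_of_nonneg_left (by linarith) hδpos.le
      refine this.trans (le_of_eq ?_)
      rw [hδ]; field_simp; ring
    have h8 : area e * ∫ x in cell e, W12.toFun g x ^ 2 ≤ area e * (ε / 4 + ε / 2) := by
      nlinarith
    have := le_of_mul_le_mul_left h8 hA
    linarith
  · have h9 : 0 ≤ δ * (freqSq e k * ‖coef e (W12.toFun g) k‖ ^ 2) :=
      mul_nonneg hδpos.le (mul_nonneg (freqSq_nonneg k) (sq_nonneg _))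
    by_cases hk : k ∈ S
    · rw [if_pos hk, hcoef]
      have h10 : n₀ (j, k) ≤ (Finset.univ ×ˢ S).sup n₀ :=
        Finset.le_sup (f := n₀) (Finset.mem_product.mpr ⟨Finset.mem_univ j, hk⟩)
      have h11 := hn₀ (j, k) m (h10.trans hm) l (h10.trans hl)
      rw [hcoef] at h9
      linarith
    · rw [if_neg hk, zero_add, ← mul_assoc]
      have h10 : δ⁻¹ ≤ freqSq e k := by
        by_contra hcon
        exact hk (hfin.mem_toFinset.mpr hcon)
      refine le_mul_of_one_le_left (sq_nonneg _) ?_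
      rwa [inv_le_iff_one_le_mul₀' hδpos] at h10

theorem continuous_integral_mul {ψ : Plane → ℝ} (hψ : MemLp ψ 2 (cellMeasure e)) :
    Continuous fun f : Lp ℝ 2 (cellMeasure e) => ∫ x in cell e, f x * ψ x := by
  have h : ∀ f : Lp ℝ 2 (cellMeasure e), ∫ x in cell e, f x * ψ x = inner ℝ (hψ.toLp ψ) f := by
    intro f
    rw [L2.inner_def]
    refine integral_congr_ae ?_
    filter_upwards [hψ.coeFn_toLp] with x hx
    rw [hx]; rfl
  simp only [h]
  fun_prop

/-- The defining identities are preserved under L² limits, because integration against a bounded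
function is continuous on L². -/
theorem isClosed_W12 (e : Module.Basis (Fin 2) ℝ Plane) : IsClosed (W12 e : Set (WithLp 2
    (Lp ℝ 2 (cellMeasure e) × PiLp 2 (fun _ : Fin 2 => Lp ℝ 2 (cellMeasure e))))) := by
  have h : (W12 e : Set (WithLp 2 (Lp ℝ 2 (cellMeasure e) ×
      PiLp 2 (fun _ : Fin 2 => Lp ℝ 2 (cellMeasure e)))))
      = ⋂ (i : Fin 2) (φ : Plane → ℝ) (_ : IsTest e φ),
        {f | ∫ x in cell e, f.fst x * partialDeriv i φ x = -∫ x in cell e, f.snd i x * φ x} := by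
    ext f
    simp only [Set.mem_iInter]
    rfl
  rw [h]
  refine isClosed_iInter fun i => isClosed_iInter fun φ => isClosed_iInter fun hφ => ?_
  refine isClosed_eq ?_ (Continuous.neg ?_)
  · exact (continuous_integral_mul ((hφ.partialDeriv i).isLipPer.memLp 2)).comp
      (WithLp.continuous_fst _ _ _)
  · exact (continuous_integral_mul (hφ.isLipPer.memLp 2)).comp
      ((PiLp.continuous_apply 2 _ i).comp (WithLp.continuous_snd _ _ _))

instance completeSpace_W12 (e : Module.Basis (Fin 2) ℝ Plane) : CompleteSpace (W12 e) :=
  (isClosed_W12 e).completeSpace_coe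

end

section

/-! ### Convergence in `L²` on the cell -/

variable {e : Module.Basis (Fin 2) ℝ Plane}

theorem integral_sq_eq_norm_toLp {f : Plane → ℝ} (hf : MemLp f 2 (cellMeasure e)) :
    ∫ x in cell e, f x ^ 2 = ‖hf.toLp f‖ ^ 2 := by
  rw [norm_Lp_sq]
  refine integral_congr_ae ?_
  filter_upwards [hf.coeFn_toLp] with x hx
  rw [hx]

/-- Cauchy–Schwarz on the cell. -/
theorem abs_integral_mul_le {f g : Plane → ℝ} (hf : MemLp f 2 (cellMeasure e))
    (hg : MemLp g 2 (cellMeasure e)) :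
    |∫ x in cell e, f x * g x|
      ≤ Real.sqrt (∫ x in cell e, f x ^ 2) * Real.sqrt (∫ x in cell e, g x ^ 2) := by
  have h : ∫ x in cell e, f x * g x = inner ℝ (hf.toLp f) (hg.toLp g) := by
    rw [L2.inner_def]
    refine integral_congr_ae ?_
    filter_upwards [hf.coeFn_toLp, hg.coeFn_toLp] with x hx hx'
    rw [hx, hx', real_inner_eq_re_inner, RCLike.inner_apply]
    simp [mul_comm]
  rw [h, integral_sq_eq_norm_toLp hf, integral_sq_eq_norm_toLp hg, Real.sqrt_sq (norm_nonneg _),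
    Real.sqrt_sq (norm_nonneg _)]
  exact abs_real_inner_le_norm _ _

theorem sq_integral_mul_le {f g : Plane → ℝ} (hf : MemLp f 2 (cellMeasure e))
    (hg : MemLp g 2 (cellMeasure e)) :
    (∫ x in cell e, f x * g x) ^ 2 ≤ (∫ x in cell e, f x ^ 2) * ∫ x in cell e, g x ^ 2 := by
  have h := abs_integral_mul_le hf hg
  have h1 : 0 ≤ ∫ x in cell e, f x ^ 2 := integral_nonneg fun _ => sq_nonneg _
  have h2 : 0 ≤ ∫ x in cell e, g x ^ 2 := integral_nonneg fun _ => sq_nonneg _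
  rw [← Real.sqrt_mul h1] at h
  have h3 := Real.sq_sqrt (mul_nonneg h1 h2)
  rw [← sq_abs, ← h3]
  gcongr

theorem sq_integral_abs_le {f : Plane → ℝ} (hf : MemLp f 2 (cellMeasure e)) :
    (∫ x in cell e, |f x|) ^ 2 ≤ area e * ∫ x in cell e, f x ^ 2 := by
  have h := sq_integral_mul_le (memLp_const (1 : ℝ)) hf.abs
  simp only [Pi.abs_apply, one_mul, sq_abs, one_pow] at h
  refine h.trans (le_of_eq ?_)
  congr 1
  simp [area, Measure.real]

theorem tendsto_integral_mul_of_L2 {f g : Plane → ℝ} {F : ℕ → Plane → ℝ}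
    (hf : MemLp f 2 (cellMeasure e)) (hF : ∀ n, MemLp (F n) 2 (cellMeasure e))
    (hg : MemLp g 2 (cellMeasure e))
    (h : Tendsto (fun n => ∫ x in cell e, (f x - F n x) ^ 2) atTop (𝓝 0)) :
    Tendsto (fun n => ∫ x in cell e, F n x * g x) atTop (𝓝 (∫ x in cell e, f x * g x)) := by
  rw [tendsto_iff_dist_tendsto_zero]
  have h1 : Tendsto (fun n => Real.sqrt (∫ x in cell e, (f x - F n x) ^ 2)
      * Real.sqrt (∫ x in cell e, g x ^ 2)) atTop (𝓝 0) := by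
    simpa using (h.sqrt).mul_const (Real.sqrt (∫ x in cell e, g x ^ 2))
  refine squeeze_zero (fun n => dist_nonneg) (fun n => ?_) h1
  have h2 : (∫ x in cell e, f x * g x) - ∫ x in cell e, F n x * g x
      = ∫ x in cell e, (f x - F n x) * g x := by
    simp only [sub_mul]
    exact (integral_sub (hf.integrable_mul hg) ((hF n).integrable_mul hg)).symm
  rw [dist_comm, Real.dist_eq, h2]
  exact abs_integral_mul_le (hf.sub (hF n)) hg

theorem tendsto_integral_sq_of_L2 {f : Plane → ℝ} {F : ℕ → Plane → ℝ}
    (hf : MemLp f 2 (cellMeasure e)) (hF : ∀ n, MemLp (F n) 2 (cellMeasure e))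
    (h : Tendsto (fun n => ∫ x in cell e, (f x - F n x) ^ 2) atTop (𝓝 0)) :
    Tendsto (fun n => ∫ x in cell e, F n x ^ 2) atTop (𝓝 (∫ x in cell e, f x ^ 2)) := by
  have h1 := (tendsto_integral_mul_of_L2 hf hF hf h).const_mul 2
  have h2 := (h.add h1).sub_const (∫ x in cell e, f x ^ 2)
  have e1 : 0 + 2 * (∫ x in cell e, f x * f x) - ∫ x in cell e, f x ^ 2
      = ∫ x in cell e, f x ^ 2 := by
    simp only [← sq]; ring
  rw [e1] at h2
  refine h2.congr fun n => ?_
  have hi1 : Integrable (fun x => (f x - F n x) ^ 2) (cellMeasure e) :=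
    (hf.sub (hF n)).integrable_sq
  have hi2 : Integrable (fun x => F n x * f x) (cellMeasure e) := (hF n).integrable_mul hf
  have hi3 := hf.integrable_sq
  have hi4 : Integrable (fun x => (f x - F n x) ^ 2 + 2 * (F n x * f x)) (cellMeasure e) :=
    hi1.add (hi2.const_mul 2)
  rw [← integral_const_mul, ← integral_add hi1 (hi2.const_mul 2), ← integral_sub hi4 hi3]
  congr 1; ext x
  ring

theorem tendsto_integral_abs_of_L2 {f : Plane → ℝ} {F : ℕ → Plane → ℝ}
    (hf : MemLp f 2 (cellMeasure e)) (hF : ∀ n, MemLp (F n) 2 (cellMeasure e))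
    (h : Tendsto (fun n => ∫ x in cell e, (f x - F n x) ^ 2) atTop (𝓝 0)) :
    Tendsto (fun n => ∫ x in cell e, |F n x|) atTop (𝓝 (∫ x in cell e, |f x|)) := by
  rw [tendsto_iff_dist_tendsto_zero]
  have h1 : Tendsto (fun n => Real.sqrt (area e * ∫ x in cell e, (f x - F n x) ^ 2)) atTop (𝓝 0) := by
    simpa using (h.const_mul (area e)).sqrt
  refine squeeze_zero (fun n => dist_nonneg) (fun n => ?_) h1
  rw [dist_comm, Real.dist_eq, ← integral_sub (MemLp.integrableOn_cell hf).abs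
    (MemLp.integrableOn_cell (hF n)).abs]
  refine Real.le_sqrt_of_sq_le (le_trans ?_ (sq_integral_abs_le (hf.sub (hF n))))
  have h2 : |∫ x in cell e, (|f x| - |F n x|)| ≤ ∫ x in cell e, |f x - F n x| := by
    refine (abs_integral_le_integral_abs).trans ?_
    refine integral_mono ?_ ?_ fun x => abs_abs_sub_abs_le _ _
    · exact ((MemLp.integrableOn_cell hf).abs.sub (MemLp.integrableOn_cell (hF n)).abs).abs
    · exact (MemLp.integrableOn_cell (hf.sub (hF n))).abs
  gcongr

/-- `L²`-convergence yields an almost everywhere convergent subsequence. -/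
theorem exists_subseq_ae_of_L2 {f : Plane → ℝ} {F : ℕ → Plane → ℝ}
    (hf : MemLp f 2 (cellMeasure e)) (hF : ∀ n, MemLp (F n) 2 (cellMeasure e))
    (h : Tendsto (fun n => ∫ x in cell e, (f x - F n x) ^ 2) atTop (𝓝 0)) :
    ∃ σ : ℕ → ℕ, StrictMono σ ∧
      ∀ᵐ x ∂(cellMeasure e), Tendsto (fun n => F (σ n) x) atTop (𝓝 (f x)) := by
  have h1 : Tendsto (fun n => eLpNorm (F n - f) 2 (cellMeasure e)) atTop (𝓝 0) := by
    have h2 : ∀ n, eLpNorm (F n - f) 2 (cellMeasure e)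
        = ENNReal.ofReal (Real.sqrt (∫ x in cell e, (f x - F n x) ^ 2)) := by
      intro n
      have h3 := integral_sq_eq_norm_toLp (hf.sub (hF n))
      simp only [Pi.sub_apply] at h3
      rw [h3, Real.sqrt_sq (norm_nonneg _), Lp.norm_toLp, ENNReal.ofReal_toReal
        (hf.sub (hF n)).2.ne, eLpNorm_sub_comm]
    simp only [h2]
    simpa using ENNReal.tendsto_ofReal h.sqrt
  exact (tendstoInMeasure_of_tendsto_eLpNorm (by norm_num) (fun n => (hF n).1) hf.1 h1).exists_seq_tendsto_ae

/-- Fatou's lemma along almost everywhere convergent sequences. -/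
theorem integrable_of_ae_tendsto_of_integral_le {f : Plane → ℝ} {F : ℕ → Plane → ℝ} {B : ℝ}
    (hF : ∀ n, Integrable (F n) (cellMeasure e)) (hF0 : ∀ n x, 0 ≤ F n x)
    (hB : ∀ n, ∫ x in cell e, F n x ≤ B)
    (h : ∀ᵐ x ∂(cellMeasure e), Tendsto (fun n => F n x) atTop (𝓝 (f x))) :
    Integrable f (cellMeasure e) ∧ ∫ x in cell e, f x ≤ B := by
  have hmeas : AEStronglyMeasurable f (cellMeasure e) :=
    aestronglyMeasurable_of_tendsto_ae atTop (fun n => (hF n).1) h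
  have hf0 : 0 ≤ᵐ[cellMeasure e] f := by
    filter_upwards [h] with x hx
    exact ge_of_tendsto' hx fun n => hF0 n x
  have hlint : ∫⁻ x in cell e, ENNReal.ofReal (f x) ≤ ENNReal.ofReal B := by
    have h1 : ∫⁻ x in cell e, ENNReal.ofReal (f x)
        ≤ ∫⁻ x in cell e, liminf (fun n => ENNReal.ofReal (F n x)) atTop := by
      refine lintegral_mono_ae ?_
      filter_upwards [h] with x hx
      exact (ENNReal.tendsto_ofReal hx).liminf_eq.ge
    refine h1.trans ((lintegral_liminf_le' fun n => (hF n).1.aemeasurable.ennreal_ofReal).trans ?_)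
    refine liminf_le_of_frequently_le' (Frequently.of_forall fun n => ?_)
    rw [← ofReal_integral_eq_lintegral_ofReal (hF n) (ae_of_all _ (hF0 n))]
    exact ENNReal.ofReal_le_ofReal (hB n)
  have hB0 : 0 ≤ B := (integral_nonneg (hF0 0)).trans (hB 0)
  refine ⟨⟨hmeas, ?_⟩, ?_⟩
  · rw [hasFiniteIntegral_iff_ofReal hf0]
    exact hlint.trans_lt ENNReal.ofReal_lt_top
  · rw [integral_eq_lintegral_of_nonneg_ae hf0 hmeas]
    exact ENNReal.toReal_le_of_le_ofReal hB0 hlint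

/-! ### The Gagliardo–Nirenberg–Sobolev inequality on the torus -/

-- By discreteness of the lattice only finitely many translates of the bounded set t meet the cell;
-- C is their number.
open scoped Pointwise in
theorem exists_lintegral_le_of_isBounded (e : Module.Basis (Fin 2) ℝ Plane) {t : Set Plane}
    (ht : Bornology.IsBounded t) :
    ∃ C : ℕ, ∀ g : Plane → ENNReal, IsPeriodic e g →
      ∫⁻ x in t, g x ≤ C * ∫⁻ x in cell e, g x := by
  set Γ := Submodule.span ℤ (Set.range e) with hΓ
  have hbd : Bornology.IsBounded (cell e - t) :=
    (ZSpan.fundamentalDomain_isBounded e).sub ht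
  have hfin := ZSpan.setFinite_inter e hbd
  have hfin' : {l : Γ | (l : Plane) ∈ cell e - t}.Finite := by
    refine Set.Finite.of_finite_image (f := Subtype.val) (hfin.subset ?_) Subtype.val_injective.injOn
    rintro _ ⟨l, hl, rfl⟩
    exact ⟨hl, l.2⟩
  refine ⟨hfin'.toFinset.card, fun g hg => ?_⟩
  rw [(isAddFundamentalDomain_cell e).setLIntegral_eq_tsum' g t]
  rw [tsum_eq_sum (s := hfin'.toFinset) fun l hl => ?_]
  · refine (Finset.sum_le_card_nsmul _ _ (∫⁻ x in cell e, g x) fun l _ => ?_).trans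
      (by rw [nsmul_eq_mul])
    refine le_trans (le_of_eq ?_) (lintegral_mono_set (Set.inter_subset_right (s := l +ᵥ t)))
    exact lintegral_congr fun x => hg.lattice_add (-l).2 x
  · have hempty : (l +ᵥ t) ∩ cell e = ∅ := by
      rw [Set.eq_empty_iff_forall_notMem]
      rintro x ⟨⟨y, hy, rfl⟩, hx⟩
      refine hl (hfin'.mem_toFinset.mpr ?_)
      refine ⟨_, hx, y, hy, ?_⟩
      simp only [vadd_eq_add]; abel
    rw [hempty]; simp

theorem norm_fderiv_le_sum (f : Plane → ℝ) (x : Plane) :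
    ‖fderiv ℝ f x‖ ≤ ∑ i, |partialDeriv i f x| := by
  refine ContinuousLinearMap.opNorm_le_bound _ (Finset.sum_nonneg fun _ _ => abs_nonneg _) fun y => ?_
  have h : y = ∑ i, y i • EuclideanSpace.single i (1 : ℝ) := by
    ext l; fin_cases l <;> simp
  conv_lhs => rw [h, map_sum]
  refine (norm_sum_le _ _).trans ?_
  rw [Finset.sum_mul]
  refine Finset.sum_le_sum fun i _ => ?_
  rw [map_smul, norm_smul, mul_comm]
  exact mul_le_mul le_rfl (PiLp.norm_apply_le y i) (norm_nonneg _) (abs_nonneg _)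

/-- The planar inequality bounding the L² norm by the L¹ norm of the gradient is applied to ηv, with
a cut-off η equal to 1 on the cell. The support of η is bounded, so periodicity brings the
right-hand side back to the cell. -/
theorem exists_gns_test (e : Module.Basis (Fin 2) ℝ Plane) :
    ∃ C : ℝ, 0 < C ∧ ∀ v : Plane → ℝ, IsTest e v →
      ∫ x in cell e, v x ^ 2
        ≤ (C * ((∫ x in cell e, |v x|) + ∑ i, ∫ x in cell e, |partialDeriv i v x|)) ^ 2 := by
  obtain ⟨R, hR0, hR⟩ := (ZSpan.fundamentalDomain_isBounded e).subset_closedBall_lt 0 0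
  let η : ContDiffBump (0 : Plane) := ⟨R, R + 1, hR0, by linarith⟩
  have hηsm : ContDiff ℝ 1 η := η.contDiff
  obtain ⟨B, hB⟩ := (hηsm.continuous_fderiv (by simp)).norm.bounded_above_of_compact_support
    (η.hasCompactSupport.fderiv (𝕜 := ℝ)).norm
  simp only [norm_norm] at hB
  have hB0 : 0 ≤ B := (norm_nonneg _).trans (hB 0)
  obtain ⟨M, hM⟩ := exists_lintegral_le_of_isBounded e (Metric.isBounded_closedBall (x := (0 : Plane)) (r := R + 1))
  set C₀ := eLpNormLESNormFDerivOneConst (volume : Measure Plane) ((2 : NNReal) : ℝ) with hC₀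
  -- The summand 1 only makes the constant positive.
  refine ⟨C₀ * M * (B + 1) + 1, by positivity, fun v hv => ?_⟩
  set G : Plane → ℝ := fun x => |v x| + ∑ i, |partialDeriv i v x| with hG
  have hG0 : ∀ x, 0 ≤ G x := fun x => add_nonneg (abs_nonneg _)
    (Finset.sum_nonneg fun _ _ => abs_nonneg _)
  have hGper : IsPeriodic e fun x => ENNReal.ofReal (G x) := fun k x => by
    simp only [hG, hv.periodic k x, hv.isPeriodic.partialDeriv _ k x]
  set u : Plane → ℝ := fun x => η x * v x with hu
  have husm : ContDiff ℝ 1 u := hηsm.mul (hv.smooth.of_le (by simp))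
  have hucs : HasCompactSupport u := η.hasCompactSupport.mul_right
  have hfin : NNReal.HolderConjugate (Module.finrank ℝ Plane : NNReal) 2 := by
    rw [finrank_euclideanSpace_fin]
    exact_mod_cast NNReal.HolderConjugate.two_two
  have h1 := eLpNorm_le_eLpNorm_fderiv_one (volume : Measure Plane) husm hucs hfin
  have h2 : eLpNorm v 2 (cellMeasure e) ≤ eLpNorm u 2 volume := by
    have h3 : eLpNorm v 2 (cellMeasure e) = eLpNorm u 2 (cellMeasure e) := by
      refine eLpNorm_congr_ae ?_
      filter_upwards [ae_restrict_mem (ZSpan.fundamentalDomain_measurableSet e)] with x hx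
      rw [hu]
      simp [η.one_of_mem_closedBall (hR hx)]
    rw [h3]
    exact eLpNorm_mono_measure _ Measure.restrict_le_self
  have hpt : ∀ x, ‖fderiv ℝ u x‖ ≤ (Metric.closedBall (0 : Plane) (R + 1)).indicator
      (fun x => (B + 1) * G x) x := by
    intro x
    by_cases hx : x ∈ Metric.closedBall (0 : Plane) (R + 1)
    · rw [Set.indicator_of_mem hx, hu, fderiv_fun_mul (hηsm.differentiable (by simp) x)
        (hv.smooth.differentiable (by simp) x)]
      refine (norm_add_le _ _).trans ?_
      rw [norm_smul, norm_smul, Real.norm_eq_abs, Real.norm_eq_abs, abs_of_nonneg η.nonneg]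
      have h3 : η x * ‖fderiv ℝ v x‖ ≤ 1 * ∑ i, |partialDeriv i v x| :=
        mul_le_mul η.le_one (norm_fderiv_le_sum v x) (norm_nonneg _) zero_le_one
      have h4 : |v x| * ‖fderiv ℝ η x‖ ≤ |v x| * B := mul_le_mul_of_nonneg_left (hB x) (abs_nonneg _)
      have h5 : 0 ≤ B * ∑ i, |partialDeriv i v x| :=
        mul_nonneg hB0 (Finset.sum_nonneg fun _ _ => abs_nonneg _)
      simp only [hG]
      nlinarith [abs_nonneg (v x)]
    · rw [Set.indicator_of_notMem hx]
      have h3 : x ∉ tsupport u := fun h => hx (by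
        have := tsupport_mul_subset_left h
        rwa [η.tsupport_eq] at this)
      rw [fderiv_of_notMem_tsupport (𝕜 := ℝ) h3, norm_zero]
  have h6 : eLpNorm (fderiv ℝ u) 1 volume
      ≤ M * (ENNReal.ofReal (B + 1) * ∫⁻ x in cell e, ENNReal.ofReal (G x)) := by
    rw [eLpNorm_one_eq_lintegral_enorm]
    calc ∫⁻ x, ‖fderiv ℝ u x‖ₑ ≤ ∫⁻ x, (Metric.closedBall (0 : Plane) (R + 1)).indicator
          (fun x => ENNReal.ofReal ((B + 1) * G x)) x := by
          refine lintegral_mono fun x => ?_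
          rw [← ofReal_norm]
          refine (ENNReal.ofReal_le_ofReal (hpt x)).trans (le_of_eq ?_)
          by_cases hx : x ∈ Metric.closedBall (0 : Plane) (R + 1)
          · rw [Set.indicator_of_mem hx, Set.indicator_of_mem hx]
          · rw [Set.indicator_of_notMem hx, Set.indicator_of_notMem hx, ENNReal.ofReal_zero]
      _ = ∫⁻ x in Metric.closedBall (0 : Plane) (R + 1), ENNReal.ofReal ((B + 1) * G x) :=
          lintegral_indicator Metric.isClosed_closedBall.measurableSet _
      _ ≤ M * ∫⁻ x in cell e, ENNReal.ofReal ((B + 1) * G x) := by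
          refine hM _ fun k x => ?_
          have := hGper k x
          simp only [ENNReal.ofReal_mul (by linarith : 0 ≤ B + 1), this]
      _ = _ := by
          congr 1
          simp only [ENNReal.ofReal_mul (by linarith : 0 ≤ B + 1)]
          rw [lintegral_const_mul']
          exact ENNReal.ofReal_ne_top
  have hvi : Integrable v (cellMeasure e) := MemLp.integrableOn_cell (hv.isLipPer.memLp 2)
  have hdi : ∀ i, Integrable (partialDeriv i v) (cellMeasure e) := fun i =>
    MemLp.integrableOn_cell (hv.isLipPer.memLp_partialDeriv i 2)
  have hGi : Integrable G (cellMeasure e) :=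
    hvi.abs.add (integrable_finsetSum _ fun i _ => (hdi i).abs)
  have hGint : ∫ x in cell e, G x
      = (∫ x in cell e, |v x|) + ∑ i, ∫ x in cell e, |partialDeriv i v x| := by
    rw [hG, integral_add hvi.abs (integrable_finsetSum _ fun i _ => (hdi i).abs),
      integral_finsetSum _ fun i _ => (hdi i).abs]
  rw [← ofReal_integral_eq_lintegral_ofReal hGi (ae_of_all _ hG0)] at h6
  have hGI0 : 0 ≤ ∫ x in cell e, G x := integral_nonneg hG0
  have h7 : eLpNorm v 2 (cellMeasure e)
      ≤ ENNReal.ofReal (C₀ * M * (B + 1) * ∫ x in cell e, G x) := by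
    refine (h2.trans h1).trans ((mul_le_mul_right h6 _).trans (le_of_eq ?_))
    rw [ENNReal.ofReal_mul (by positivity), ENNReal.ofReal_mul (by positivity),
      ENNReal.ofReal_mul (by positivity), ENNReal.ofReal_coe_nnreal, ENNReal.ofReal_natCast]
    ring
  have h8 := integral_sq_eq_norm_toLp (hv.isLipPer.memLp 2)
  rw [h8, Lp.norm_toLp, ← hGint]
  have h9 := ENNReal.toReal_le_of_le_ofReal (by positivity) h7
  have h10 : (eLpNorm v 2 (cellMeasure e)).toReal ≤ (C₀ * M * (B + 1) + 1) * ∫ x in cell e, G x :=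
    h9.trans (mul_le_mul_of_nonneg_right (by linarith) hGI0)
  gcongr

theorem exists_gns (e : Module.Basis (Fin 2) ℝ Plane) :
    ∃ C : ℝ, 0 < C ∧ ∀ f : W12 e,
      ∫ x in cell e, W12.toFun f x ^ 2
        ≤ (C * ((∫ x in cell e, |W12.toFun f x|) + ∑ i, ∫ x in cell e, |W12.grad f i x|)) ^ 2 := by
  obtain ⟨C, hC, h⟩ := exists_gns_test e
  refine ⟨C, hC, fun f => ?_⟩
  have hL : ∀ n, MemLp (fejer e (W12.toFun f) n) 2 (cellMeasure e) := fun n =>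
    (isTest_fejer _ n).isLipPer.memLp 2
  have hL' : ∀ i n, MemLp (fejer e (W12.grad f i) n) 2 (cellMeasure e) := fun i n =>
    (isTest_fejer _ n).isLipPer.memLp 2
  have h0 := tendsto_integral_sub_fejer_sq (W12.memLp_toFun f)
  have h0' := fun i => tendsto_integral_sub_fejer_sq (W12.memLp_grad f i)
  have h1 := tendsto_integral_sq_of_L2 (W12.memLp_toFun f) hL h0
  have h2 := tendsto_integral_abs_of_L2 (W12.memLp_toFun f) hL h0
  have h3 := fun i => tendsto_integral_abs_of_L2 (W12.memLp_grad f i) (hL' i) (h0' i)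
  have h4 := ((h2.add (tendsto_finsetSum Finset.univ fun i _ => h3 i)).const_mul C).pow 2
  refine le_of_tendsto_of_tendsto' h1 h4 fun n => ?_
  have h5 := h _ (isTest_fejer (W12.toFun f) n)
  simpa only [fun i => (W12.isWeakPartial f i).partialDeriv_fejer n] using h5

end

section

/-! ### The Moser–Trudinger inequality -/

variable {e : Module.Basis (Fin 2) ℝ Plane}

/-- The part of `v` between the levels `k` and `k + 1`. -/
def slice (v : Plane → ℝ) (k : ℕ) (x : Plane) : ℝ := max 0 (min (v x - k) 1)

theorem isLipPer_slice {v : Plane → ℝ} (hv : IsLipPer e v) (k : ℕ) : IsLipPer e (slice v k) := by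
  obtain ⟨C, hC⟩ := hv.lip
  refine ⟨⟨C, ?_⟩, fun j x => by simp only [slice, hv.periodic j x]⟩
  have h1 : LipschitzWith C fun x => v x - k := by
    refine LipschitzWith.of_dist_le_mul fun x y => ?_
    rw [dist_sub_right]
    exact hC.dist_le_mul x y
  exact (h1.min_const 1).const_max 0

theorem slice_nonneg (v : Plane → ℝ) (k : ℕ) (x : Plane) : 0 ≤ slice v k x := le_max_left _ _

theorem slice_le_one (v : Plane → ℝ) (k : ℕ) (x : Plane) : slice v k x ≤ 1 :=
  max_le zero_le_one (min_le_right _ _)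

theorem slice_eq_zero {v : Plane → ℝ} {k : ℕ} {x : Plane} (h : v x ≤ k) : slice v k x = 0 :=
  max_eq_left ((min_le_left _ _).trans (by linarith))

theorem slice_eq_one {v : Plane → ℝ} {k : ℕ} {x : Plane} (h : (k : ℝ) + 1 ≤ v x) :
    slice v k x = 1 := by
  rw [slice, min_eq_right (by linarith), max_eq_right zero_le_one]

/-- Where v ≤ k or v ≥ k + 1 the slice takes its extreme value 0 or 1, so `fderiv` vanishes there,
whether or not the slice is differentiable. Hence the formula holds at every point. -/
theorem partialDeriv_slice {v : Plane → ℝ} (hv : Continuous v) (k : ℕ) (i : Fin 2) (x : Plane) :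
    partialDeriv i (slice v k) x
      = if (k : ℝ) < v x ∧ v x < k + 1 then partialDeriv i v x else 0 := by
  split_ifs with h
  · have h1 : slice v k =ᶠ[𝓝 x] fun y => v y - k := by
      filter_upwards [hv.continuousAt.eventually (lt_mem_nhds h.1),
        hv.continuousAt.eventually (gt_mem_nhds h.2)] with y hy hy'
      rw [slice, min_eq_left (by linarith), max_eq_right (by linarith)]
    rw [partialDeriv, h1.fderiv_eq, fderiv_sub_const, partialDeriv]
  · rw [not_and_or, not_lt, not_lt] at h
    rcases h with h | h
    · have h1 : IsLocalMin (slice v k) x := Eventually.of_forall fun y => by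
        rw [slice_eq_zero h]; exact slice_nonneg v k y
      rw [partialDeriv, h1.fderiv_eq_zero]; rfl
    · have h1 : IsLocalMax (slice v k) x := Eventually.of_forall fun y => by
        rw [slice_eq_one h]; exact slice_le_one v k y
      rw [partialDeriv, h1.fderiv_eq_zero]; rfl

/-- The measure of the superlevel set. -/
def superlevel (e : Module.Basis (Fin 2) ℝ Plane) (v : Plane → ℝ) (k : ℕ) : ℝ :=
  ∫ x in cell e, if (k : ℝ) < v x then 1 else 0

/-- The Dirichlet energy between the levels `k` and `k + 1`. -/
def sliceEnergy (e : Module.Basis (Fin 2) ℝ Plane) (v : Plane → ℝ) (k : ℕ) : ℝ :=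
  ∑ i, ∫ x in cell e, partialDeriv i (slice v k) x ^ 2

theorem superlevel_nonneg (v : Plane → ℝ) (k : ℕ) : 0 ≤ superlevel e v k :=
  integral_nonneg fun x => by positivity

theorem sliceEnergy_nonneg (v : Plane → ℝ) (k : ℕ) : 0 ≤ sliceEnergy e v k :=
  Finset.sum_nonneg fun _ _ => integral_nonneg fun _ => sq_nonneg _

theorem memLp_superlevel {v : Plane → ℝ} (hv : Continuous v) (k : ℕ) (p : ENNReal) :
    MemLp (fun x => if (k : ℝ) < v x then (1 : ℝ) else 0) p (cellMeasure e) := by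
  refine MemLp.of_bound (C := 1) ?_ (ae_of_all _ fun x => ?_)
  · exact (Measurable.ite (measurableSet_lt measurable_const hv.measurable) measurable_const
      measurable_const).aestronglyMeasurable
  · split_ifs <;> simp

theorem superlevel_zero_le (v : Plane → ℝ) : superlevel e v 0 ≤ area e := by
  have h : area e = ∫ x in cell e, (1 : ℝ) := by simp [area, Measure.real]
  rw [h, superlevel]
  refine integral_mono_of_nonneg (ae_of_all _ fun x => by positivity) (integrable_const _)
    (ae_of_all _ fun x => ?_)
  dsimp only
  split_ifs <;> simp

/-- With m_k the measure of {v > k} and E_k the slice energy: the slice is 1 on {v > k+1} and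
vanishes off {v > k}. So m_{k+1} ≤ ∫ slice², and the Sobolev inequality with Cauchy–Schwarz on {v >
k} bounds this by a multiple of m_k² + m_k E_k. -/
theorem exists_superlevel_succ_le (e : Module.Basis (Fin 2) ℝ Plane) :
    ∃ C : ℝ, 0 < C ∧ ∀ v : Plane → ℝ, IsTest e v → ∀ k,
      superlevel e v (k + 1) ≤ C * (superlevel e v k + sliceEnergy e v k) * superlevel e v k := by
  obtain ⟨C, hC, h⟩ := exists_gns e
  refine ⟨3 * C ^ 2, by positivity, fun v hv k => ?_⟩
  have hc := hv.smooth.continuous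
  have hs := isLipPer_slice hv.isLipPer k
  have h1 := h hs.toW12
  have e1 : ∫ x in cell e, W12.toFun hs.toW12 x ^ 2 = ∫ x in cell e, slice v k x ^ 2 :=
    integral_congr_ae (hs.toFun_toW12.fun_comp fun t => t ^ 2)
  have e2 : ∫ x in cell e, |W12.toFun hs.toW12 x| = ∫ x in cell e, |slice v k x| :=
    integral_congr_ae (hs.toFun_toW12.fun_comp fun t => |t|)
  have e3 : ∀ i, ∫ x in cell e, |W12.grad hs.toW12 i x|
      = ∫ x in cell e, |partialDeriv i (slice v k) x| := fun i =>
    integral_congr_ae ((hs.grad_toW12 i).fun_comp fun t => |t|)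
  simp only [e1, e2, e3] at h1
  set m := superlevel e v k with hm
  have hm0 : 0 ≤ m := superlevel_nonneg v k
  have h2 : superlevel e v (k + 1) ≤ ∫ x in cell e, slice v k x ^ 2 := by
    refine integral_mono (MemLp.integrableOn_cell (memLp_superlevel hc _ 2))
      (hs.memLp 2).integrable_sq fun x => ?_
    dsimp only
    split_ifs with hx
    · push_cast at hx
      rw [slice_eq_one hx.le]; norm_num
    · positivity
  have h3 : ∫ x in cell e, |slice v k x| ≤ m := by
    refine integral_mono (MemLp.integrableOn_cell (hs.memLp 2)).abs
      (MemLp.integrableOn_cell (memLp_superlevel hc _ 2)) fun x => ?_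
    dsimp only
    split_ifs with hx
    · rw [abs_of_nonneg (slice_nonneg v k x)]; exact slice_le_one v k x
    · rw [slice_eq_zero (not_lt.mp hx), abs_zero]
  have h4 : ∀ i, (∫ x in cell e, |partialDeriv i (slice v k) x|) ^ 2
      ≤ m * ∫ x in cell e, partialDeriv i (slice v k) x ^ 2 := by
    intro i
    have h5 := sq_integral_mul_le (memLp_superlevel (e := e) hc k 2)
      (hs.memLp_partialDeriv i 2).abs
    have e1 : ∀ x, (if (k : ℝ) < v x then (1 : ℝ) else 0) * |partialDeriv i (slice v k) x|
        = |partialDeriv i (slice v k) x| := fun x => by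
      rw [partialDeriv_slice hc]
      by_cases hx : (k : ℝ) < v x
      · simp [hx]
      · simp [hx]
    have e2 : ∀ x, (if (k : ℝ) < v x then (1 : ℝ) else 0) ^ 2 = if (k : ℝ) < v x then (1 : ℝ) else 0 :=
      fun x => by split_ifs <;> simp
    simp only [Pi.abs_apply, sq_abs, e1, e2] at h5
    exact h5
  have h6 : (C * ((∫ x in cell e, |slice v k x|)
      + ∑ i, ∫ x in cell e, |partialDeriv i (slice v k) x|)) ^ 2
      ≤ 3 * C ^ 2 * (m + sliceEnergy e v k) * m := by
    simp only [Fin.sum_univ_two, sliceEnergy]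
    have ha : 0 ≤ ∫ x in cell e, |slice v k x| := integral_nonneg fun _ => abs_nonneg _
    have ha' : (∫ x in cell e, |slice v k x|) ^ 2 ≤ m ^ 2 := by gcongr
    have h40 := h4 0
    have h41 := h4 1
    set a := ∫ x in cell e, |slice v k x|
    set b := ∫ x in cell e, |partialDeriv 0 (slice v k) x|
    set c := ∫ x in cell e, |partialDeriv 1 (slice v k) x|
    have h7 : (a + (b + c)) ^ 2 ≤ 3 * (a ^ 2 + b ^ 2 + c ^ 2) := by
      nlinarith [sq_nonneg (a - b), sq_nonneg (b - c), sq_nonneg (a - c)]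
    rw [mul_pow]
    have h8 : C ^ 2 * (a + (b + c)) ^ 2 ≤ C ^ 2 * (3 * (m ^ 2
        + m * (∫ x in cell e, partialDeriv 0 (slice v k) x ^ 2)
        + m * (∫ x in cell e, partialDeriv 1 (slice v k) x ^ 2))) := by
      gcongr
      linarith
    refine h8.trans (le_of_eq ?_)
    ring
  exact h2.trans (h1.trans h6)

theorem sum_sliceEnergy_le {v : Plane → ℝ} (hv : IsTest e v) (J : ℕ) :
    ∑ k ∈ Finset.range J, sliceEnergy e v k ≤ ∑ i, ∫ x in cell e, partialDeriv i v x ^ 2 := by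
  simp only [sliceEnergy]
  rw [Finset.sum_comm]
  refine Finset.sum_le_sum fun i _ => ?_
  have hint : ∀ k, Integrable (fun x => partialDeriv i (slice v k) x ^ 2) (cellMeasure e) :=
    fun k => ((isLipPer_slice hv.isLipPer k).memLp_partialDeriv i 2).integrable_sq
  rw [← integral_finsetSum _ fun k _ => hint k]
  refine integral_mono (integrable_finsetSum _ fun k _ => hint k)
    (hv.isLipPer.memLp_partialDeriv i 2).integrable_sq fun x => ?_
  simp only [partialDeriv_slice hv.smooth.continuous]
  -- The level intervals are disjoint, so at most one slice has a nonzero derivative at x.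
  by_cases h : ∃ k₀ : ℕ, (k₀ : ℝ) < v x ∧ v x < k₀ + 1
  · obtain ⟨k₀, hk₀⟩ := h
    have h1 : ∀ k : ℕ, (if (k : ℝ) < v x ∧ v x < k + 1 then partialDeriv i v x else 0) ^ 2
        = if k = k₀ then partialDeriv i v x ^ 2 else 0 := by
      intro k
      by_cases hk : k = k₀
      · rw [hk, if_pos hk₀, if_pos rfl]
      · rw [if_neg hk, if_neg, zero_pow two_ne_zero]
        rintro ⟨ha, hb⟩
        have h2 : (k : ℝ) < k₀ + 1 := ha.trans hk₀.2
        have h3 : (k₀ : ℝ) < k + 1 := hk₀.1.trans hb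
        have h2' : k < k₀ + 1 := by exact_mod_cast h2
        have h3' : k₀ < k + 1 := by exact_mod_cast h3
        omega
    simp only [h1, Finset.sum_ite_eq']
    split_ifs
    · exact le_rfl
    · positivity
  · push Not at h
    have h1 : ∀ k : ℕ, ¬ ((k : ℝ) < v x ∧ v x < k + 1) := fun k hk => absurd hk.2 (h k hk.1).not_gt
    simp only [h1, if_false]
    simp; positivity

theorem sum_indicator_lt_le (t : ℝ) (J : ℕ) :
    ∑ k ∈ Finset.range J, (if (k : ℝ) < t then (1 : ℝ) else 0) ≤ |t| + 1 := by
  rw [Finset.sum_ite]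
  simp only [Finset.sum_const, nsmul_eq_mul, mul_one, mul_zero, add_zero]
  have h1 : (Finset.range J).filter (fun k : ℕ => (k : ℝ) < t) ⊆ Finset.range (⌈|t|⌉₊) := by
    intro k hk
    rw [Finset.mem_filter] at hk
    rw [Finset.mem_range, Nat.lt_ceil]
    exact hk.2.trans_le (le_abs_self t)
  have h2 := Finset.card_le_card h1
  rw [Finset.card_range] at h2
  have h3 : ((Finset.range J).filter (fun k : ℕ => (k : ℝ) < t)).card ≤ (⌈|t|⌉₊ : ℝ) := by
    exact_mod_cast h2
  exact h3.trans (Nat.ceil_lt_add_one (abs_nonneg t)).le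

theorem sum_superlevel_le {v : Plane → ℝ} (hv : IsTest e v) (J : ℕ) :
    ∑ k ∈ Finset.range J, superlevel e v k ≤ (∫ x in cell e, |v x|) + area e := by
  have hc := hv.smooth.continuous
  simp only [superlevel]
  rw [← integral_finsetSum _ fun k _ => MemLp.integrableOn_cell (memLp_superlevel hc k 2)]
  have h : area e = ∫ x in cell e, (1 : ℝ) := by simp [area, Measure.real]
  have hvi := (MemLp.integrableOn_cell (hv.isLipPer.memLp 2)).abs
  rw [h, ← integral_add hvi (integrable_const _)]
  exact integral_mono (integrable_finsetSum _ fun k _ =>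
    MemLp.integrableOn_cell (memLp_superlevel hc k 2)) (hvi.add (integrable_const _))
    fun x => sum_indicator_lt_le _ _

/-- For t > 0 the single term k = ⌈t⌉ - 1 already suffices. -/
theorem exp_mul_max_le_sum {q t : ℝ} (hq : 0 ≤ q) {J : ℕ} (ht : t ≤ J) :
    Real.exp (q * max t 0)
      ≤ 1 + ∑ k ∈ Finset.range J, Real.exp (q * (k + 1)) * (if (k : ℝ) < t then 1 else 0) := by
  have hnn : ∀ k ∈ Finset.range J,
      0 ≤ Real.exp (q * (k + 1)) * (if (k : ℝ) < t then (1 : ℝ) else 0) := fun k _ => by positivity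
  rcases le_or_gt t 0 with h | h
  · rw [max_eq_right h, mul_zero, Real.exp_zero]
    linarith [Finset.sum_nonneg hnn]
  · rw [max_eq_left h.le]
    set k := ⌈t⌉₊ - 1 with hk
    have hpos : 0 < ⌈t⌉₊ := Nat.ceil_pos.mpr h
    have hk1 : k + 1 = ⌈t⌉₊ := by omega
    have hkt : (k : ℝ) < t := Nat.lt_ceil.mp (by omega)
    have htk : t ≤ k + 1 := by
      have := Nat.le_ceil t
      rw [← hk1] at this; exact_mod_cast this
    have hkJ : k ∈ Finset.range J := by
      rw [Finset.mem_range]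
      exact_mod_cast hkt.trans_le ht
    have h1 := Finset.single_le_sum hnn hkJ
    rw [if_pos hkt, mul_one] at h1
    have h2 : Real.exp (q * t) ≤ Real.exp (q * (k + 1)) :=
      Real.exp_le_exp.mpr (mul_le_mul_of_nonneg_left htk hq)
    linarith

/-- Put a_k = m_k + E_k, so that m_{k+1} ≤ C a_k m_k and ∑ a_k ≤ P + |Ω|. With δ chosen so that Cδ =
exp(-(q+1)), one has C a ≤ exp(-(q+1)) exp(a/δ). Iteration gives m_k ≤ |Ω| exp(-(q+1)k)
exp((P+|Ω|)/δ), which beats the factor exp(qk) of the layer sum, for any q. -/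
theorem exists_exp_integral_le_test (e : Module.Basis (Fin 2) ℝ Plane) {q : ℝ} (hq : 0 ≤ q) :
    ∃ D : ℝ, 0 < D ∧ ∀ v : Plane → ℝ, IsTest e v →
      ∫ x in cell e, Real.exp (q * max (v x) 0)
        ≤ D * Real.exp (D * ((∫ x in cell e, |v x|)
          + ∑ i, ∫ x in cell e, partialDeriv i v x ^ 2)) := by
  obtain ⟨C, hC, hrec⟩ := exists_superlevel_succ_le e
  have hA := area_pos e
  set δ : ℝ := Real.exp (-(q + 1)) / C with hδ
  have hδpos : 0 < δ := by positivity
  set D : ℝ := δ⁻¹ + (area e + 2 * area e * Real.exp q * Real.exp (area e / δ)) with hD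
  refine ⟨D, by positivity, fun v hv => ?_⟩
  have hc := hv.smooth.continuous
  set P : ℝ := (∫ x in cell e, |v x|) + ∑ i, ∫ x in cell e, partialDeriv i v x ^ 2 with hP
  have hP0 : 0 ≤ P := add_nonneg (integral_nonneg fun _ => abs_nonneg _)
    (Finset.sum_nonneg fun _ _ => integral_nonneg fun _ => sq_nonneg _)
  set a : ℕ → ℝ := fun k => superlevel e v k + sliceEnergy e v k with ha
  have ha0 : ∀ k, 0 ≤ a k := fun k => add_nonneg (superlevel_nonneg v k) (sliceEnergy_nonneg v k)
  have hsum : ∀ J, ∑ k ∈ Finset.range J, a k ≤ P + area e := fun J => by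
    rw [ha, Finset.sum_add_distrib]
    linarith [sum_superlevel_le hv J, sum_sliceEnergy_le hv J]
  have hind : ∀ J, superlevel e v J ≤ area e * Real.exp (-(q + 1) * J)
      * Real.exp ((∑ k ∈ Finset.range J, a k) / δ) := by
    intro J
    induction J with
    | zero => simpa using superlevel_zero_le v
    | succ J ih =>
      have h1 := hrec v hv J
      have h2 : C * a J ≤ Real.exp (-(q + 1)) * Real.exp (a J / δ) := by
        have h3 : a J / δ ≤ Real.exp (a J / δ) := by
          linarith [Real.add_one_le_exp (a J / δ)]
        have h4 : a J = a J / δ * δ := by field_simp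
        have h5 : C * δ = Real.exp (-(q + 1)) := by rw [hδ]; field_simp
        calc C * a J = (C * δ) * (a J / δ) := by rw [h4]; field_simp
          _ ≤ _ := by rw [h5]; gcongr
      calc superlevel e v (J + 1) ≤ C * a J * superlevel e v J := h1
        _ ≤ (Real.exp (-(q + 1)) * Real.exp (a J / δ)) * (area e * Real.exp (-(q + 1) * J)
            * Real.exp ((∑ k ∈ Finset.range J, a k) / δ)) :=
            mul_le_mul h2 ih (superlevel_nonneg v J) (by positivity)
        _ = _ := by
            have e1 : Real.exp ((∑ k ∈ Finset.range (J + 1), a k) / δ)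
                = Real.exp ((∑ k ∈ Finset.range J, a k) / δ) * Real.exp (a J / δ) := by
              rw [Finset.sum_range_succ, add_div, Real.exp_add]
            have e2 : Real.exp (-(q + 1) * ((J + 1 : ℕ) : ℝ))
                = Real.exp (-(q + 1) * J) * Real.exp (-(q + 1)) := by
              rw [← Real.exp_add]; push_cast; ring_nf
            rw [e1, e2]; ring
  obtain ⟨B, hB⟩ := hv.isLipPer.exists_bound
  obtain ⟨J, hJ⟩ := exists_nat_ge B
  have hint : ∀ k : ℕ, Integrable (fun x => Real.exp (q * ((k : ℝ) + 1))
      * (if (k : ℝ) < v x then (1 : ℝ) else 0)) (cellMeasure e) := fun k =>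
    (MemLp.integrableOn_cell (memLp_superlevel hc k 2)).const_mul _
  have hone : Integrable (fun _ : Plane => (1 : ℝ)) (cellMeasure e) := integrable_const _
  have h1 : ∫ x in cell e, Real.exp (q * max (v x) 0)
      ≤ area e + ∑ k ∈ Finset.range J, Real.exp (q * (k + 1)) * superlevel e v k := by
    have h2 : ∫ x in cell e, Real.exp (q * max (v x) 0) ≤ ∫ x in cell e, ((1 : ℝ)
        + ∑ k ∈ Finset.range J, Real.exp (q * (k + 1)) * (if (k : ℝ) < v x then 1 else 0)) :=
      integral_mono_of_nonneg (ae_of_all _ fun x => (Real.exp_pos _).le)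
        (hone.add (integrable_finsetSum _ fun k _ => hint k))
        (ae_of_all _ fun x => exp_mul_max_le_sum hq (((le_abs_self _).trans (hB x)).trans hJ))
    refine h2.trans (le_of_eq ?_)
    rw [integral_add hone (integrable_finsetSum _ fun k _ => hint k),
      integral_finsetSum _ fun k _ => hint k]
    congr 1
    · simp [area, Measure.real]
    · exact Finset.sum_congr rfl fun k _ => integral_const_mul _ _
  have h3 : ∀ k : ℕ, Real.exp (q * ((k : ℝ) + 1)) * superlevel e v k
      ≤ area e * Real.exp q * Real.exp ((P + area e) / δ) * Real.exp (-1) ^ k := by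
    intro k
    have h4 : superlevel e v k ≤ area e * Real.exp (-(q + 1) * k) * Real.exp ((P + area e) / δ) := by
      refine (hind k).trans ?_
      gcongr
      exact hsum k
    calc Real.exp (q * ((k : ℝ) + 1)) * superlevel e v k
        ≤ Real.exp (q * ((k : ℝ) + 1))
          * (area e * Real.exp (-(q + 1) * k) * Real.exp ((P + area e) / δ)) := by gcongr
      _ = area e * Real.exp ((P + area e) / δ)
          * (Real.exp (q * ((k : ℝ) + 1)) * Real.exp (-(q + 1) * k)) := by ring
      _ = area e * Real.exp ((P + area e) / δ) * (Real.exp q * Real.exp (-1) ^ k) := by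
          rw [← Real.exp_add, ← Real.exp_nat_mul, ← Real.exp_add]; ring_nf
      _ = _ := by ring
  have h5 : ∑ k ∈ Finset.range J, Real.exp (-1) ^ k ≤ 2 := by
    have h6 : Real.exp (-1) ≤ 1 / 2 := by
      rw [Real.exp_neg, one_div]
      exact inv_anti₀ (by norm_num) (by linarith [Real.add_one_le_exp (1 : ℝ)])
    calc ∑ k ∈ Finset.range J, Real.exp (-1) ^ k ≤ ∑ k ∈ Finset.range J, (1 / 2 : ℝ) ^ k :=
          Finset.sum_le_sum fun k _ => pow_le_pow_left₀ (Real.exp_pos _).le h6 k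
      _ ≤ ∑' k, (1 / 2 : ℝ) ^ k :=
          summable_geometric_two.sum_le_tsum _ fun k _ => by positivity
      _ = 2 := tsum_geometric_two
  have h7 : ∫ x in cell e, Real.exp (q * max (v x) 0)
      ≤ area e + 2 * area e * Real.exp q * Real.exp (area e / δ) * Real.exp (δ⁻¹ * P) := by
    refine h1.trans (add_le_add le_rfl ((Finset.sum_le_sum fun k _ => h3 k).trans ?_))
    rw [← Finset.mul_sum]
    refine (mul_le_mul_of_nonneg_left h5 (by positivity)).trans (le_of_eq ?_)
    rw [add_div, Real.exp_add, div_eq_inv_mul P δ]; ring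
  have h8 : Real.exp (δ⁻¹ * P) ≤ Real.exp (D * P) := by
    refine Real.exp_le_exp.mpr (mul_le_mul_of_nonneg_right ?_ hP0)
    rw [hD]
    have : 0 ≤ area e + 2 * area e * Real.exp q * Real.exp (area e / δ) := by positivity
    linarith
  have h9 : 1 ≤ Real.exp (D * P) := Real.one_le_exp (by positivity)
  have hDi : 0 < δ⁻¹ := by positivity
  calc ∫ x in cell e, Real.exp (q * max (v x) 0)
      ≤ area e + 2 * area e * Real.exp q * Real.exp (area e / δ) * Real.exp (δ⁻¹ * P) := h7
    _ ≤ area e * Real.exp (D * P)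
        + 2 * area e * Real.exp q * Real.exp (area e / δ) * Real.exp (D * P) := by
        gcongr
        exact le_mul_of_one_le_right hA.le h9
    _ = (area e + 2 * area e * Real.exp q * Real.exp (area e / δ)) * Real.exp (D * P) := by ring
    _ ≤ D * Real.exp (D * P) := by
        gcongr
        rw [hD]; linarith

theorem continuous_exp_mul_max (q : ℝ) : Continuous fun t : ℝ => Real.exp (q * max t 0) := by
  fun_prop

theorem exists_exp_integral_max_le (e : Module.Basis (Fin 2) ℝ Plane) {q : ℝ} (hq : 0 ≤ q) (R : ℝ) :
    ∃ C : ℝ, ∀ f : W12 e, ‖f‖ ≤ R →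
      Integrable (fun x => Real.exp (q * max (W12.toFun f x) 0)) (cellMeasure e) ∧
        ∫ x in cell e, Real.exp (q * max (W12.toFun f x) 0) ≤ C := by
  obtain ⟨D, hD, h⟩ := exists_exp_integral_le_test e hq
  -- The bounds for the Fejér sums converge to at most the first summand; the added 1 makes them
  -- eventually smaller than the total, and Fatou's lemma passes to f.
  refine ⟨D * Real.exp (D * (Real.sqrt (area e * R ^ 2) + R ^ 2)) + 1, fun f hf => ?_⟩
  have hR2 : ‖f‖ ^ 2 ≤ R ^ 2 := by gcongr
  set F : ℕ → Plane → ℝ := fun n => fejer e (W12.toFun f) n with hFdef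
  have htest : ∀ n, IsTest e (F n) := fun n => isTest_fejer _ n
  have hL : ∀ n, MemLp (F n) 2 (cellMeasure e) := fun n => (htest n).isLipPer.memLp 2
  have hL' : ∀ i n, MemLp (fejer e (W12.grad f i) n) 2 (cellMeasure e) := fun i n =>
    (isTest_fejer _ n).isLipPer.memLp 2
  have h0 := tendsto_integral_sub_fejer_sq (W12.memLp_toFun f)
  have h2 := tendsto_integral_abs_of_L2 (W12.memLp_toFun f) hL h0
  have h3 := fun i => tendsto_integral_sq_of_L2 (W12.memLp_grad f i) (hL' i)
    (tendsto_integral_sub_fejer_sq (W12.memLp_grad f i))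
  have h4 := (Real.continuous_exp.tendsto _).comp
    ((h2.add (tendsto_finsetSum Finset.univ fun i _ => h3 i)).const_mul D)
  have h5 := h4.const_mul D
  have hlim : D * Real.exp (D * ((∫ x in cell e, |W12.toFun f x|) + dirichlet f))
      < D * Real.exp (D * (Real.sqrt (area e * R ^ 2) + R ^ 2)) + 1 := by
    refine lt_of_le_of_lt ?_ (lt_add_one _)
    have h6 : ∫ x in cell e, |W12.toFun f x| ≤ Real.sqrt (area e * R ^ 2) := by
      refine Real.le_sqrt_of_sq_le ((sq_integral_abs_le (W12.memLp_toFun f)).trans ?_)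
      exact mul_le_mul_of_nonneg_left ((W12.integral_sq_le f).trans hR2) (area_pos e).le
    have h7 := (W12.dirichlet_le f).trans hR2
    gcongr
  obtain ⟨σ, hσ, hae⟩ := exists_subseq_ae_of_L2 (W12.memLp_toFun f) hL h0
  have hev := (h5.comp hσ.tendsto_atTop).eventually (gt_mem_nhds hlim)
  obtain ⟨n₀, hn₀⟩ := eventually_atTop.mp hev
  refine integrable_of_ae_tendsto_of_integral_le
    (F := fun n x => Real.exp (q * max (F (σ (n + n₀)) x) 0)) (fun n => ?_)
    (fun n x => (Real.exp_pos _).le) (fun n => ?_) ?_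
  · obtain ⟨B, hB⟩ := (htest (σ (n + n₀))).isLipPer.exists_bound
    refine Integrable.of_bound
      ((continuous_exp_mul_max q).comp (htest _).smooth.continuous).aestronglyMeasurable
      (Real.exp (q * max B 0)) (ae_of_all _ fun x => ?_)
    rw [Real.norm_eq_abs, Real.abs_exp]
    exact Real.exp_le_exp.mpr (mul_le_mul_of_nonneg_left
      (max_le_max_right 0 ((le_abs_self _).trans (hB x))) hq)
  · refine (h _ (htest (σ (n + n₀)))).trans (le_trans (le_of_eq ?_) (hn₀ (n + n₀) (by omega)).le)
    simp only [Function.comp, hFdef, fun i => (W12.isWeakPartial f i).partialDeriv_fejer]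
  · filter_upwards [hae] with x hx
    exact ((continuous_exp_mul_max q).tendsto _).comp (hx.comp (tendsto_add_atTop_nat n₀))

/-- The Moser–Trudinger inequality on bounded sets of `W12`. -/
theorem exists_exp_integral_le (e : Module.Basis (Fin 2) ℝ Plane) {q : ℝ} (hq : 0 ≤ q) (R : ℝ) :
    ∃ C : ℝ, ∀ f : W12 e, ‖f‖ ≤ R →
      Integrable (fun x => Real.exp (q * |W12.toFun f x|)) (cellMeasure e) ∧
        ∫ x in cell e, Real.exp (q * |W12.toFun f x|) ≤ C := by
  obtain ⟨C, hC⟩ := exists_exp_integral_max_le e hq R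
  refine ⟨C + C, fun f hf => ?_⟩
  have h1 := hC f hf
  have h2 := hC ((-1 : ℝ) • f) (by rw [norm_smul]; simpa using hf)
  have hneg : (fun x => Real.exp (q * max (W12.toFun ((-1 : ℝ) • f) x) 0))
      =ᵐ[cellMeasure e] fun x => Real.exp (q * max (-W12.toFun f x) 0) := by
    filter_upwards [W12.toFun_smul (-1) f] with x hx
    rw [hx, neg_one_mul]
  rw [integrable_congr hneg, integral_congr_ae hneg] at h2
  have hle : ∀ x, Real.exp (q * |W12.toFun f x|)
      ≤ Real.exp (q * max (W12.toFun f x) 0) + Real.exp (q * max (-W12.toFun f x) 0) := by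
    intro x
    rcases abs_cases (W12.toFun f x) with ⟨h, h'⟩ | ⟨h, h'⟩
    · rw [h, max_eq_left h']; linarith [Real.exp_pos (q * max (-W12.toFun f x) 0)]
    · rw [h, max_eq_left (by linarith : 0 ≤ -W12.toFun f x)]
      linarith [Real.exp_pos (q * max (W12.toFun f x) 0)]
  have hmeas : AEStronglyMeasurable (fun x => Real.exp (q * |W12.toFun f x|)) (cellMeasure e) :=
    (show Continuous fun t : ℝ => Real.exp (q * |t|) by fun_prop).comp_aestronglyMeasurable
      (W12.memLp_toFun f).1
  have hi : Integrable (fun x => Real.exp (q * |W12.toFun f x|)) (cellMeasure e) :=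
    (h1.1.add h2.1).mono' hmeas (ae_of_all _ fun x => by
      rw [Real.norm_eq_abs, Real.abs_exp]; exact hle x)
  refine ⟨hi, ?_⟩
  calc ∫ x in cell e, Real.exp (q * |W12.toFun f x|)
      ≤ ∫ x in cell e, (Real.exp (q * max (W12.toFun f x) 0)
        + Real.exp (q * max (-W12.toFun f x) 0)) := integral_mono hi (h1.1.add h2.1) hle
    _ = _ := integral_add h1.1 h2.1
    _ ≤ C + C := add_le_add h1.2 h2.2

end

section

/-! ### Regularity of the background functions -/

variable {e : Module.Basis (Fin 2) ℝ Plane}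

theorem laplacian_cos_phase (k : Fin 2 → ℤ) (x : Plane) :
    (Δ fun x => Real.cos (phase e k x)) x = -(freqSq e k * Real.cos (phase e k x)) := by
  rw [InnerProductSpace.laplacian_eq_iteratedFDeriv_orthonormalBasis _
    (EuclideanSpace.basisFun (Fin 2) ℝ)]
  have h1 : (fderiv ℝ fun x => Real.cos (phase e k x)) = fun y => -Real.sin (phase e k y) • phase e k := by
    ext y : 1
    rw [fderiv_cos (phase e k).differentiableAt, ContinuousLinearMap.fderiv]
  have h2 : HasFDerivAt (fun y => -Real.sin (phase e k y) • phase e k)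
      ((-(Real.cos (phase e k x) • phase e k)).smulRight (phase e k)) x := by
    have h3 : HasFDerivAt (fun y => -Real.sin (phase e k y))
        (-(Real.cos (phase e k x) • phase e k)) x := (phase e k).hasFDerivAt.sin.neg
    exact h3.smul_const (phase e k)
  simp only [iteratedFDeriv_two_apply, h1, h2.fderiv]
  simp [freqSq, freq]; ring

theorem laplacian_sin_phase (k : Fin 2 → ℤ) (x : Plane) :
    (Δ fun x => Real.sin (phase e k x)) x = -(freqSq e k * Real.sin (phase e k x)) := by
  rw [InnerProductSpace.laplacian_eq_iteratedFDeriv_orthonormalBasis _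
    (EuclideanSpace.basisFun (Fin 2) ℝ)]
  have h1 : (fderiv ℝ fun x => Real.sin (phase e k x)) = fun y => Real.cos (phase e k y) • phase e k := by
    ext y : 1
    rw [fderiv_sin (phase e k).differentiableAt, ContinuousLinearMap.fderiv]
  have h2 : HasFDerivAt (fun y => Real.cos (phase e k y) • phase e k)
      ((-Real.sin (phase e k x) • phase e k).smulRight (phase e k)) x := by
    have h3 : HasFDerivAt (fun y => Real.cos (phase e k y))
        (-Real.sin (phase e k x) • phase e k) x := (phase e k).hasFDerivAt.cos
    exact h3.smul_const (phase e k)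
  simp only [iteratedFDeriv_two_apply, h1, h2.fderiv]
  simp [freqSq, freq]; ring

theorem integral_cos_phase {k : Fin 2 → ℤ} (hk : k ≠ 0) :
    ∫ x in cell e, Real.cos (phase e k x) = 0 := by
  have h := congrArg Complex.re (integral_char (e := e) k)
  rw [if_neg hk, ← RCLike.re_eq_complex_re, ← integral_re] at h
  · simp only [cos_phase_eq]; simpa using h
  · exact (memLp_char k).integrable (by norm_num)

theorem integral_sin_phase {k : Fin 2 → ℤ} (hk : k ≠ 0) :
    ∫ x in cell e, Real.sin (phase e k x) = 0 := by
  have h := congrArg Complex.im (integral_char (e := e) k)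
  rw [if_neg hk, ← RCLike.im_eq_complex_im, ← integral_im] at h
  · simp only [sin_phase_eq]; simpa using h
  · exact (memLp_char k).integrable (by norm_num)

theorem freqSq_zero : freqSq e 0 = 0 := by simp [freqSq, freq, phase_zero_index]

theorem freqSq_pos {k : Fin 2 → ℤ} (hk : k ≠ 0) : 0 < freqSq e k := by
  obtain ⟨C, hC, h⟩ := exists_norm_sq_le_freqSq e
  have h1 := one_le_norm_of_ne_zero hk
  have h2 := h k
  by_contra hcon
  nlinarith [freqSq_nonneg (e := e) k]

/-- An integrable function with square summable Fourier coefficients is square integrable. -/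
theorem memLp_two_of_summable_coef {f : Plane → ℝ} (hf : IntegrableOn f (cell e))
    (h : Summable fun k => ‖coef e f k‖ ^ 2) : MemLp f 2 (cellMeasure e) := by
  have hs : ((Real.sqrt (area e) : ℝ) : ℂ) ≠ 0 := by
    exact_mod_cast (Real.sqrt_pos.mpr (area_pos e)).ne'
  have hmem : Memℓp (fun k => ((Real.sqrt (area e))⁻¹ : ℂ) * coef e f k) 2 := by
    refine memℓp_gen ?_
    simp only [norm_mul, ENNReal.toReal_ofNat, Real.rpow_two, mul_pow]
    exact h.mul_left _
  -- Riesz–Fischer gives an L² function with the coefficients of f; uniqueness in L¹ identifies f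
  -- with its real part.
  set F : Lp ℂ 2 (cellMeasure e) := (charBasis e).repr.symm ⟨_, hmem⟩ with hF
  have hFk : ∀ k, ∫ x in cell e, F x * char e (-k) x = coef e f k := by
    intro k
    have h1 : (charBasis e).repr F k = ((Real.sqrt (area e))⁻¹ : ℂ) * coef e f k := by
      rw [hF, LinearIsometryEquiv.apply_symm_apply]
    rw [HilbertBasis.repr_apply_apply, charBasis, HilbertBasis.coe_mkOfOrthogonalEqBot, charLp,
      inner_smul_left, inner_toLp_char, ← Complex.ofReal_inv, Complex.conj_ofReal,
      Complex.ofReal_inv] at h1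
    exact mul_left_cancel₀ (inv_ne_zero hs) h1
  have hFi : Integrable F (cellMeasure e) := (Lp.memLp F).integrable (by norm_num)
  have hint : ∀ k, Integrable (fun x => F x * char e k x) (cellMeasure e) := fun k =>
    hFi.mul_bdd (c := 1) (continuous_char k).aestronglyMeasurable
      (ae_of_all _ fun x => (norm_char k x).le)
  have hint' : ∀ k, Integrable (fun x => (starRingEnd ℂ) (F x) * char e k x) (cellMeasure e) :=
    fun k => (Complex.conjCLE.toContinuousLinearMap.integrable_comp hFi).mul_bdd (c := 1)
      (continuous_char k).aestronglyMeasurable (ae_of_all _ fun x => (norm_char k x).le)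
  have hconj : ∀ k, ∫ x in cell e, (starRingEnd ℂ) (F x) * char e (-k) x = coef e f k := by
    intro k
    have h1 := congrArg (starRingEnd ℂ) (hFk (-k))
    rw [← integral_conj, coef, ← integral_conj] at h1
    rw [coef]
    simpa only [map_mul, conj_char, neg_neg, Complex.conj_ofReal] using h1
  have hre : ∀ k, coef e (fun x => (F x).re) k = coef e f k := by
    intro k
    have h3 : ∀ x, (((F x).re : ℝ) : ℂ) * char e (-k) x
        = 2⁻¹ * (F x * char e (-k) x + (starRingEnd ℂ) (F x) * char e (-k) x) := fun x => by
      rw [← add_mul, Complex.add_conj]; push_cast; ring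
    rw [coef]
    simp only [h3]
    rw [integral_const_mul, integral_add (hint _) (hint' _), hFk, hconj]; ring
  have hrem : MemLp (fun x => (F x).re) 2 (cellMeasure e) := (Lp.memLp F).re
  have h0 := ae_eq_zero_of_integral_mul_char_eq_zero (e := e)
    (f := fun x => f x - (F x).re) (hf.sub (MemLp.integrableOn_cell hrem)) fun k => by
      have h4 := coef_sub hf (MemLp.integrableOn_cell hrem) (-k)
      rw [hre, sub_self, coef, neg_neg] at h4
      exact h4
  refine (memLp_congr_ae ?_).mpr hrem
  filter_upwards [h0] with x hx
  exact sub_eq_zero.mp hx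

namespace IsBackground

variable {n : ℕ} {p : Fin n → Plane} {u : Plane → ℝ}

theorem freqSq_mul_cosCoef (hu : IsBackground e p u) {k : Fin 2 → ℤ} (hk : k ≠ 0) :
    freqSq e k * cosCoef e u k = -(4 * Real.pi * ∑ s, Real.cos (phase e k (p s))) := by
  have h := hu.equation _ (isTest_cos_phase k)
  simp only [laplacian_cos_phase, integral_cos_phase hk, mul_zero, sub_zero] at h
  rw [← h, cosCoef, ← integral_const_mul, ← integral_neg]
  congr 1; ext x; ring

theorem freqSq_mul_sinCoef (hu : IsBackground e p u) {k : Fin 2 → ℤ} (hk : k ≠ 0) :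
    freqSq e k * sinCoef e u k = -(4 * Real.pi * ∑ s, Real.sin (phase e k (p s))) := by
  have h := hu.equation _ (isTest_sin_phase k)
  simp only [laplacian_sin_phase, integral_sin_phase hk, mul_zero, sub_zero] at h
  rw [← h, sinCoef, ← integral_const_mul, ← integral_neg]
  congr 1; ext x; ring

/-- The equation bounds each cosine and sine coefficient, multiplied by the squared frequency, by
4πn, and the squares of the inverse squared frequencies are summable. -/
theorem memLp_two (hu : IsBackground e p u) : MemLp u 2 (cellMeasure e) := by
  refine memLp_two_of_summable_coef hu.integrable ?_
  refine Summable.of_norm_bounded_eventually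
    ((summable_inv_freqSq_sq e).mul_left (2 * (4 * Real.pi * n) ^ 2)) ?_
  filter_upwards [(Set.finite_singleton (0 : Fin 2 → ℤ)).compl_mem_cofinite] with k hk
  have hk0 : k ≠ 0 := hk
  have hpos := freqSq_pos (e := e) hk0
  have hc : |∑ s, Real.cos (phase e k (p s))| ≤ n := by
    refine (Finset.abs_sum_le_sum_abs _ _).trans ?_
    refine (Finset.sum_le_sum fun s _ => Real.abs_cos_le_one _).trans ?_
    simp
  have hs : |∑ s, Real.sin (phase e k (p s))| ≤ n := by
    refine (Finset.abs_sum_le_sum_abs _ _).trans ?_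
    refine (Finset.sum_le_sum fun s _ => Real.abs_sin_le_one _).trans ?_
    simp
  have hpi := Real.pi_pos
  have h1 : (freqSq e k * cosCoef e u k) ^ 2 ≤ (4 * Real.pi * n) ^ 2 := by
    rw [hu.freqSq_mul_cosCoef hk0, neg_sq]
    refine sq_le_sq.mpr ?_
    rw [abs_mul, abs_of_pos (by positivity), abs_of_nonneg (by positivity : 0 ≤ 4 * Real.pi * (n : ℝ))]
    exact mul_le_mul_of_nonneg_left hc (by positivity)
  have h2 : (freqSq e k * sinCoef e u k) ^ 2 ≤ (4 * Real.pi * n) ^ 2 := by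
    rw [hu.freqSq_mul_sinCoef hk0, neg_sq]
    refine sq_le_sq.mpr ?_
    rw [abs_mul, abs_of_pos (by positivity), abs_of_nonneg (by positivity : 0 ≤ 4 * Real.pi * (n : ℝ))]
    exact mul_le_mul_of_nonneg_left hs (by positivity)
  rw [Real.norm_eq_abs, abs_of_nonneg (by positivity), norm_coef_sq hu.integrable,
    ← div_eq_mul_inv, le_div_iff₀ (by positivity)]
  linarith

/-- The Laplacian of the Fejér sums of a background function is bounded below. -/
theorem laplacian_fejer_ge (hu : IsBackground e p u) (m : ℕ) (x : Plane) :
    -(4 * Real.pi * n / area e)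
      ≤ ∑ i, partialDeriv i (partialDeriv i (fejer e u m)) x := by
  have hA := area_pos e
  have hpi := Real.pi_pos
  have h1 : ∑ i, partialDeriv i (partialDeriv i (fejer e u m)) x
      = (((m : ℝ) + 1) ^ 2 * area e)⁻¹ * ∑ j ∈ box m, ∑ l ∈ box m,
        (-(freqSq e (j - l) * cosCoef e u (j - l)) * Real.cos (phase e (j - l) x)
          - freqSq e (j - l) * sinCoef e u (j - l) * Real.sin (phase e (j - l) x)) := by
    simp only [fejer_eq_trigSum, partialDeriv_trigSum, trigSum]
    rw [← Finset.mul_sum, Finset.sum_comm]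
    congr 1
    refine Finset.sum_congr rfl fun j _ => ?_
    rw [Finset.sum_comm]
    refine Finset.sum_congr rfl fun l _ => ?_
    simp only [freqSq, Fin.sum_univ_two]; ring
  -- Away from k = 0 the equation yields the coefficients of the point masses; the indicator at k =
  -- 0 removes their constant mode, matching the neutralising term -4πn/|Ω|.
  have h2 : ∀ k, -(freqSq e k * cosCoef e u k) * Real.cos (phase e k x)
      - freqSq e k * sinCoef e u k * Real.sin (phase e k x)
      = 4 * Real.pi * ∑ s, (Real.cos (phase e k (x - p s)) - if k = 0 then 1 else 0) := by
    intro k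
    by_cases hk : k = 0
    · subst hk
      simp [freqSq_zero, phase_zero_index]
    · rw [hu.freqSq_mul_cosCoef hk, hu.freqSq_mul_sinCoef hk]
      simp only [if_neg hk, sub_zero, map_sub, Real.cos_sub, Finset.sum_add_distrib,
        ← Finset.mul_sum]
      ring
  simp only [h2] at h1
  -- Positivity of the Fejér kernel: the double sum is the squared modulus of the sum of the
  -- characters over the box.
  have h3 : ∀ y : Plane, 0 ≤ ∑ j ∈ box m, ∑ l ∈ box m, Real.cos (phase e (j - l) y) := by
    intro y
    have : ∑ j ∈ box m, ∑ l ∈ box m, Real.cos (phase e (j - l) y)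
        = (∑ j ∈ box m, Real.cos (phase e j y)) ^ 2 + (∑ j ∈ box m, Real.sin (phase e j y)) ^ 2 := by
      simp only [phase_sub_index, Real.cos_sub, Finset.sum_add_distrib, sq, Finset.sum_mul_sum]
    rw [this]; positivity
  have h4 : ∑ j ∈ box m, ∑ l ∈ box m, (if j - l = 0 then (1 : ℝ) else 0) = ((m : ℝ) + 1) ^ 2 := by
    simp only [sub_eq_zero, Finset.sum_ite_eq]
    rw [Finset.sum_ite_mem, Finset.inter_self, Finset.sum_const, nsmul_eq_mul, mul_one, card_box]
  have h5 : ∑ j ∈ box m, ∑ l ∈ box m, 4 * Real.pi * ∑ s,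
      (Real.cos (phase e (j - l) (x - p s)) - if j - l = 0 then 1 else 0)
      = 4 * Real.pi * ∑ s, ((∑ j ∈ box m, ∑ l ∈ box m, Real.cos (phase e (j - l) (x - p s)))
        - ((m : ℝ) + 1) ^ 2) := by
    simp only [← Finset.mul_sum]
    congr 1
    rw [← h4]
    simp only [← Finset.sum_sub_distrib]
    rw [Finset.sum_comm]
    conv_rhs => rw [Finset.sum_comm]
    rw [Finset.sum_comm]
    refine Finset.sum_congr rfl fun j _ => ?_
    rw [Finset.sum_comm]
  have h6 : -(n * ((m : ℝ) + 1) ^ 2) ≤ ∑ s, ((∑ j ∈ box m, ∑ l ∈ box m,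
      Real.cos (phase e (j - l) (x - p s))) - ((m : ℝ) + 1) ^ 2) := by
    have : -((n : ℝ) * ((m : ℝ) + 1) ^ 2) = ∑ _s : Fin n, -(((m : ℝ) + 1) ^ 2) := by simp
    rw [this]
    exact Finset.sum_le_sum fun s _ => by linarith [h3 (x - p s)]
  rw [h1, h5]
  have h7 : -(4 * Real.pi * n / area e)
      = (((m : ℝ) + 1) ^ 2 * area e)⁻¹ * (4 * Real.pi * -(n * ((m : ℝ) + 1) ^ 2)) := by
    have : (m : ℝ) + 1 ≠ 0 := by positivity
    field_simp
  rw [h7]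
  gcongr

/-- Weak form of the lower bound on the Laplacian. -/
theorem integral_grad_fejer_mul_le (hu : IsBackground e p u) (m : ℕ) {ψ : Plane → ℝ}
    (hψ : IsLipPer e ψ) (hψ0 : ∀ x, 0 ≤ ψ x) :
    ∑ i, ∫ x in cell e, partialDeriv i (fejer e u m) x * partialDeriv i ψ x
      ≤ 4 * Real.pi * n / area e * ∫ x in cell e, ψ x := by
  have ht : IsTest e (fejer e u m) := isTest_fejer u m
  have h1 : ∀ i, ∫ x in cell e, partialDeriv i (fejer e u m) x * partialDeriv i ψ x
      = -∫ x in cell e, partialDeriv i (partialDeriv i (fejer e u m)) x * ψ x := fun i =>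
    (ht.partialDeriv i).isLipPer.integral_mul_partialDeriv hψ i
  have hint : ∀ i, Integrable (fun x => partialDeriv i (partialDeriv i (fejer e u m)) x * ψ x)
      (cellMeasure e) := fun i =>
    (((ht.partialDeriv i).partialDeriv i).isLipPer.memLp 2).integrable_mul (hψ.memLp 2)
  simp only [h1]
  rw [Finset.sum_neg_distrib, ← integral_finsetSum _ fun i _ => hint i, ← integral_neg,
    ← integral_const_mul]
  refine integral_mono (integrable_finsetSum _ fun i _ => hint i).neg
    ((MemLp.integrableOn_cell (hψ.memLp 2)).const_mul _) fun x => ?_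
  simp only [← Finset.sum_mul]
  have := mul_le_mul_of_nonneg_right (hu.laplacian_fejer_ge m x) (hψ0 x)
  linarith

/-- Testing the lower bound on the Laplacian of the Fejér sum F_m with its own positive part w_m
gives ∫|∇w_m|² ≤ (4πn/|Ω|) ∫ w_m. So the positive parts are bounded in W^{1,2}, although u itself
need not lie there, and the Moser–Trudinger inequality with Fatou's lemma applies. -/
theorem integrable_exp (hu : IsBackground e p u) {q : ℝ} (hq : 0 ≤ q) :
    Integrable (fun x => Real.exp (q * u x)) (cellMeasure e) := by
  have hA := area_pos e
  set F : ℕ → Plane → ℝ := fun m => fejer e u m with hF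
  have ht : ∀ m, IsTest e (F m) := fun m => isTest_fejer u m
  have hL : ∀ m, MemLp (F m) 2 (cellMeasure e) := fun m => (ht m).isLipPer.memLp 2
  have h0 := tendsto_integral_sub_fejer_sq hu.memLp_two
  have hsq := tendsto_integral_sq_of_L2 hu.memLp_two hL h0
  have habs := tendsto_integral_abs_of_L2 hu.memLp_two hL h0
  obtain ⟨B₁, hB₁⟩ := hsq.bddAbove_range
  obtain ⟨B₂, hB₂⟩ := habs.bddAbove_range
  set w : ℕ → Plane → ℝ := fun m x => max (F m x) 0 with hw
  have hwL : ∀ m, IsLipPer e (w m) := fun m => by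
    obtain ⟨C, hC⟩ := (ht m).isLipPer.lip
    exact ⟨⟨C, hC.max_const 0⟩, fun k x => by simp only [hw, (ht m).periodic k x]⟩
  have hw0 : ∀ m x, 0 ≤ w m x := fun m x => le_max_right _ _
  -- Where F_m ≤ 0 the function w_m attains its minimum 0, so its derivative vanishes even on the
  -- boundary of the positivity set.
  have hder : ∀ m i x, partialDeriv i (w m) x ^ 2 = partialDeriv i (F m) x * partialDeriv i (w m) x := by
    intro m i x
    rcases lt_or_ge 0 (F m x) with h | h
    · have h1 : w m =ᶠ[𝓝 x] F m := by
        filter_upwards [(ht m).smooth.continuous.continuousAt.eventually (lt_mem_nhds h)] with y hy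
        exact max_eq_left hy.le
      have h2 : partialDeriv i (w m) x = partialDeriv i (F m) x := by
        rw [partialDeriv, h1.fderiv_eq, partialDeriv]
      rw [h2, sq]
    · have h1 : IsLocalMin (w m) x := Eventually.of_forall fun y => by
        have : w m x = 0 := max_eq_right h
        rw [this]; exact hw0 m y
      have h2 : partialDeriv i (w m) x = 0 := by
        rw [partialDeriv, h1.fderiv_eq_zero]; rfl
      rw [h2]; simp
  have hnorm : ∀ m, ‖(hwL m).toW12‖ ≤ Real.sqrt (B₁ + 4 * Real.pi * n / area e * B₂) := by
    intro m
    refine Real.le_sqrt_of_sq_le ?_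
    rw [W12.norm_sq, dirichlet]
    have e1 : ∫ x in cell e, W12.toFun (hwL m).toW12 x ^ 2 = ∫ x in cell e, w m x ^ 2 :=
      integral_congr_ae ((hwL m).toFun_toW12.fun_comp fun t => t ^ 2)
    have e2 : ∀ i, ∫ x in cell e, W12.grad (hwL m).toW12 i x ^ 2
        = ∫ x in cell e, partialDeriv i (F m) x * partialDeriv i (w m) x := fun i => by
      simp only [← hder]
      exact integral_congr_ae (((hwL m).grad_toW12 i).fun_comp fun t => t ^ 2)
    simp only [e1, e2]
    refine add_le_add ?_ ((hu.integral_grad_fejer_mul_le m (hwL m) (hw0 m)).trans ?_)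
    · refine le_trans ?_ (hB₁ ⟨m, rfl⟩)
      refine integral_mono ((hwL m).memLp 2).integrable_sq (hL m).integrable_sq fun x => ?_
      simp only [hw]
      rcases le_total (F m x) 0 with h | h
      · rw [max_eq_right h]; simpa using sq_nonneg (F m x)
      · rw [max_eq_left h]
    · refine mul_le_mul_of_nonneg_left (le_trans ?_ (hB₂ ⟨m, rfl⟩)) (by positivity)
      refine integral_mono (MemLp.integrableOn_cell ((hwL m).memLp 2))
        (MemLp.integrableOn_cell (hL m)).abs fun x => ?_
      exact max_le (le_abs_self _) (abs_nonneg _)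
  obtain ⟨C, hC⟩ := exists_exp_integral_max_le e hq (Real.sqrt (B₁ + 4 * Real.pi * n / area e * B₂))
  have hbound : ∀ m, Integrable (fun x => Real.exp (q * max (F m x) 0)) (cellMeasure e) ∧
      ∫ x in cell e, Real.exp (q * max (F m x) 0) ≤ C := by
    intro m
    have h1 := hC _ (hnorm m)
    have e1 : (fun x => Real.exp (q * max (W12.toFun (hwL m).toW12 x) 0))
        =ᵐ[cellMeasure e] fun x => Real.exp (q * max (F m x) 0) := by
      filter_upwards [(hwL m).toFun_toW12] with x hx
      rw [hx, max_eq_left (hw0 m x)]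
    rwa [integrable_congr e1, integral_congr_ae e1] at h1
  obtain ⟨σ, hσ, hae⟩ := exists_subseq_ae_of_L2 hu.memLp_two hL h0
  have hlim := integrable_of_ae_tendsto_of_integral_le (e := e) (B := C)
    (f := fun x => Real.exp (q * max (u x) 0))
    (F := fun m x => Real.exp (q * max (F (σ m) x) 0)) (fun m => (hbound _).1)
    (fun m x => (Real.exp_pos _).le) (fun m => (hbound _).2) (by
      filter_upwards [hae] with x hx
      exact ((continuous_exp_mul_max q).tendsto _).comp hx)
  refine hlim.1.mono' ((show Continuous fun t : ℝ => Real.exp (q * t) by fun_prop).comp_aestronglyMeasurable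
    hu.memLp_two.1) (ae_of_all _ fun x => ?_)
  rw [Real.norm_eq_abs, Real.abs_exp]
  exact Real.exp_le_exp.mpr (mul_le_mul_of_nonneg_left (le_max_left _ _) hq)

end IsBackground

end

section

/-! ### Exponential moments -/

/-- All exponential moments of `g` over the period cell are finite. -/
structure HasExpMoments (e : Module.Basis (Fin 2) ℝ Plane) (g : Plane → ℝ) : Prop where
  aestronglyMeasurable : AEStronglyMeasurable g (cellMeasure e)
  integrable_exp : ∀ q : ℝ, 0 ≤ q → Integrable (fun x => Real.exp (q * g x)) (cellMeasure e)

variable {e : Module.Basis (Fin 2) ℝ Plane} {N : ℕ}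

theorem IsBackground.hasExpMoments {n : ℕ} {p : Fin n → Plane} {u : Plane → ℝ}
    (hu : IsBackground e p u) : HasExpMoments e u :=
  ⟨hu.memLp_two.1, fun _ hq => hu.integrable_exp hq⟩

theorem W12.hasExpMoments (f : W12 e) : HasExpMoments e (W12.toFun f) := by
  refine ⟨(W12.memLp_toFun f).1, fun q hq => ?_⟩
  obtain ⟨C, hC⟩ := exists_exp_integral_le e hq ‖f‖
  refine (hC f le_rfl).1.mono' (Real.continuous_exp.comp_aestronglyMeasurable
    ((W12.memLp_toFun f).1.const_mul q)) (ae_of_all _ fun x => ?_)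
  rw [Real.norm_of_nonneg (Real.exp_pos _).le]
  exact Real.exp_le_exp.mpr (mul_le_mul_of_nonneg_left (le_abs_self _) hq)

namespace HasExpMoments

theorem add {g h : Plane → ℝ} (hg : HasExpMoments e g) (hh : HasExpMoments e h) :
    HasExpMoments e fun x => g x + h x := by
  refine ⟨hg.1.add hh.1, fun q hq => ?_⟩
  refine ((hg.2 (2 * q) (by positivity)).add (hh.2 (2 * q) (by positivity))).mono'
    (Real.continuous_exp.comp_aestronglyMeasurable ((hg.1.add hh.1).const_mul q))
    (ae_of_all _ fun x => ?_)
  rw [Real.norm_of_nonneg (Real.exp_pos _).le, Pi.add_apply]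
  have h1 : Real.exp (q * (g x + h x)) = Real.exp (q * g x) * Real.exp (q * h x) := by
    rw [← Real.exp_add]; ring_nf
  have h2 : Real.exp (2 * q * g x) = Real.exp (q * g x) ^ 2 := by
    rw [← Real.exp_nat_mul]; push_cast; ring_nf
  have h3 : Real.exp (2 * q * h x) = Real.exp (q * h x) ^ 2 := by
    rw [← Real.exp_nat_mul]; push_cast; ring_nf
  rw [h1, h2, h3]
  nlinarith [sq_nonneg (Real.exp (q * g x) - Real.exp (q * h x)),
    sq_nonneg (Real.exp (q * g x)), sq_nonneg (Real.exp (q * h x))]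

theorem memLp_exp {g : Plane → ℝ} (hg : HasExpMoments e g) :
    MemLp (fun x => Real.exp (g x)) 2 (cellMeasure e) := by
  refine (memLp_two_iff_integrable_sq
    (Real.continuous_exp.comp_aestronglyMeasurable hg.1)).mpr ?_
  refine (hg.2 2 (by norm_num)).congr (ae_of_all _ fun x => ?_)
  simp only
  rw [← Real.exp_nat_mul]; push_cast; rfl

end HasExpMoments

/-! ### Differentiability of the action functional -/

/-- The weak derivative as a continuous linear map into `L²`. -/
def W12.gradL (e : Module.Basis (Fin 2) ℝ Plane) (i : Fin 2) :
    W12 e →L[ℝ] Lp ℝ 2 (cellMeasure e) :=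
  (PiLp.proj 2 (fun _ : Fin 2 => Lp ℝ 2 (cellMeasure e)) i) ∘L
    (WithLp.sndL 2 ℝ (Lp ℝ 2 (cellMeasure e)) (PiLp 2 (fun _ : Fin 2 => Lp ℝ 2 (cellMeasure e)))) ∘L
      (W12 e).subtypeL

/-- Integration against a square integrable function. -/
def integralL {g : Plane → ℝ} (hg : MemLp g 2 (cellMeasure e)) : W12 e →L[ℝ] ℝ :=
  (innerSL ℝ (hg.toLp g)) ∘L
    (WithLp.fstL 2 ℝ (Lp ℝ 2 (cellMeasure e)) (PiLp 2 (fun _ : Fin 2 => Lp ℝ 2 (cellMeasure e)))) ∘L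
      (W12 e).subtypeL

theorem integralL_apply {g : Plane → ℝ} (hg : MemLp g 2 (cellMeasure e)) (f : W12 e) :
    integralL hg f = ∫ x in cell e, W12.toFun f x * g x := by
  have h1 : integralL hg f = ⟪hg.toLp g, f.1.fst⟫_ℝ := rfl
  rw [h1, L2.inner_def]
  refine integral_congr_ae ?_
  filter_upwards [hg.coeFn_toLp] with x hx
  simp [hx]

theorem inner_gradL (f g : W12 e) (i : Fin 2) :
    ⟪W12.gradL e i f, W12.gradL e i g⟫_ℝ = ∫ x in cell e, W12.grad f i x * W12.grad g i x := by
  rw [L2.inner_def]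
  refine integral_congr_ae (ae_of_all _ fun x => ?_)
  exact mul_comm _ _

/-- `F` is differentiable at `v` with differential `w ↦ d w`. -/
def HasDifferential {E : Type*} [NormedAddCommGroup E] [NormedSpace ℝ E] (F : E → ℝ) (v : E)
    (d : E → ℝ) : Prop :=
  ∃ D : E →L[ℝ] ℝ, HasFDerivAt F D v ∧ ∀ w, D w = d w

namespace HasDifferential

variable {E : Type*} [NormedAddCommGroup E] [NormedSpace ℝ E] {F G : E → ℝ} {v : E} {d d' : E → ℝ}

theorem add (hF : HasDifferential F v d) (hG : HasDifferential G v d') :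
    HasDifferential (fun v => F v + G v) v fun w => d w + d' w := by
  obtain ⟨D, h, h'⟩ := hF
  obtain ⟨D₁, h₁, h₁'⟩ := hG
  exact ⟨D + D₁, h.add h₁, fun w => by simp [h', h₁']⟩

theorem sub (hF : HasDifferential F v d) (hG : HasDifferential G v d') :
    HasDifferential (fun v => F v - G v) v fun w => d w - d' w := by
  obtain ⟨D, h, h'⟩ := hF
  obtain ⟨D₁, h₁, h₁'⟩ := hG
  exact ⟨D - D₁, h.sub h₁, fun w => by simp [h', h₁']⟩

theorem add_const (hF : HasDifferential F v d) (c : ℝ) :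
    HasDifferential (fun v => F v + c) v d := by
  obtain ⟨D, h, h'⟩ := hF
  exact ⟨D, h.add_const c, h'⟩

theorem const_mul (hF : HasDifferential F v d) (c : ℝ) :
    HasDifferential (fun v => c * F v) v fun w => c * d w := by
  obtain ⟨D, h, h'⟩ := hF
  exact ⟨c • D, h.const_mul c, fun w => by simp [h']⟩

theorem sum {ι : Type*} {s : Finset ι} {F : ι → E → ℝ} {d : ι → E → ℝ}
    (hF : ∀ i ∈ s, HasDifferential (F i) v (d i)) :
    HasDifferential (fun v => ∑ i ∈ s, F i v) v fun w => ∑ i ∈ s, d i w := by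
  choose! D h h' using hF
  refine ⟨∑ i ∈ s, D i, HasFDerivAt.fun_sum h, fun w => ?_⟩
  rw [_root_.sum_apply]
  exact Finset.sum_congr rfl fun i hi => h' i hi w

theorem comp_clm {E' : Type*} [NormedAddCommGroup E'] [NormedSpace ℝ E'] {v : E'} {T : E' →L[ℝ] E}
    (hF : HasDifferential F (T v) d) : HasDifferential (fun v => F (T v)) v fun w => d (T w) := by
  obtain ⟨D, h, h'⟩ := hF
  exact ⟨D ∘L T, h.comp v T.hasFDerivAt, fun w => by simp [h']⟩

theorem inner {H : Type*} [NormedAddCommGroup H] [InnerProductSpace ℝ H] (S T : E →L[ℝ] H) (v : E) :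
    HasDifferential (fun v => ⟪S v, T v⟫_ℝ) v fun w => ⟪S v, T w⟫_ℝ + ⟪S w, T v⟫_ℝ :=
  ⟨_, S.hasFDerivAt.inner ℝ T.hasFDerivAt, fun _ => rfl⟩

theorem fderiv_apply (hF : HasDifferential F v d) (w : E) : fderiv ℝ F v w = d w := by
  obtain ⟨D, h, h'⟩ := hF
  rw [h.fderiv, h']

end HasDifferential

/-- Second-order Taylor remainder with t² factored out, so that an exponential moment of z alone
controls it; |z|² ≤ 2 exp|z| absorbs the polynomial factor. -/
theorem abs_exp_mul_sub_le {t : ℝ} (ht : 0 ≤ t) (ht1 : t ≤ 1) (z : ℝ) :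
    |Real.exp (t * z) - 1 - t * z| ≤ t ^ 2 * (2 * Real.exp (2 * |z|)) := by
  have h1 := Complex.norm_exp_sub_sum_le_norm_mul_exp ((t * z : ℝ) : ℂ) 2
  have h2 : Complex.exp ((t * z : ℝ) : ℂ)
      - ∑ m ∈ Finset.range 2, ((t * z : ℝ) : ℂ) ^ m / (m.factorial : ℂ)
      = ((Real.exp (t * z) - 1 - t * z : ℝ) : ℂ) := by
    simp [Finset.sum_range_succ]; ring
  rw [h2, Complex.norm_real, Complex.norm_real, Real.norm_eq_abs, Real.norm_eq_abs] at h1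
  refine h1.trans ?_
  rw [abs_mul, abs_of_nonneg ht]
  have h3 : Real.exp (t * |z|) ≤ Real.exp |z| :=
    Real.exp_le_exp.mpr (mul_le_of_le_one_left (abs_nonneg z) ht1)
  have h4 : |z| ^ 2 ≤ 2 * Real.exp |z| := by
    have := Real.quadratic_le_exp_of_nonneg (abs_nonneg z)
    nlinarith [abs_nonneg z]
  have h5 : Real.exp (2 * |z|) = Real.exp |z| * Real.exp |z| := by rw [← Real.exp_add]; ring_nf
  rw [mul_pow, h5, mul_assoc]
  refine mul_le_mul_of_nonneg_left ?_ (sq_nonneg t)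
  calc |z| ^ 2 * Real.exp (t * |z|) ≤ (2 * Real.exp |z|) * Real.exp |z| := by gcongr
    _ = _ := by ring

theorem integral_exp_sub_eq {g : Plane → ℝ} (hg : HasExpMoments e g) (v w : W12 e) :
    (∫ x in cell e, Real.exp (g x + W12.toFun (v + w) x))
        - (∫ x in cell e, Real.exp (g x + W12.toFun v x))
        - (∫ x in cell e, W12.toFun w x * Real.exp (g x + W12.toFun v x))
      = ∫ x in cell e, Real.exp (g x + W12.toFun v x)
          * (Real.exp (W12.toFun w x) - 1 - W12.toFun w x) := by
  have hL := (hg.add (W12.hasExpMoments v)).memLp_exp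
  have hE := MemLp.integrableOn_cell hL
  have hE' := MemLp.integrableOn_cell (hg.add (W12.hasExpMoments (v + w))).memLp_exp
  have hEw : Integrable (fun x => W12.toFun w x * Real.exp (g x + W12.toFun v x))
    (cellMeasure e) := (W12.memLp_toFun w).integrable_mul hL
  rw [← integral_sub hE' hE]
  refine (integral_sub (hE'.sub hE) hEw).symm.trans (integral_congr_ae ?_)
  filter_upwards [W12.toFun_add v w] with x hx
  simp only [Pi.sub_apply]
  rw [hx, ← add_assoc, Real.exp_add (g x + W12.toFun v x)]; ring

/-- Writing w = ‖w‖ z with ‖z‖ ≤ 1, the remainder is at most ‖w‖² · 2 exp(2|z|). After squaring, the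
fourth exponential moment is needed, uniformly on the unit ball. -/
theorem exists_integral_exp_remainder_sq_le (e : Module.Basis (Fin 2) ℝ Plane) :
    ∃ C, 0 ≤ C ∧ ∀ w : W12 e, ‖w‖ ≤ 1 →
      ∫ x in cell e, (Real.exp (W12.toFun w x) - 1 - W12.toFun w x) ^ 2 ≤ C * (‖w‖ ^ 2) ^ 2 := by
  obtain ⟨C, hC⟩ := exists_exp_integral_le e (q := 4) (by norm_num) 1
  have hC0 : 0 ≤ C := le_trans (integral_nonneg fun x => (Real.exp_pos _).le) (hC 0 (by simp)).2
  refine ⟨4 * C, by positivity, fun w hw => ?_⟩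
  obtain ⟨z, hz1, hz⟩ : ∃ z : W12 e, ‖z‖ ≤ 1 ∧ w = ‖w‖ • z := by
    rcases eq_or_ne w 0 with rfl | h0
    · exact ⟨0, by simp, by simp⟩
    · refine ⟨‖w‖⁻¹ • w, ?_, ?_⟩
      · rw [norm_smul, norm_inv, norm_norm, inv_mul_cancel₀ (norm_ne_zero_iff.mpr h0)]
      · rw [smul_smul, mul_inv_cancel₀ (norm_ne_zero_iff.mpr h0), one_smul]
  have hzw : W12.toFun w =ᵐ[cellMeasure e] fun x => ‖w‖ * W12.toFun z x := by
    have := W12.toFun_smul ‖w‖ z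
    rwa [← hz] at this
  obtain ⟨hzi, hzC⟩ := hC z hz1
  have hρL : MemLp (fun x => Real.exp (W12.toFun w x) - 1 - W12.toFun w x) 2 (cellMeasure e) :=
    ((W12.hasExpMoments w).memLp_exp.sub (memLp_const 1)).sub (W12.memLp_toFun w)
  calc ∫ x in cell e, (Real.exp (W12.toFun w x) - 1 - W12.toFun w x) ^ 2
      ≤ ∫ x in cell e, 4 * (‖w‖ ^ 2) ^ 2 * Real.exp (4 * |W12.toFun z x|) := by
        refine integral_mono_ae hρL.integrable_sq (hzi.const_mul _) ?_
        filter_upwards [hzw] with x hx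
        simp only [hx]
        have h1 := abs_exp_mul_sub_le (norm_nonneg w) hw (W12.toFun z x)
        have h2 : Real.exp (4 * |W12.toFun z x|) = Real.exp (2 * |W12.toFun z x|) ^ 2 := by
          rw [← Real.exp_nat_mul]; push_cast; ring_nf
        rw [← sq_abs, h2]
        calc _ ≤ (‖w‖ ^ 2 * (2 * Real.exp (2 * |W12.toFun z x|))) ^ 2 :=
              pow_le_pow_left₀ (abs_nonneg _) h1 2
          _ = _ := by ring
    _ = 4 * (‖w‖ ^ 2) ^ 2 * ∫ x in cell e, Real.exp (4 * |W12.toFun z x|) :=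
        integral_const_mul _ _
    _ ≤ 4 * (‖w‖ ^ 2) ^ 2 * C := by gcongr
    _ = 4 * C * (‖w‖ ^ 2) ^ 2 := by ring

/-- The exact remainder is the integral of exp(g+v)(exp w - 1 - w); Cauchy–Schwarz and the quadratic
bound on the second factor make it O(‖w‖²). -/
theorem hasDifferential_integral_exp {g : Plane → ℝ} (hg : HasExpMoments e g) (v : W12 e) :
    HasDifferential (fun v : W12 e => ∫ x in cell e, Real.exp (g x + W12.toFun v x)) v
      fun w => ∫ x in cell e, W12.toFun w x * Real.exp (g x + W12.toFun v x) := by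
  have hL : MemLp (fun x => Real.exp (g x + W12.toFun v x)) 2 (cellMeasure e) :=
    (hg.add (W12.hasExpMoments v)).memLp_exp
  refine ⟨integralL hL, ?_, integralL_apply hL⟩
  rw [hasFDerivAt_iff_isLittleO_nhds_zero]
  obtain ⟨C, hC0, hC⟩ := exists_integral_exp_remainder_sq_le e
  refine Asymptotics.IsBigO.trans_isLittleO (g := fun w : W12 e => ‖w‖ ^ 2) ?_
    (Asymptotics.isLittleO_norm_pow_id one_lt_two)
  refine Asymptotics.IsBigO.of_bound
    (Real.sqrt (∫ x in cell e, Real.exp (g x + W12.toFun v x) ^ 2) * Real.sqrt C) ?_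
  filter_upwards [Metric.closedBall_mem_nhds (0 : W12 e) one_pos] with w hw
  rw [Real.norm_eq_abs, norm_pow, norm_norm, integralL_apply, integral_exp_sub_eq hg v w]
  refine (abs_integral_mul_le hL (((W12.hasExpMoments w).memLp_exp.sub (memLp_const 1)).sub
    (W12.memLp_toFun w))).trans ?_
  rw [mul_assoc]
  refine mul_le_mul_of_nonneg_left ?_ (Real.sqrt_nonneg _)
  rw [Real.sqrt_le_left (by positivity), mul_pow, Real.sq_sqrt hC0]
  exact hC w (by simpa using hw)

scoped instance normedAddCommGroup_W12N : NormedAddCommGroup (W12N e N) :=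
  PiLp.normedAddCommGroup 2 fun _ : Fin N => W12 e

scoped instance normedSpace_W12N : NormedSpace ℝ (W12N e N) :=
  PiLp.normedSpace 2 ℝ fun _ : Fin N => W12 e

/-- The `j`-th component as a continuous linear map. -/
def W12N.projL (e : Module.Basis (Fin 2) ℝ Plane) {N : ℕ} (j : Fin N) : W12N e N →L[ℝ] W12 e :=
  PiLp.proj 2 (fun _ : Fin N => W12 e) j

theorem hasDifferential_integral_grad (i : Fin 2) (j k : Fin N) (v : W12N e N) :
    HasDifferential
      (fun v : W12N e N => ∫ x in cell e, W12.grad (v j) i x * W12.grad (v k) i x) v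
      fun w => (∫ x in cell e, W12.grad (v j) i x * W12.grad (w k) i x)
        + ∫ x in cell e, W12.grad (w j) i x * W12.grad (v k) i x := by
  have h := HasDifferential.inner (E := W12N e N) (W12.gradL e i ∘L W12N.projL e j)
    (W12.gradL e i ∘L W12N.projL e k) v
  simp only [ContinuousLinearMap.comp_apply, inner_gradL] at h
  exact h

end

section

/-! ### The differential of the action functional -/

variable {e : Module.Basis (Fin 2) ℝ Plane} {N : ℕ}

theorem integral_dot_mulVec {F G : Fin N → Plane → ℝ} (B : Matrix (Fin N) (Fin N) ℝ)
    (h : ∀ j k, Integrable (fun x => F j x * G k x) (cellMeasure e)) :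
    ∫ x in cell e, (fun j => F j x) ⬝ᵥ B *ᵥ (fun j => G j x)
      = ∑ j, ∑ k, B j k * ∫ x in cell e, F j x * G k x := by
  have h1 : ∀ x, (fun j => F j x) ⬝ᵥ B *ᵥ (fun j => G j x)
      = ∑ j, ∑ k, B j k * (F j x * G k x) := fun x => by
    simp only [dotProduct, mulVec, Finset.mul_sum]
    exact Finset.sum_congr rfl fun j _ => Finset.sum_congr rfl fun k _ => by ring
  simp only [h1]
  refine (integral_finsetSum _ fun j _ => integrable_finsetSum _ fun k _ =>
    (h j k).const_mul (B j k)).trans ?_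
  refine Finset.sum_congr rfl fun j _ => ?_
  refine (integral_finsetSum _ fun k _ => (h j k).const_mul (B j k)).trans ?_
  exact Finset.sum_congr rfl fun k _ => integral_const_mul _ _

theorem integral_dot {F : Fin N → Plane → ℝ} (b : Fin N → ℝ)
    (h : ∀ j, Integrable (F j) (cellMeasure e)) :
    ∫ x in cell e, b ⬝ᵥ (fun j => F j x) = ∑ j, b j * ∫ x in cell e, F j x := by
  simp only [dotProduct]
  rw [integral_finsetSum _ fun j _ => (h j).const_mul _]
  exact Finset.sum_congr rfl fun k _ => integral_const_mul _ _

/-- The function `exp (u⁰ⱼ + vⱼ)`. -/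
def density (u₀ : Fin N → Plane → ℝ) (v : W12N e N) (j : Fin N) (x : Plane) : ℝ :=
  Real.exp (u₀ j x + W12.toFun (v j) x)

/-- The rescaled function `rⱼ exp (u⁰ⱼ + vⱼ)`. -/
def weight (u₀ : Fin N → Plane → ℝ) (v : W12N e N) (j : Fin N) (x : Plane) : ℝ :=
  r N j * density u₀ v j x

/-- The nonlinearity `aⱼ ((K a)ⱼ - 1)` with `aⱼ = rⱼ exp (u⁰ⱼ + vⱼ)`. -/
def force (u₀ : Fin N → Plane → ℝ) (v : W12N e N) (j : Fin N) (x : Plane) : ℝ :=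
  weight u₀ v j x * ((K N *ᵥ fun k => weight u₀ v k x) j - 1)

variable {u₀ : Fin N → Plane → ℝ}

theorem memLp_density (hu : ∀ j, HasExpMoments e (u₀ j)) (v : W12N e N) (j : Fin N) :
    MemLp (density u₀ v j) 2 (cellMeasure e) :=
  ((hu j).add (W12.hasExpMoments (v j))).memLp_exp

theorem memLp_density_mul (hu : ∀ j, HasExpMoments e (u₀ j)) (v : W12N e N) (j k : Fin N) :
    MemLp (fun x => density u₀ v j x * density u₀ v k x) 2 (cellMeasure e) := by
  have h := (((hu j).add (W12.hasExpMoments (v j))).add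
    ((hu k).add (W12.hasExpMoments (v k)))).memLp_exp
  simp only [Real.exp_add _ (u₀ k _ + _)] at h
  exact h

theorem memLp_weight (hu : ∀ j, HasExpMoments e (u₀ j)) (v : W12N e N) (j : Fin N) : MemLp (weight u₀ v j) 2 (cellMeasure e) :=
  (memLp_density hu v j).const_mul _

theorem memLp_weight_mul (hu : ∀ j, HasExpMoments e (u₀ j)) (v : W12N e N) (j k : Fin N) :
    MemLp (fun x => weight u₀ v j x * weight u₀ v k x) 2 (cellMeasure e) := by
  refine ((memLp_density_mul hu v j k).const_mul (r N j * r N k)).ae_eq (ae_of_all _ fun x => ?_)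
  simp only [weight]; ring

theorem force_eq (v : W12N e N) (j : Fin N) (x : Plane) :
    force u₀ v j x = ∑ k, K N j k * (weight u₀ v j x * weight u₀ v k x) - weight u₀ v j x := by
  rw [force, mul_sub, mul_one, mulVec, dotProduct, Finset.mul_sum]
  congr 1
  exact Finset.sum_congr rfl fun k _ => by ring

theorem memLp_force (hu : ∀ j, HasExpMoments e (u₀ j)) (v : W12N e N) (j : Fin N) : MemLp (force u₀ v j) 2 (cellMeasure e) := by
  have h : force u₀ v j
      = fun x => ∑ k, K N j k * (weight u₀ v j x * weight u₀ v k x) - weight u₀ v j x :=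
    funext (force_eq v j)
  rw [h]
  exact (memLp_finsetSum _ fun k _ => (memLp_weight_mul hu v j k).const_mul _).sub
    (memLp_weight hu v j)

/-- Since U_j U_k = exp((u_j^0+u_k^0) + (v_j+v_k)), expanding the potential leaves one type of
nonlinear functional, ∫ exp(g + f), composed with the linear maps v ↦ v_j and v ↦ v_j + v_k. -/
theorem action_eq (hu : ∀ j, HasExpMoments e (u₀ j)) (lam : ℝ) (n : Fin N → ℕ) (v : W12N e N) :
    action e lam n u₀ v
      = 1 / 2 * (∑ i, ∑ j, ∑ k, A N j k * ∫ x in cell e, W12.grad (v j) i x * W12.grad (v k) i x)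
        + lam / 2 * (∑ j, ∑ k, M N j k *
          ((∫ x in cell e, Real.exp (u₀ j x + u₀ k x + W12.toFun (v j + v k) x))
            - (∫ x in cell e, Real.exp (u₀ j x + W12.toFun (v j) x))
            - (∫ x in cell e, Real.exp (u₀ k x + W12.toFun (v k) x)) + area e))
        + 1 / area e * ∑ j, bvec n j * ∫ x in cell e, W12.toFun (v j) x := by
  rw [action]
  congr 1
  · congr 1
    · congr 1
      exact Finset.sum_congr rfl fun i _ => integral_dot_mulVec
        (F := fun j x => W12.grad (v j) i x) (G := fun j x => W12.grad (v j) i x) _ fun j k =>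
          (W12.memLp_grad (v j) i).integrable_mul (W12.memLp_grad (v k) i)
    · congr 1
      have hm : ∀ j, MemLp (fun x => Real.exp (u₀ j x + W12.toFun (v j) x) - 1) 2 (cellMeasure e) :=
        fun j => (memLp_density hu v j).sub (memLp_const 1)
      refine (integral_dot_mulVec
        (F := fun j x => Real.exp (u₀ j x + W12.toFun (v j) x) - 1)
        (G := fun j x => Real.exp (u₀ j x + W12.toFun (v j) x) - 1) _ fun j k =>
          (hm j).integrable_mul (hm k)).trans ?_
      refine Finset.sum_congr rfl fun j _ => Finset.sum_congr rfl fun k _ => ?_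
      congr 1
      have h1 : Integrable (fun x => density u₀ v j x * density u₀ v k x) (cellMeasure e) :=
        (memLp_density hu v j).integrable_mul (memLp_density hu v k)
      have h2 := MemLp.integrableOn_cell (memLp_density hu v j)
      have h3 := MemLp.integrableOn_cell (memLp_density hu v k)
      have e1 : ∫ x in cell e, Real.exp (u₀ j x + u₀ k x + W12.toFun (v j + v k) x)
          = ∫ x in cell e, density u₀ v j x * density u₀ v k x := by
        refine integral_congr_ae ?_
        filter_upwards [W12.toFun_add (v j) (v k)] with x hx
        simp only [density]
        rw [hx, ← Real.exp_add]; ring_nf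
      have e2 : area e = ∫ _ in cell e, (1 : ℝ) := by simp [area]
      rw [e1, e2]
      have e3 : (∫ x in cell e, density u₀ v j x * density u₀ v k x)
          - ∫ x in cell e, density u₀ v j x
          = ∫ x in cell e, density u₀ v j x * density u₀ v k x - density u₀ v j x :=
        (integral_sub h1 h2).symm
      have e4 : (∫ x in cell e, density u₀ v j x * density u₀ v k x - density u₀ v j x)
          - ∫ x in cell e, density u₀ v k x
          = ∫ x in cell e, density u₀ v j x * density u₀ v k x - density u₀ v j x
            - density u₀ v k x := (integral_sub (h1.sub h2) h3).symm
      change _ = _ - (∫ x in cell e, density u₀ v j x) - (∫ x in cell e, density u₀ v k x) + _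
      rw [e3, e4]
      refine Eq.trans ?_ (integral_add ((h1.sub h2).sub h3) (integrable_const 1))
      refine integral_congr_ae (ae_of_all _ fun x => ?_)
      simp only [density]; ring
  · congr 1
    exact integral_dot (F := fun j x => W12.toFun (v j) x) _ fun j =>
      MemLp.integrableOn_cell (W12.memLp_toFun (v j))

theorem M_symm (i j : Fin N) : M N i j = M N j i := by
  simp only [M, mul_diagonal, diagonal_mul, K_symm i j]; ring

/-- The differential of the action functional at `v` in the direction `w`. -/
def dAction (lam : ℝ) (n : Fin N → ℕ) (u₀ : Fin N → Plane → ℝ) (v w : W12N e N) : ℝ :=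
  (∑ i, ∑ j, ∑ k, A N j k * ∫ x in cell e, W12.grad (v j) i x * W12.grad (w k) i x)
    + lam * (∑ j, ∫ x in cell e, W12.toFun (w j) x * force u₀ v j x)
    + 1 / area e * ∑ j, bvec n j * ∫ x in cell e, W12.toFun (w j) x

theorem integral_toFun_mul_force (hN3 : 3 ≤ N) (hN5 : N ≤ 5)
    (hu : ∀ j, HasExpMoments e (u₀ j)) (v w : W12N e N) (j : Fin N) :
    ∫ x in cell e, W12.toFun (w j) x * force u₀ v j x
      = ∑ k, M N j k * ((∫ x in cell e, W12.toFun (w j) x * (density u₀ v j x * density u₀ v k x))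
        - ∫ x in cell e, W12.toFun (w j) x * density u₀ v j x) := by
  have h1 : ∀ k, Integrable (fun x => W12.toFun (w j) x * (density u₀ v j x * density u₀ v k x))
      (cellMeasure e) := fun k =>
    (W12.memLp_toFun (w j)).integrable_mul (memLp_density_mul hu v j k)
  have h2 : Integrable (fun x => W12.toFun (w j) x * density u₀ v j x) (cellMeasure e) :=
    (W12.memLp_toFun (w j)).integrable_mul (memLp_density hu v j)
  have h3 : ∀ x, W12.toFun (w j) x * force u₀ v j x = ∑ k, M N j k *
      (W12.toFun (w j) x * (density u₀ v j x * density u₀ v k x)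
        - W12.toFun (w j) x * density u₀ v j x) := fun x => by
    have h4 := mul_M_mulVec_sub_one hN3 hN5 (fun k => density u₀ v k x) j
    rw [force]
    simp only [weight]
    rw [← h4, mulVec, dotProduct, Finset.mul_sum, Finset.mul_sum]
    exact Finset.sum_congr rfl fun k _ => by ring
  simp only [h3]
  refine (integral_finsetSum _ fun k _ => ((h1 k).sub h2).const_mul (M N j k)).trans ?_
  refine Finset.sum_congr rfl fun k _ => ?_
  refine (integral_const_mul _ _).trans ?_
  congr 1
  exact integral_sub (h1 k) h2

/-- M is symmetric, so the variations of the two factors contribute equally; the resulting 2 cancels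
the denominator in λ/2. -/
theorem sum_M_mul_integral_eq (hN3 : 3 ≤ N) (hN5 : N ≤ 5)
    (hu : ∀ j, HasExpMoments e (u₀ j)) (v w : W12N e N) :
    ∑ j, ∑ k, M N j k * ((∫ x in cell e, W12.toFun (w j + w k) x
          * Real.exp (u₀ j x + u₀ k x + W12.toFun (v j + v k) x))
        - (∫ x in cell e, W12.toFun (w j) x * Real.exp (u₀ j x + W12.toFun (v j) x))
        - ∫ x in cell e, W12.toFun (w k) x * Real.exp (u₀ k x + W12.toFun (v k) x))
      = 2 * ∑ j, ∫ x in cell e, W12.toFun (w j) x * force u₀ v j x := by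
  simp only [integral_toFun_mul_force hN3 hN5 hu]
  obtain ⟨P, hP⟩ : ∃ P : Fin N → Fin N → ℝ, ∀ j k, ∫ x in cell e,
    W12.toFun (w j) x * (density u₀ v j x * density u₀ v k x) = P j k := ⟨_, fun _ _ => rfl⟩
  obtain ⟨Q, hQ⟩ : ∃ Q : Fin N → ℝ, ∀ j,
    ∫ x in cell e, W12.toFun (w j) x * density u₀ v j x = Q j := ⟨_, fun _ => rfl⟩
  have hQ' : ∀ j, ∫ x in cell e, W12.toFun (w j) x * Real.exp (u₀ j x + W12.toFun (v j) x) = Q j :=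
    hQ
  have e1 : ∀ j k, ∫ x in cell e, W12.toFun (w j + w k) x
      * Real.exp (u₀ j x + u₀ k x + W12.toFun (v j + v k) x) = P j k + P k j := fun j k => by
    have i1 : Integrable (fun x => W12.toFun (w j) x * (density u₀ v j x * density u₀ v k x))
      (cellMeasure e) := (W12.memLp_toFun (w j)).integrable_mul (memLp_density_mul hu v j k)
    have i2 : Integrable (fun x => W12.toFun (w k) x * (density u₀ v k x * density u₀ v j x))
      (cellMeasure e) := (W12.memLp_toFun (w k)).integrable_mul (memLp_density_mul hu v k j)
    rw [← hP, ← hP]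
    refine Eq.trans (integral_congr_ae ?_) (integral_add i1 i2)
    filter_upwards [W12.toFun_add (v j) (v k), W12.toFun_add (w j) (w k)] with x hx hx'
    simp only [density]
    rw [hx, hx', ← Real.exp_add, ← Real.exp_add]; ring_nf
  have e2 : ∑ j, ∑ k, M N j k * (P k j - Q k) = ∑ j, ∑ k, M N j k * (P j k - Q j) := by
    rw [Finset.sum_comm]
    exact Finset.sum_congr rfl fun j _ => Finset.sum_congr rfl fun k _ => by rw [M_symm]
  have e3 : ∑ j, ∑ k, M N j k * (P j k + P k j - Q j - Q k)
      = ∑ j, ∑ k, M N j k * (P j k - Q j) + ∑ j, ∑ k, M N j k * (P k j - Q k) := by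
    simp only [← Finset.sum_add_distrib]
    exact Finset.sum_congr rfl fun j _ => Finset.sum_congr rfl fun k _ => by ring
  simp only [e1, hP, hQ, hQ']
  rw [e3, e2]; ring

theorem hasDifferential_action (hN3 : 3 ≤ N) (hN5 : N ≤ 5) (hu : ∀ j, HasExpMoments e (u₀ j))
    (lam : ℝ) (n : Fin N → ℕ) (v : W12N e N) :
    HasDifferential (action e lam n u₀) v (dAction lam n u₀ v) := by
  have hfun : action e lam n u₀ = _ := funext (action_eq hu lam n)
  rw [hfun]
  have hq := HasDifferential.sum (s := Finset.univ) (v := v) fun (i : Fin 2) _ =>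
    HasDifferential.sum (s := Finset.univ) fun (j : Fin N) _ =>
      HasDifferential.sum (s := Finset.univ) fun (k : Fin N) _ =>
        (hasDifferential_integral_grad i j k v).const_mul (A N j k)
  have he : ∀ j k : Fin N, HasDifferential
      (fun v : W12N e N => ∫ x in cell e, Real.exp (u₀ j x + u₀ k x + W12.toFun (v j + v k) x)) v
      fun w => ∫ x in cell e, W12.toFun (w j + w k) x
        * Real.exp (u₀ j x + u₀ k x + W12.toFun (v j + v k) x) := fun j k =>
    (hasDifferential_integral_exp ((hu j).add (hu k)) (v j + v k)).comp_clm
      (T := W12N.projL e j + W12N.projL e k)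
  have hs : ∀ j : Fin N, HasDifferential
      (fun v : W12N e N => ∫ x in cell e, Real.exp (u₀ j x + W12.toFun (v j) x)) v
      fun w => ∫ x in cell e, W12.toFun (w j) x * Real.exp (u₀ j x + W12.toFun (v j) x) := fun j =>
    (hasDifferential_integral_exp (hu j) (v j)).comp_clm (T := W12N.projL e j)
  have hl : ∀ j : Fin N, HasDifferential (fun v : W12N e N => ∫ x in cell e, W12.toFun (v j) x) v
      fun w => ∫ x in cell e, W12.toFun (w j) x := fun j => by
    have h1 : HasDifferential (fun f : W12 e => ∫ x in cell e, W12.toFun f x) (v j)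
        fun f => ∫ x in cell e, W12.toFun f x :=
      ⟨integralL (memLp_const (1 : ℝ)),
        (integralL (e := e) (memLp_const (1 : ℝ))).hasFDerivAt.congr_of_eventuallyEq
          (Eventually.of_forall fun w => by simp only [integralL_apply, mul_one]),
        fun w => by simp only [integralL_apply, mul_one]⟩
    exact h1.comp_clm (T := W12N.projL e j)
  have hM := HasDifferential.sum (s := Finset.univ) (v := v) fun (j : Fin N) _ =>
      HasDifferential.sum (s := Finset.univ) fun (k : Fin N) _ =>
        ((((he j k).sub (hs j)).sub (hs k)).add_const (area e)).const_mul (M N j k)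
  have hL := HasDifferential.sum (s := Finset.univ) (v := v) fun (j : Fin N) _ =>
    (hl j).const_mul (bvec n j)
  obtain ⟨D, hD, hD'⟩ := ((hq.const_mul (1 / 2)).add (hM.const_mul (lam / 2))).add
    (hL.const_mul (1 / area e))
  refine ⟨D, hD, fun w => ?_⟩
  rw [hD', dAction]
  beta_reduce
  congr 1
  congr 1
  · rw [Finset.mul_sum]
    refine Finset.sum_congr rfl fun i _ => ?_
    simp only [mul_add, Finset.sum_add_distrib]
    have hsw : ∑ j, ∑ k, A N j k * ∫ x in cell e, W12.grad (w j) i x * W12.grad (v k) i x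
        = ∑ j, ∑ k, A N j k * ∫ x in cell e, W12.grad (v j) i x * W12.grad (w k) i x := by
      rw [Finset.sum_comm]
      refine Finset.sum_congr rfl fun j _ => Finset.sum_congr rfl fun k _ => ?_
      rw [A_symm hN3 hN5]
      simp only [mul_comm (W12.grad (w k) i _)]
    rw [hsw]; ring
  · rw [sum_M_mul_integral_eq hN3 hN5 hu]; ring

/-- As differentiability is established, `fderiv` is the true derivative here and not its default
value 0. -/
theorem fderiv_action (hN3 : 3 ≤ N) (hN5 : N ≤ 5) (hu : ∀ j, HasExpMoments e (u₀ j))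
    (lam : ℝ) (n : Fin N → ℕ) (v w : W12N e N) :
    fderiv ℝ (action e lam n u₀) v w = dAction lam n u₀ v w :=
  (hasDifferential_action hN3 hN5 hu lam n v).fderiv_apply w

theorem abs_dAction_le (hN3 : 3 ≤ N) (hN5 : N ≤ 5) (hu : ∀ j, HasExpMoments e (u₀ j))
    (lam : ℝ) (n : Fin N → ℕ) (v w : W12N e N) :
    |dAction lam n u₀ v w| ≤ ‖fderiv ℝ (action e lam n u₀) v‖ * ‖w‖ := by
  rw [← fderiv_action hN3 hN5 hu, ← Real.norm_eq_abs]
  exact ContinuousLinearMap.le_opNorm _ _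

end

section

/-! ### Testing with constants -/

variable {e : Module.Basis (Fin 2) ℝ Plane} {N : ℕ} {u₀ : Fin N → Plane → ℝ}

theorem sum_sq_le_sq_sum {x : Fin N → ℝ} (hx : ∀ j, 0 ≤ x j) : ∑ j, x j ^ 2 ≤ (∑ j, x j) ^ 2 := by
  rw [sq (∑ j, x j), Finset.sum_mul]
  refine Finset.sum_le_sum fun j hj => ?_
  rw [sq]
  exact mul_le_mul_of_nonneg_left (Finset.single_le_sum (fun k _ => hx k) hj) (hx j)

theorem norm_W12N_sq (w : W12N e N) : ‖w‖ ^ 2 = ∑ j, ‖w j‖ ^ 2 :=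
  PiLp.norm_sq_eq_of_L2 (fun _ : Fin N => W12 e) w

theorem norm_W12N_le_sum (w : W12N e N) : ‖w‖ ≤ ∑ j, ‖w j‖ := by
  refine le_of_sq_le_sq ?_ (Finset.sum_nonneg fun j _ => norm_nonneg _)
  rw [norm_W12N_sq]
  exact sum_sq_le_sq_sum fun j => norm_nonneg _

theorem isTest_const (e : Module.Basis (Fin 2) ℝ Plane) (c : ℝ) : IsTest e fun _ => c :=
  ⟨contDiff_const, fun _ _ => rfl⟩

/-- The constant function `1`. -/
def W12.one (e : Module.Basis (Fin 2) ℝ Plane) : W12 e := (isTest_const e 1).isLipPer.toW12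

theorem W12.toFun_one : W12.toFun (W12.one e) =ᵐ[cellMeasure e] fun _ => 1 :=
  (isTest_const e 1).isLipPer.toFun_toW12

theorem W12.gradL_one (i : Fin 2) : W12.gradL e i (W12.one e) = 0 := by
  have h : W12.grad (W12.one e) i =ᵐ[cellMeasure e] partialDeriv i fun _ => 1 :=
    (isTest_const e 1).isLipPer.grad_toW12 i
  refine Lp.ext (h.trans ?_)
  filter_upwards [Lp.coeFn_zero ℝ 2 (cellMeasure e)] with x hx
  rw [hx]
  simp [partialDeriv]

theorem dAction_eq_inner (hu : ∀ j, HasExpMoments e (u₀ j)) (lam : ℝ) (n : Fin N → ℕ)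
    (v w : W12N e N) :
    dAction lam n u₀ v w
      = (∑ i, ∑ j, ∑ k, A N j k * ⟪W12.gradL e i (v j), W12.gradL e i (w k)⟫_ℝ)
        + lam * (∑ j, integralL (memLp_force hu v j) (w j))
        + 1 / area e * ∑ j, bvec n j * integralL (memLp_const (1 : ℝ)) (w j) := by
  simp only [inner_gradL, integralL_apply, mul_one, dAction]

theorem integralL_one {g : Plane → ℝ} (hg : MemLp g 2 (cellMeasure e)) :
    integralL hg (W12.one e) = ∫ x in cell e, g x := by
  rw [integralL_apply]
  refine integral_congr_ae ?_
  filter_upwards [W12.toFun_one (e := e)] with x hx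
  rw [hx, one_mul]

/-- The sum is aᵀKa - ∑ a_j. Half of the coercivity absorbs the linear term at the cost of 15/2 per
component, in total at most 75/2 ≤ 40. -/
theorem sum_force_ge (hN3 : 3 ≤ N) (hN5 : N ≤ 5) (v : W12N e N) (x : Plane) :
    1 / 30 * ∑ j, weight u₀ v j x ^ 2 - 40 ≤ ∑ j, force u₀ v j x := by
  have h1 := K_coercive hN3 hN5 fun j => weight u₀ v j x
  have h2 : ∑ j, force u₀ v j x = (fun j => weight u₀ v j x) ⬝ᵥ K N *ᵥ (fun j => weight u₀ v j x)
      - ∑ j, weight u₀ v j x := by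
    rw [dotProduct, ← Finset.sum_sub_distrib]
    exact Finset.sum_congr rfl fun j _ => by rw [force]; ring
  have h3 : ∑ j, weight u₀ v j x ≤ ∑ j : Fin N, (1 / 30 * weight u₀ v j x ^ 2 + 15 / 2) :=
    Finset.sum_le_sum fun j _ => by nlinarith [sq_nonneg (weight u₀ v j x - 15)]
  rw [Finset.sum_add_distrib, ← Finset.mul_sum, Finset.sum_const, Finset.card_univ,
    Fintype.card_fin, nsmul_eq_mul] at h3
  have h4 : (N : ℝ) ≤ 5 := by exact_mod_cast hN5
  rw [h2]
  linarith

/-- The direction (1,...,1) has no gradient, and the term with b is nonnegative and can be dropped,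
which leaves an upper bound for the integral of the summed forces. -/
theorem exists_integral_weight_sq_le (hN3 : 3 ≤ N) (hN5 : N ≤ 5) {lam : ℝ} (hlam : 0 < lam)
    {n : Fin N → ℕ} (hn : ∃ k, 0 < n k) (hu : ∀ j, HasExpMoments e (u₀ j)) (B : ℝ) :
    ∃ C, 0 ≤ C ∧ ∀ v : W12N e N, ‖fderiv ℝ (action e lam n u₀) v‖ ≤ B →
      ∑ j, ∫ x in cell e, weight u₀ v j x ^ 2 ≤ C := by
  set w : W12N e N := WithLp.toLp 2 fun _ => W12.one e with hw
  refine ⟨max 0 (30 * (lam⁻¹ * (B * ‖w‖) + 40 * area e)), le_max_left _ _, fun v hv => ?_⟩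
  have h1 := (le_abs_self _).trans ((abs_dAction_le hN3 hN5 hu lam n v w).trans
    (mul_le_mul_of_nonneg_right hv (norm_nonneg w)))
  have h2 : dAction lam n u₀ v w = lam * (∑ j, ∫ x in cell e, force u₀ v j x)
      + 1 / area e * ∑ j, bvec n j * area e := by
    rw [dAction_eq_inner hu]
    simp only [hw, W12.gradL_one, inner_zero_right, mul_zero, Finset.sum_const_zero, zero_add,
      integralL_one]
    simp [area]
  have h3 : 0 ≤ 1 / area e * ∑ j, bvec n j * area e :=
    mul_nonneg (one_div_nonneg.mpr (area_pos e).le) (Finset.sum_nonneg fun j _ =>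
      mul_nonneg (bvec_pos hN3 hN5 hn j).le (area_pos e).le)
  have h4 : 1 / 30 * (∑ j, ∫ x in cell e, weight u₀ v j x ^ 2) - 40 * area e
      ≤ ∑ j, ∫ x in cell e, force u₀ v j x := by
    have i1 : ∀ j ∈ Finset.univ, Integrable (fun x => weight u₀ v j x ^ 2) (cellMeasure e) :=
      fun j _ => (memLp_weight hu v j).integrable_sq
    have i2 : ∀ j ∈ Finset.univ, Integrable (fun x => force u₀ v j x) (cellMeasure e) :=
      fun j _ => (memLp_force hu v j).integrable (by norm_num)
    have e1 : 40 * area e = ∫ _ in cell e, (40 : ℝ) := by simp [area, mul_comm]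
    rw [← integral_finsetSum _ i1, ← integral_finsetSum _ i2, ← integral_const_mul, e1]
    refine (integral_sub ((integrable_finsetSum _ i1).const_mul _) (integrable_const _)).symm.trans_le ?_
    exact integral_mono (((integrable_finsetSum _ i1).const_mul _).sub (integrable_const _))
      (integrable_finsetSum _ i2) fun x => sum_force_ge hN3 hN5 v x
  refine le_trans ?_ (le_max_right _ _)
  have h5 : ∑ j, ∫ x in cell e, force u₀ v j x ≤ lam⁻¹ * (B * ‖w‖) := by
    rw [inv_mul_eq_div, le_div_iff₀ hlam]
    linarith
  linarith

/-! ### Composition with the complementarity map -/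

/-- Solutions of the complementarity problem along a Lipschitz doubly periodic family are Lipschitz
and doubly periodic. -/
theorem IsLipPer.compl (hN3 : 3 ≤ N) (hN5 : N ≤ 5) {ξ : Fin N → Plane → ℝ}
    (hξ : ∀ j, IsLipPer e (ξ j)) {sol : (Fin N → ℝ) → Fin N → ℝ} (hsol : ∀ ξ, IsCompl ξ (sol ξ))
    (j : Fin N) : IsLipPer e fun x => sol (fun k => ξ k x) j := by
  constructor
  · choose L hL using fun k => (hξ k).lip
    refine ⟨15 * ∑ k, L k, LipschitzWith.of_dist_le_mul fun x y => ?_⟩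
    have h1 := (hsol fun k => ξ k x).sum_sq_sub_le hN3 hN5 (hsol fun k => ξ k y)
    have h2 : (sol (fun k => ξ k x) j - sol (fun k => ξ k y) j) ^ 2
        ≤ ∑ k, (sol (fun k => ξ k x) k - sol (fun k => ξ k y) k) ^ 2 :=
      Finset.single_le_sum (f := fun k => (sol (fun k => ξ k x) k - sol (fun k => ξ k y) k) ^ 2)
        (fun k _ => sq_nonneg _) (Finset.mem_univ j)
    have h3 : ∑ k, (ξ k x - ξ k y) ^ 2 ≤ (∑ k, (L k : ℝ) * dist x y) ^ 2 := by
      refine le_trans (Finset.sum_le_sum fun k _ => ?_)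
        (sum_sq_le_sq_sum fun k => by positivity)
      rw [← sq_abs]
      exact pow_le_pow_left₀ (abs_nonneg _) ((hL k).dist_le_mul x y) 2
    rw [Real.dist_eq]
    refine abs_le_of_sq_le_sq ?_ (by positivity)
    push_cast
    rw [← Finset.sum_mul] at h3
    nlinarith
  · intro k x
    simp only [(hξ _).periodic k x]

/-- This is `firm` for the data at x and at x + t e_i, divided by t², in the limit t → 0. -/
theorem IsCompl.partialDeriv_inequality {ξ : Fin N → Plane → ℝ} {sol : (Fin N → ℝ) → Fin N → ℝ}
    (hsol : ∀ ξ, IsCompl ξ (sol ξ)) {x : Plane} (hξ : ∀ j, DifferentiableAt ℝ (ξ j) x)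
    (hψ : ∀ j, DifferentiableAt ℝ (fun x => sol (fun k => ξ k x) j) x) (i : Fin 2) :
    (fun j => partialDeriv i (fun x => sol (fun k => ξ k x) j) x) ⬝ᵥ
        K N *ᵥ (fun j => partialDeriv i (fun x => sol (fun k => ξ k x) j) x)
      ≤ ∑ j, partialDeriv i (ξ j) x * partialDeriv i (fun x => sol (fun k => ξ k x) j) x := by
  set ψ : Fin N → Plane → ℝ := fun j x => sol (fun k => ξ k x) j with hψd
  set y : ℝ → Plane := fun t => x + t • EuclideanSpace.single i 1 with hy
  have h1 : ∀ j, Tendsto (fun t : ℝ => t⁻¹ * (ξ j (y t) - ξ j x)) (𝓝[≠] 0)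
      (𝓝 (partialDeriv i (ξ j) x)) := fun j => by
    simpa [hy] using (IsLipPer.partialDeriv_eq_lim (hξ j) i).tendsto_slope_zero
  have h2 : ∀ j, Tendsto (fun t : ℝ => t⁻¹ * (ψ j (y t) - ψ j x)) (𝓝[≠] 0)
      (𝓝 (partialDeriv i (ψ j) x)) := fun j => by
    simpa [hy] using (IsLipPer.partialDeriv_eq_lim (hψ j) i).tendsto_slope_zero
  have h3 : Tendsto (fun t : ℝ => ∑ j, (t⁻¹ * (ψ j (y t) - ψ j x)) *
      ∑ k, K N j k * (t⁻¹ * (ψ k (y t) - ψ k x))) (𝓝[≠] 0)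
      (𝓝 (∑ j, partialDeriv i (ψ j) x * ∑ k, K N j k * partialDeriv i (ψ k) x)) :=
    tendsto_finsetSum _ fun j _ => (h2 j).mul
      (tendsto_finsetSum _ fun k _ => (h2 k).const_mul _)
  have h4 : Tendsto (fun t : ℝ => ∑ j, (t⁻¹ * (ξ j (y t) - ξ j x)) * (t⁻¹ * (ψ j (y t) - ψ j x)))
      (𝓝[≠] 0) (𝓝 (∑ j, partialDeriv i (ξ j) x * partialDeriv i (ψ j) x)) :=
    tendsto_finsetSum _ fun j _ => (h1 j).mul (h2 j)
  refine le_of_tendsto_of_tendsto h3 h4 (Eventually.of_forall fun t => ?_)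
  have h5 := (hsol fun k => ξ k (y t)).firm (hsol fun k => ξ k x)
  simp only [dotProduct, mulVec, Pi.sub_apply] at h5
  have h6 := mul_le_mul_of_nonneg_left h5 (sq_nonneg t⁻¹)
  simp only [Finset.mul_sum] at h6 ⊢
  refine le_of_eq_of_le ?_ (h6.trans_eq ?_)
  · exact Finset.sum_congr rfl fun j _ => Finset.sum_congr rfl fun k _ => by ring
  · exact Finset.sum_congr rfl fun j _ => by ring

end

section

/-! ### The test functions built from the complementarity map -/

variable {e : Module.Basis (Fin 2) ℝ Plane} {N : ℕ} {u₀ : Fin N → Plane → ℝ}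

/-- The tuple `K W`. -/
def cartan (W : Fin N → W12 e) : W12N e N := WithLp.toLp 2 fun j => ∑ k, K N j k • W k

theorem norm_cartan_le (hN5 : N ≤ 5) (W : Fin N → W12 e) : ‖cartan W‖ ≤ 10 * ∑ k, ‖W k‖ := by
  have h1 : ∀ j, ‖cartan W j‖ ≤ 2 * ∑ k, ‖W k‖ := fun j => by
    refine (norm_sum_le Finset.univ fun k => K N j k • W k).trans ?_
    rw [Finset.mul_sum]
    refine Finset.sum_le_sum fun k _ => ?_
    rw [norm_smul, Real.norm_eq_abs]
    exact mul_le_mul_of_nonneg_right (abs_K_le j k) (norm_nonneg _)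
  have h2 : (N : ℝ) ≤ 5 := by exact_mod_cast hN5
  have h3 : 0 ≤ ∑ k, ‖W k‖ := Finset.sum_nonneg fun k _ => norm_nonneg _
  calc ‖cartan W‖ ≤ ∑ j, ‖cartan W j‖ := norm_W12N_le_sum _
    _ ≤ ∑ _j : Fin N, 2 * ∑ k, ‖W k‖ := Finset.sum_le_sum fun j _ => h1 j
    _ = N * (2 * ∑ k, ‖W k‖) := by simp
    _ ≤ 5 * (2 * ∑ k, ‖W k‖) := by gcongr
    _ = _ := by ring

/-- The relation AK = 1 decouples the gradient term and turns b into the vortex numbers. -/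
theorem dAction_cartan (hN3 : 3 ≤ N) (hN5 : N ≤ 5) (hu : ∀ j, HasExpMoments e (u₀ j))
    (lam : ℝ) (n : Fin N → ℕ) (v : W12N e N) (W : Fin N → W12 e) :
    dAction lam n u₀ v (cartan W)
      = (∑ i, ∑ j, ∫ x in cell e, W12.grad (v j) i x * W12.grad (W j) i x)
        + lam * (∑ j, ∑ k, K N j k * ∫ x in cell e, W12.toFun (W k) x * force u₀ v j x)
        + 4 * Real.pi / area e * ∑ j, n j * ∫ x in cell e, W12.toFun (W j) x := by
  have hc : ∀ j, cartan W j = ∑ k, K N j k • W k := fun j => rfl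
  rw [dAction_eq_inner hu]
  simp only [hc, map_sum, map_smul, inner_sum, inner_smul_right, smul_eq_mul, integralL_apply,
    mul_one]
  congr 1
  · congr 1
    refine Finset.sum_congr rfl fun i _ => Finset.sum_congr rfl fun j _ => ?_
    have h1 : (A N *ᵥ (K N *ᵥ fun l => ⟪W12.gradL e i (v j), W12.gradL e i (W l)⟫_ℝ)) j
        = ⟪W12.gradL e i (v j), W12.gradL e i (W j)⟫_ℝ := by
      rw [mulVec_mulVec, A_mul_K hN3 hN5, one_mulVec]
    rw [← inner_gradL, ← h1]
    rfl
  · have h2 := bvec_dot_K_mulVec hN3 hN5 n fun k => ∫ x in cell e, W12.toFun (W k) x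
    simp only [dotProduct, mulVec] at h2
    rw [h2]; ring

/-- The function `log rⱼ + u⁰ⱼ + vⱼ`. -/
def logWeight (u₀ : Fin N → Plane → ℝ) (v : W12N e N) (j : Fin N) (x : Plane) : ℝ :=
  W12.toFun (v j) x + u₀ j x + Real.log (r N j)

/-- Smooth approximations of `log rⱼ + u⁰ⱼ + vⱼ`. -/
def logWeightApprox (u₀ : Fin N → Plane → ℝ) (v : W12N e N) (m : ℕ) (j : Fin N) (x : Plane) : ℝ :=
  fejer e (W12.toFun (v j)) m x + fejer e (u₀ j) m x + Real.log (r N j)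

theorem exp_logWeight (hN3 : 3 ≤ N) (hN5 : N ≤ 5) (v : W12N e N) (j : Fin N) (x : Plane) :
    Real.exp (logWeight u₀ v j x) = weight u₀ v j x := by
  rw [logWeight, Real.exp_add, Real.exp_log (r_pos hN3 hN5 j), weight, density,
    add_comm (u₀ j x), mul_comm]

theorem isTest_logWeightApprox (v : W12N e N) (m : ℕ) (j : Fin N) :
    IsTest e (logWeightApprox u₀ v m j) :=
  ⟨((isTest_fejer _ m).smooth.add (isTest_fejer _ m).smooth).add contDiff_const, fun k x => by
    simp only [logWeightApprox, (isTest_fejer _ m).periodic k x]⟩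

theorem partialDeriv_logWeightApprox (v : W12N e N) (m : ℕ) (j : Fin N) (i : Fin 2) (x : Plane) :
    partialDeriv i (logWeightApprox u₀ v m j) x
      = partialDeriv i (fejer e (W12.toFun (v j)) m) x + partialDeriv i (fejer e (u₀ j) m) x := by
  have h1 : Differentiable ℝ (fejer e (W12.toFun (v j)) m) :=
    (isTest_fejer _ m).smooth.differentiable (by simp)
  have h2 : Differentiable ℝ (fejer e (u₀ j) m) :=
    (isTest_fejer _ m).smooth.differentiable (by simp)
  have h3 : logWeightApprox u₀ v m j
      = fun x => fejer e (W12.toFun (v j)) m x + fejer e (u₀ j) m x + Real.log (r N j) := rfl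
  rw [partialDeriv, h3, fderiv_add_const, fderiv_fun_add (h1 x) (h2 x)]
  rfl

theorem memLp_logWeight (hu : ∀ j, MemLp (u₀ j) 2 (cellMeasure e)) (v : W12N e N) (j : Fin N) :
    MemLp (logWeight u₀ v j) 2 (cellMeasure e) :=
  ((W12.memLp_toFun (v j)).add (hu j)).add (memLp_const _)

theorem tendsto_integral_logWeight_sub (hu : ∀ j, MemLp (u₀ j) 2 (cellMeasure e)) (v : W12N e N)
    (j : Fin N) :
    Tendsto (fun m => ∫ x in cell e, (logWeight u₀ v j x - logWeightApprox u₀ v m j x) ^ 2) atTop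
      (𝓝 0) := by
  have h := ((tendsto_integral_sub_fejer_sq (W12.memLp_toFun (v j))).const_mul 2).add
    ((tendsto_integral_sub_fejer_sq (hu j)).const_mul 2)
  rw [mul_zero, add_zero] at h
  refine squeeze_zero (fun m => integral_nonneg fun x => sq_nonneg _) (fun m => ?_) h
  have h1 := ((W12.memLp_toFun (v j)).sub
    ((isTest_fejer (e := e) (W12.toFun (v j)) m).isLipPer.memLp 2)).integrable_sq.const_mul 2
  have h2 := ((hu j).sub ((isTest_fejer (e := e) (u₀ j) m).isLipPer.memLp 2)).integrable_sq.const_mul 2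
  have h3 := ((memLp_logWeight hu v j).sub
    ((isTest_logWeightApprox (u₀ := u₀) v m j).isLipPer.memLp 2)).integrable_sq
  rw [← integral_const_mul, ← integral_const_mul]
  refine (integral_mono h3 (h1.add h2) fun x => ?_).trans_eq (integral_add h1 h2)
  simp only [logWeight, logWeightApprox, Pi.sub_apply, Pi.add_apply]
  nlinarith [sq_nonneg ((W12.toFun (v j) x - fejer e (W12.toFun (v j)) m x)
    - (u₀ j x - fejer e (u₀ j) m x))]

variable {sol : (Fin N → ℝ) → Fin N → ℝ}

theorem IsCompl.continuous (hN3 : 3 ≤ N) (hN5 : N ≤ 5) (hsol : ∀ ξ, IsCompl ξ (sol ξ))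
    (j : Fin N) : Continuous fun ξ => sol ξ j := by
  -- 34 exceeds the square root of 225 · 5; the 5 comes from the sup distance on at most five
  -- coordinates.
  refine (LipschitzWith.of_dist_le_mul (K := 34) fun ξ ξ' => ?_).continuous
  have h1 := (hsol ξ).sum_sq_sub_le hN3 hN5 (hsol ξ')
  have h2 : (sol ξ j - sol ξ' j) ^ 2 ≤ ∑ k, (sol ξ k - sol ξ' k) ^ 2 :=
    Finset.single_le_sum (f := fun k => (sol ξ k - sol ξ' k) ^ 2)
      (fun k _ => sq_nonneg _) (Finset.mem_univ j)
  have h3 : ∑ k, (ξ k - ξ' k) ^ 2 ≤ ∑ _k : Fin N, dist ξ ξ' ^ 2 := by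
    refine Finset.sum_le_sum fun k _ => ?_
    rw [← sq_abs]
    exact pow_le_pow_left₀ (abs_nonneg _) (dist_le_pi_dist ξ ξ' k) 2
  rw [Finset.sum_const, Finset.card_univ, Fintype.card_fin, nsmul_eq_mul] at h3
  have h4 : (N : ℝ) ≤ 5 := by exact_mod_cast hN5
  have h5 : (N : ℝ) * dist ξ ξ' ^ 2 ≤ 5 * dist ξ ξ' ^ 2 := by gcongr
  rw [Real.dist_eq]
  refine abs_le_of_sq_le_sq ?_ (by positivity)
  push_cast
  nlinarith [sq_nonneg (dist ξ ξ')]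

theorem memLp_compl (hN3 : 3 ≤ N) (hN5 : N ≤ 5) (hsol : ∀ ξ, IsCompl ξ (sol ξ))
    {ξ : Fin N → Plane → ℝ} (hξ : ∀ k, MemLp (ξ k) 2 (cellMeasure e)) (j : Fin N) :
    MemLp (fun x => sol (fun k => ξ k x) j) 2 (cellMeasure e) := by
  have hm : AEStronglyMeasurable (fun x => sol (fun k => ξ k x) j) (cellMeasure e) :=
    (IsCompl.continuous hN3 hN5 hsol j).measurable.comp_aemeasurable
      (aemeasurable_pi_lambda _ fun k => (hξ k).1.aemeasurable) |>.aestronglyMeasurable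
  refine (memLp_two_iff_integrable_sq hm).mpr ?_
  refine ((integrable_finsetSum Finset.univ fun k _ => (hξ k).integrable_sq).const_mul 225).mono'
    (hm.pow 2) (ae_of_all _ fun x => ?_)
  rw [Real.norm_of_nonneg (sq_nonneg _)]
  refine (Finset.single_le_sum (f := fun k => sol (fun k => ξ k x) k ^ 2)
    (fun k _ => sq_nonneg _) (Finset.mem_univ j)).trans
    (((hsol fun k => ξ k x).sum_sq_le hN3 hN5).trans ?_)
  refine mul_le_mul_of_nonneg_left (Finset.sum_le_sum fun k _ => ?_) (by norm_num)
  rcases le_total (ξ k x) 0 with h | h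
  · rw [max_eq_right h]; simpa using sq_nonneg (ξ k x)
  · rw [max_eq_left h]

theorem integral_compl_sub_sq_le (hN3 : 3 ≤ N) (hN5 : N ≤ 5) (hsol : ∀ ξ, IsCompl ξ (sol ξ))
    {ξ ξ' : Fin N → Plane → ℝ} (hξ : ∀ k, MemLp (ξ k) 2 (cellMeasure e))
    (hξ' : ∀ k, MemLp (ξ' k) 2 (cellMeasure e)) (j : Fin N) :
    ∫ x in cell e, (sol (fun k => ξ k x) j - sol (fun k => ξ' k x) j) ^ 2
      ≤ 225 * ∑ k, ∫ x in cell e, (ξ k x - ξ' k x) ^ 2 := by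
  have hi : ∀ k ∈ Finset.univ, Integrable (fun x => (ξ k x - ξ' k x) ^ 2) (cellMeasure e) :=
    fun k _ => ((hξ k).sub (hξ' k)).integrable_sq
  rw [← integral_finsetSum _ hi, ← integral_const_mul]
  refine integral_mono ((memLp_compl hN3 hN5 hsol hξ j).sub
    (memLp_compl hN3 hN5 hsol hξ' j)).integrable_sq
    ((integrable_finsetSum _ hi).const_mul 225) fun x => ?_
  refine (Finset.single_le_sum
    (f := fun k => (sol (fun k => ξ k x) k - sol (fun k => ξ' k x) k) ^ 2)
    (fun k _ => sq_nonneg _) (Finset.mem_univ j)).trans ?_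
  exact (hsol fun k => ξ k x).sum_sq_sub_le hN3 hN5 (hsol fun k => ξ' k x)

end

section

/-! ### Exponential integrability along almost critical points -/

variable {e : Module.Basis (Fin 2) ℝ Plane} {N : ℕ} {u₀ : Fin N → Plane → ℝ}
  {sol : (Fin N → ℝ) → Fin N → ℝ}

theorem sum_integral_partialDeriv_compl_ge (hN3 : 3 ≤ N) (hN5 : N ≤ 5)
    (hsol : ∀ ξ, IsCompl ξ (sol ξ)) {ξ : Fin N → Plane → ℝ} (hξ : ∀ j, IsLipPer e (ξ j))
    (i : Fin 2) :
    1 / 15 * ∑ j, ∫ x in cell e, partialDeriv i (fun x => sol (fun k => ξ k x) j) x ^ 2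
      ≤ ∑ j, ∫ x in cell e,
          partialDeriv i (ξ j) x * partialDeriv i (fun x => sol (fun k => ξ k x) j) x := by
  have hψ := IsLipPer.compl hN3 hN5 hξ hsol
  have i1 : ∀ j ∈ Finset.univ, Integrable
      (fun x => partialDeriv i (fun x => sol (fun k => ξ k x) j) x ^ 2) (cellMeasure e) :=
    fun j _ => ((hψ j).memLp_partialDeriv i 2).integrable_sq
  have i2 : ∀ j ∈ Finset.univ, Integrable (fun x => partialDeriv i (ξ j) x *
      partialDeriv i (fun x => sol (fun k => ξ k x) j) x) (cellMeasure e) :=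
    fun j _ => ((hξ j).memLp_partialDeriv i 2).integrable_mul ((hψ j).memLp_partialDeriv i 2)
  rw [← integral_finsetSum _ i1, ← integral_finsetSum _ i2, ← integral_const_mul]
  refine integral_mono_ae ((integrable_finsetSum _ i1).const_mul _) (integrable_finsetSum _ i2) ?_
  have h1 : ∀ᵐ x ∂cellMeasure e, ∀ j, DifferentiableAt ℝ (ξ j) x :=
    ae_all_iff.mpr fun j => ae_restrict_of_ae (hξ j).ae_differentiableAt
  have h2 : ∀ᵐ x ∂cellMeasure e, ∀ j, DifferentiableAt ℝ (fun x => sol (fun k => ξ k x) j) x :=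
    ae_all_iff.mpr fun j => ae_restrict_of_ae (hψ j).ae_differentiableAt
  filter_upwards [h1, h2] with x hx hx'
  exact (K_coercive hN3 hN5 _).trans (IsCompl.partialDeriv_inequality hsol hx hx' i)

/-- The deviation of the weak gradient from its smooth approximation. -/
def gradDefect (v : W12N e N) (m : ℕ) : ℝ :=
  ∑ i, ∑ j, Real.sqrt (∫ x in cell e, (W12.grad (v j) i x - fejer e (W12.grad (v j) i) m x) ^ 2)

theorem tendsto_gradDefect (v : W12N e N) : Tendsto (gradDefect v) atTop (𝓝 0) := by
  have h : Tendsto (gradDefect v) atTop (𝓝 (∑ _i : Fin 2, ∑ _j : Fin N, Real.sqrt 0)) :=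
    tendsto_finsetSum _ fun i _ => tendsto_finsetSum _ fun j _ =>
      (Real.continuous_sqrt.tendsto 0).comp (tendsto_integral_sub_fejer_sq (W12.memLp_grad (v j) i))
  simpa using h

theorem sqrt_integral_grad_sq_le (f : W12 e) (i : Fin 2) :
    Real.sqrt (∫ x in cell e, W12.grad f i x ^ 2) ≤ ‖f‖ := by
  rw [Real.sqrt_le_left (norm_nonneg f)]
  refine le_trans ?_ (W12.dirichlet_le f)
  exact Finset.single_le_sum (f := fun i => ∫ x in cell e, W12.grad f i x ^ 2)
    (fun k _ => integral_nonneg fun x => sq_nonneg _) (Finset.mem_univ i)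

/-- The gradient of v splits into its distance to its Fejér sum, plus ∇ξ_m, minus the gradient of
the Fejér sum of u⁰, where ξ_m is the smooth log-weight. The first is paid for by `gradDefect`, the
second gives the coercive term, the third uses the lower bound on the Laplacian and ψ ≥ 0. The loss
it causes is exactly the b term of `dAction_cartan`. -/
theorem integral_grad_mul_grad_ge (hN3 : 3 ≤ N) (hN5 : N ≤ 5) {n : Fin N → ℕ}
    {p : (i : Fin N) → Fin (n i) → Plane} (hu₀ : ∀ i, IsBackground e (p i) (u₀ i))
    (hsol : ∀ ξ, IsCompl ξ (sol ξ)) (v : W12N e N) (m : ℕ) {W : Fin N → W12 e}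
    (hW : ∀ j, W12.toFun (W j) =ᵐ[cellMeasure e]
      fun x => sol (fun k => logWeightApprox u₀ v m k x) j)
    (hW' : ∀ j i, W12.grad (W j) i =ᵐ[cellMeasure e]
      partialDeriv i fun x => sol (fun k => logWeightApprox u₀ v m k x) j) :
    1 / 15 * (∑ j, dirichlet (W j)) - gradDefect v m * (∑ j, ‖W j‖)
        - 4 * Real.pi / area e * (∑ j, n j * ∫ x in cell e, W12.toFun (W j) x)
      ≤ ∑ i, ∑ j, ∫ x in cell e, W12.grad (v j) i x * W12.grad (W j) i x := by
  set ψ : Fin N → Plane → ℝ := fun j x => sol (fun k => logWeightApprox u₀ v m k x) j with hψd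
  have hξ : ∀ j, IsLipPer e (logWeightApprox u₀ v m j) := fun j =>
    (isTest_logWeightApprox v m j).isLipPer
  have hψ : ∀ j, IsLipPer e (ψ j) := IsLipPer.compl hN3 hN5 hξ hsol
  have hdir : ∑ j, dirichlet (W j) = ∑ i, ∑ j, ∫ x in cell e, partialDeriv i (ψ j) x ^ 2 := by
    rw [Finset.sum_comm]
    refine Finset.sum_congr rfl fun j _ => Finset.sum_congr rfl fun i _ => ?_
    exact integral_congr_ae ((hW' j i).fun_comp fun t => t ^ 2)
  have hcoer : 1 / 15 * (∑ j, dirichlet (W j)) ≤ ∑ i, ∑ j, ∫ x in cell e,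
      partialDeriv i (logWeightApprox u₀ v m j) x * partialDeriv i (ψ j) x := by
    rw [hdir, Finset.mul_sum]
    exact Finset.sum_le_sum fun i _ => sum_integral_partialDeriv_compl_ge hN3 hN5 hsol hξ i
  have hback : ∑ i, ∑ j, ∫ x in cell e,
        partialDeriv i (fejer e (u₀ j) m) x * partialDeriv i (ψ j) x
      ≤ 4 * Real.pi / area e * (∑ j, n j * ∫ x in cell e, W12.toFun (W j) x) := by
    rw [Finset.sum_comm, Finset.mul_sum]
    refine Finset.sum_le_sum fun j _ => ((hu₀ j).integral_grad_fejer_mul_le m (hψ j) fun x =>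
      (hsol _).nonneg j).trans_eq ?_
    have e1 : ∫ x in cell e, W12.toFun (W j) x = ∫ x in cell e, ψ j x := integral_congr_ae (hW j)
    rw [e1]; ring
  have hsplit : ∀ i j, (∫ x in cell e, partialDeriv i (logWeightApprox u₀ v m j) x
        * partialDeriv i (ψ j) x)
      - (∫ x in cell e, partialDeriv i (fejer e (u₀ j) m) x * partialDeriv i (ψ j) x)
      - Real.sqrt (∫ x in cell e, (W12.grad (v j) i x - fejer e (W12.grad (v j) i) m x) ^ 2)
        * (∑ j, ‖W j‖)
      ≤ ∫ x in cell e, W12.grad (v j) i x * W12.grad (W j) i x := fun i j => by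
    have m1 : MemLp (fun x => W12.grad (v j) i x - fejer e (W12.grad (v j) i) m x) 2
        (cellMeasure e) := (W12.memLp_grad (v j) i).sub
      ((isTest_fejer (e := e) (W12.grad (v j) i) m).isLipPer.memLp 2)
    have m2 := W12.memLp_grad (W j) i
    have m3 := (hξ j).memLp_partialDeriv i 2
    have m4 := (isTest_fejer (e := e) (u₀ j) m).isLipPer.memLp_partialDeriv i 2
    have m5 := (hψ j).memLp_partialDeriv i 2
    have i1 : Integrable (fun x => (W12.grad (v j) i x - fejer e (W12.grad (v j) i) m x)
      * W12.grad (W j) i x) (cellMeasure e) := m1.integrable_mul m2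
    have i2 : Integrable (fun x => partialDeriv i (logWeightApprox u₀ v m j) x
      * partialDeriv i (ψ j) x) (cellMeasure e) := m3.integrable_mul m5
    have i3 : Integrable (fun x => partialDeriv i (fejer e (u₀ j) m) x
      * partialDeriv i (ψ j) x) (cellMeasure e) := m4.integrable_mul m5
    have e1 : ∫ x in cell e, W12.grad (v j) i x * W12.grad (W j) i x
        = (∫ x in cell e, (W12.grad (v j) i x - fejer e (W12.grad (v j) i) m x)
            * W12.grad (W j) i x)
          + ((∫ x in cell e, partialDeriv i (logWeightApprox u₀ v m j) x * partialDeriv i (ψ j) x)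
            - ∫ x in cell e, partialDeriv i (fejer e (u₀ j) m) x * partialDeriv i (ψ j) x) := by
      rw [← integral_sub i2 i3]
      refine Eq.trans (integral_congr_ae ?_) (integral_add i1 (i2.sub i3))
      filter_upwards [hW' j i] with x hx
      have h2 := partialDeriv_logWeightApprox (u₀ := u₀) v m j i x
      rw [(W12.isWeakPartial (v j) i).partialDeriv_fejer m] at h2
      rw [hx, h2]; ring
    have h1 := neg_le_of_abs_le (abs_integral_mul_le m1 m2)
    have h2 : Real.sqrt (∫ x in cell e, W12.grad (W j) i x ^ 2) ≤ ∑ j, ‖W j‖ :=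
      (sqrt_integral_grad_sq_le (W j) i).trans (Finset.single_le_sum (f := fun j => ‖W j‖)
        (fun k _ => norm_nonneg _) (Finset.mem_univ j))
    have h3 := mul_le_mul_of_nonneg_left h2 (Real.sqrt_nonneg
      (∫ x in cell e, (W12.grad (v j) i x - fejer e (W12.grad (v j) i) m x) ^ 2))
    rw [e1]
    linarith
  have hsum := Finset.sum_le_sum fun i (_ : i ∈ Finset.univ) =>
    Finset.sum_le_sum fun j (_ : j ∈ Finset.univ) => hsplit i j
  simp only [Finset.sum_sub_distrib, ← Finset.sum_mul] at hsum
  rw [gradDefect]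
  linarith

end

section

variable {e : Module.Basis (Fin 2) ℝ Plane} {N : ℕ} {u₀ : Fin N → Plane → ℝ}
  {sol : (Fin N → ℝ) → Fin N → ℝ}

/-- This integrates the pointwise bound `IsCompl.pairing_lower_bound` at ξ = `logWeight`. The limit
ψ is used instead of its approximations because that bound needs exp ξ to be the weight itself. -/
theorem sum_integral_compl_mul_force_ge (hN3 : 3 ≤ N) (hN5 : N ≤ 5)
    (hu : ∀ j, HasExpMoments e (u₀ j)) (hu2 : ∀ j, MemLp (u₀ j) 2 (cellMeasure e))
    (hsol : ∀ ξ, IsCompl ξ (sol ξ)) (v : W12N e N) :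
    -(500 * (area e + ∑ j, ∫ x in cell e, weight u₀ v j x ^ 2))
      ≤ ∑ j, ∑ k, K N j k *
          ∫ x in cell e, sol (fun l => logWeight u₀ v l x) k * force u₀ v j x := by
  have hψ := memLp_compl hN3 hN5 hsol (memLp_logWeight hu2 v)
  have i1 : ∀ j k, Integrable (fun x => sol (fun l => logWeight u₀ v l x) k * force u₀ v j x)
      (cellMeasure e) := fun j k => (hψ k).integrable_mul (memLp_force hu v j)
  have i2 : ∀ j ∈ Finset.univ, Integrable (fun x => weight u₀ v j x ^ 2) (cellMeasure e) :=
    fun j _ => (memLp_weight hu v j).integrable_sq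
  have e1 : ∑ j, ∑ k, K N j k * ∫ x in cell e, sol (fun l => logWeight u₀ v l x) k * force u₀ v j x
      = ∫ x in cell e, ∑ j, ∑ k, K N j k * (sol (fun l => logWeight u₀ v l x) k * force u₀ v j x) := by
    rw [integral_finsetSum _ fun j _ => integrable_finsetSum _ fun k _ => (i1 j k).const_mul (K N j k)]
    refine Finset.sum_congr rfl fun j _ => ?_
    rw [integral_finsetSum _ fun k _ => (i1 j k).const_mul (K N j k)]
    exact Finset.sum_congr rfl fun k _ => (integral_const_mul _ _).symm
  have e2 : -(500 * (area e + ∑ j, ∫ x in cell e, weight u₀ v j x ^ 2))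
      = ∫ x in cell e, -(500 * (1 + ∑ j, weight u₀ v j x ^ 2)) := by
    rw [integral_neg, integral_const_mul]
    congr 2
    refine Eq.trans ?_ (integral_add (integrable_const 1) (integrable_finsetSum _ i2)).symm
    rw [integral_finsetSum _ i2]
    simp [area]
  rw [e1, e2]
  refine integral_mono (((integrable_const 1).add (integrable_finsetSum _ i2)).const_mul 500).neg
    (integrable_finsetSum _ fun j _ => integrable_finsetSum _ fun k _ => (i1 j k).const_mul _)
    fun x => ?_
  have h1 := (hsol fun l => logWeight u₀ v l x).pairing_lower_bound hN3 hN5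
  simp only [exp_logWeight hN3 hN5] at h1
  refine h1.trans_eq (Finset.sum_congr rfl fun j _ => ?_)
  rw [mulVec, dotProduct, Finset.sum_mul]
  exact Finset.sum_congr rfl fun k _ => by rw [force]; ring

/-- ψ is controlled by ξ⁺, and ξ⁺ ≤ exp ξ. -/
theorem sum_integral_compl_sq_le (hN3 : 3 ≤ N) (hN5 : N ≤ 5)
    (hu : ∀ j, HasExpMoments e (u₀ j)) (hu2 : ∀ j, MemLp (u₀ j) 2 (cellMeasure e))
    (hsol : ∀ ξ, IsCompl ξ (sol ξ)) (v : W12N e N) :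
    ∑ j, ∫ x in cell e, sol (fun l => logWeight u₀ v l x) j ^ 2
      ≤ 225 * ∑ j, ∫ x in cell e, weight u₀ v j x ^ 2 := by
  have i1 : ∀ j ∈ Finset.univ, Integrable (fun x => sol (fun l => logWeight u₀ v l x) j ^ 2)
    (cellMeasure e) := fun j _ =>
      (memLp_compl hN3 hN5 hsol (memLp_logWeight hu2 v) j).integrable_sq
  have i2 : ∀ j ∈ Finset.univ, Integrable (fun x => weight u₀ v j x ^ 2) (cellMeasure e) :=
    fun j _ => (memLp_weight hu v j).integrable_sq
  rw [← integral_finsetSum _ i1, ← integral_finsetSum _ i2, ← integral_const_mul]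
  refine integral_mono (integrable_finsetSum _ i1) ((integrable_finsetSum _ i2).const_mul _)
    fun x => ?_
  refine ((hsol fun l => logWeight u₀ v l x).sum_sq_le hN3 hN5).trans ?_
  refine mul_le_mul_of_nonneg_left (Finset.sum_le_sum fun j _ => ?_) (by norm_num)
  refine pow_le_pow_left₀ (le_max_right _ _) ?_ 2
  rw [← exp_logWeight hN3 hN5]
  exact max_le (by linarith [Real.add_one_le_exp (logWeight u₀ v j x)]) (Real.exp_pos _).le

/-- Along almost critical points the smooth approximations of the solution of the complementarity
problem stay bounded in the Sobolev space. -/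
theorem exists_norm_compl_le (hN3 : 3 ≤ N) (hN5 : N ≤ 5) {lam : ℝ} (hlam : 0 < lam)
    {n : Fin N → ℕ} (hn : ∃ k, 0 < n k) {p : (i : Fin N) → Fin (n i) → Plane}
    (hu₀ : ∀ i, IsBackground e (p i) (u₀ i)) (hsol : ∀ ξ, IsCompl ξ (sol ξ)) (B : ℝ) :
    ∃ R, ∀ v : W12N e N, ‖fderiv ℝ (action e lam n u₀) v‖ ≤ B →
      ∃ W : ℕ → Fin N → W12 e,
        (∀ j, Tendsto (fun m => ∫ x in cell e,
          (sol (fun l => logWeight u₀ v l x) j - W12.toFun (W m j) x) ^ 2) atTop (𝓝 0)) ∧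
        ∀ᶠ m in atTop, ∀ j, ‖W m j‖ ≤ R := by
  have hu : ∀ j, HasExpMoments e (u₀ j) := fun j => (hu₀ j).hasExpMoments
  have hu2 : ∀ j, MemLp (u₀ j) 2 (cellMeasure e) := fun j => (hu₀ j).memLp_two
  obtain ⟨C, hC0, hC⟩ := exists_integral_weight_sq_le hN3 hN5 hlam hn hu B
  -- α and β are made for T² ≤ αT + β with T = ∑ ‖W_j‖. The factor 5 is from T² ≤ N ∑ ‖W_j‖², 75 = 5
  -- · 15 from coercivity, 10 from `norm_cartan_le`; the summands 1 allow for m being large but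
  -- finite.
  set α := 75 * (1 + 10 * B) with hα
  set β := 5 * (225 * C + 1) + 75 * (lam * (500 * (area e + C) + 1)) with hβ
  refine ⟨α + β + 1, fun v hv => ?_⟩
  have hB : 0 ≤ B := (norm_nonneg _).trans hv
  have hCv := hC v hv
  have hξ : ∀ m j, IsLipPer e (logWeightApprox u₀ v m j) := fun m j =>
    (isTest_logWeightApprox v m j).isLipPer
  have hψ : ∀ m j, IsLipPer e (fun x => sol (fun k => logWeightApprox u₀ v m k x) j) :=
    fun m => IsLipPer.compl hN3 hN5 (hξ m) hsol
  set W : ℕ → Fin N → W12 e := fun m j => (hψ m j).toW12 with hW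
  have hWf : ∀ m j, W12.toFun (W m j) =ᵐ[cellMeasure e]
    fun x => sol (fun k => logWeightApprox u₀ v m k x) j := fun m j => (hψ m j).toFun_toW12
  have hlim : ∀ j, Tendsto (fun m => ∫ x in cell e,
      (sol (fun l => logWeight u₀ v l x) j - W12.toFun (W m j) x) ^ 2) atTop (𝓝 0) := fun j => by
    have h1 : Tendsto (fun m => 225 * ∑ k, ∫ x in cell e,
        (logWeight u₀ v k x - logWeightApprox u₀ v m k x) ^ 2) atTop (𝓝 (225 * ∑ _k : Fin N, 0)) :=
      (tendsto_finsetSum _ fun k _ => tendsto_integral_logWeight_sub hu2 v k).const_mul 225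
    rw [Finset.sum_const_zero, mul_zero] at h1
    refine squeeze_zero (fun m => integral_nonneg fun x => sq_nonneg _) (fun m => ?_) h1
    refine le_trans (le_of_eq (integral_congr_ae ?_)) (integral_compl_sub_sq_le hN3 hN5 hsol
      (memLp_logWeight hu2 v) (fun k => (hξ m k).memLp 2) j)
    filter_upwards [hWf m j] with x hx
    rw [hx]
  refine ⟨W, hlim, ?_⟩
  have hψL := memLp_compl hN3 hN5 hsol (memLp_logWeight hu2 v)
  have hP : Tendsto (fun m => ∑ j, ∑ k, K N j k * ∫ x in cell e, W12.toFun (W m k) x * force u₀ v j x)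
      atTop (𝓝 (∑ j, ∑ k, K N j k *
        ∫ x in cell e, sol (fun l => logWeight u₀ v l x) k * force u₀ v j x)) :=
    tendsto_finsetSum _ fun j _ => tendsto_finsetSum _ fun k _ =>
      (tendsto_integral_mul_of_L2 (hψL k) (fun m => W12.memLp_toFun (W m k))
        (memLp_force hu v j) (hlim k)).const_mul (K N j k)
  have hQ : Tendsto (fun m => ∑ j, ∫ x in cell e, W12.toFun (W m j) x ^ 2) atTop
      (𝓝 (∑ j, ∫ x in cell e, sol (fun l => logWeight u₀ v l x) j ^ 2)) :=
    tendsto_finsetSum _ fun j _ =>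
      tendsto_integral_sq_of_L2 (hψL j) (fun m => W12.memLp_toFun (W m j)) (hlim j)
  have hP1 := sum_integral_compl_mul_force_ge hN3 hN5 hu hu2 hsol v
  have hQ1 := sum_integral_compl_sq_le hN3 hN5 hu hu2 hsol v
  filter_upwards [hP.eventually_const_lt (sub_one_lt _), hQ.eventually_lt_const (lt_add_one _),
    (tendsto_gradDefect v).eventually_lt_const one_pos] with m hm1 hm2 hm3 j
  have hT0 : 0 ≤ ∑ j, ‖W m j‖ := Finset.sum_nonneg fun k _ => norm_nonneg _
  refine (Finset.single_le_sum (f := fun j => ‖W m j‖) (fun k _ => norm_nonneg _)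
    (Finset.mem_univ j)).trans ?_
  have h1 := integral_grad_mul_grad_ge hN3 hN5 hu₀ hsol v m (hWf m) fun j i =>
    (hψ m j).grad_toW12 i
  have h2 := (le_abs_self _).trans ((abs_dAction_le hN3 hN5 hu lam n v (cartan (W m))).trans
    (mul_le_mul hv (norm_cartan_le hN5 (W m)) (norm_nonneg _) hB))
  -- The b term in `h2` and the background loss in `h1` are opposite and cancel in the final
  -- combination.
  rw [dAction_cartan hN3 hN5 hu] at h2
  have h3 : ∑ j, ‖W m j‖ ^ 2
      = (∑ j, ∫ x in cell e, W12.toFun (W m j) x ^ 2) + ∑ j, dirichlet (W m j) := by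
    rw [← Finset.sum_add_distrib]
    exact Finset.sum_congr rfl fun j _ => W12.norm_sq _
  have h4 : (∑ j, ‖W m j‖) ^ 2 ≤ 5 * ∑ j, ‖W m j‖ ^ 2 := by
    refine sq_sum_le_card_mul_sum_sq.trans ?_
    rw [Finset.card_univ, Fintype.card_fin]
    have : (N : ℝ) ≤ 5 := by exact_mod_cast hN5
    exact mul_le_mul_of_nonneg_right this (Finset.sum_nonneg fun j _ => sq_nonneg _)
  have h5 : gradDefect v m * (∑ j, ‖W m j‖) ≤ 1 * ∑ j, ‖W m j‖ :=
    mul_le_mul_of_nonneg_right hm3.le hT0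
  have h6 : lam * (-(500 * (area e + C)) - 1)
      ≤ lam * ∑ j, ∑ k, K N j k * ∫ x in cell e, W12.toFun (W m k) x * force u₀ v j x :=
    mul_le_mul_of_nonneg_left (by linarith) hlam.le
  generalize (∑ j, ‖W m j‖) = T at *
  have hα0 : 0 ≤ α := by positivity
  have hβ0 : 0 ≤ β := by have := area_pos e; positivity
  have h7 : T ^ 2 ≤ α * T + β := by
    rw [hα, hβ]
    linarith
  by_contra hcon
  push Not at hcon
  nlinarith

/-- Since ξ ≤ 2ψ, a⁴ = exp 4ξ ≤ exp 8|ψ|. The Moser–Trudinger inequality bounds this for the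
approximations of ψ, and Fatou's lemma for ψ. The fourth power is needed because the force is
quadratic in a and has to be bounded in L². -/
theorem exists_integral_weight_pow_four_le (hN3 : 3 ≤ N) (hN5 : N ≤ 5) {lam : ℝ} (hlam : 0 < lam)
    {n : Fin N → ℕ} (hn : ∃ k, 0 < n k) {p : (i : Fin N) → Fin (n i) → Plane}
    (hu₀ : ∀ i, IsBackground e (p i) (u₀ i)) (B : ℝ) :
    ∃ C, ∀ v : W12N e N, ‖fderiv ℝ (action e lam n u₀) v‖ ≤ B →
      ∀ j, ∫ x in cell e, weight u₀ v j x ^ 4 ≤ C := by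
  have hu : ∀ j, HasExpMoments e (u₀ j) := fun j => (hu₀ j).hasExpMoments
  have hu2 : ∀ j, MemLp (u₀ j) 2 (cellMeasure e) := fun j => (hu₀ j).memLp_two
  choose sol hsol using exists_isCompl hN3 hN5
  obtain ⟨R, hR⟩ := exists_norm_compl_le hN3 hN5 hlam hn hu₀ hsol B
  obtain ⟨C, hC⟩ := exists_exp_integral_le e (q := 8) (by norm_num) R
  refine ⟨C, fun v hv j => ?_⟩
  obtain ⟨W, hW, hWR⟩ := hR v hv
  obtain ⟨m₀, hm₀⟩ := eventually_atTop.mp hWR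
  have hψL := memLp_compl hN3 hN5 hsol (memLp_logWeight hu2 v) j
  obtain ⟨σ, -, hσ⟩ := exists_subseq_ae_of_L2 hψL
    (fun m => W12.memLp_toFun (W (m + m₀) j)) ((tendsto_add_atTop_iff_nat m₀).mpr (hW j))
  have hb := fun m => hC (W (σ m + m₀) j) (hm₀ _ (Nat.le_add_left _ _) j)
  obtain ⟨hi, hle⟩ := integrable_of_ae_tendsto_of_integral_le
    (f := fun x => Real.exp (8 * |sol (fun l => logWeight u₀ v l x) j|)) (fun m => (hb m).1)
    (fun m x => (Real.exp_pos _).le) (fun m => (hb m).2) (by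
      filter_upwards [hσ] with x hx
      exact (Real.continuous_exp.tendsto _).comp ((hx.abs).const_mul 8))
  refine le_trans (integral_mono_of_nonneg (ae_of_all _ fun x => by positivity) hi
    (ae_of_all _ fun x => ?_)) hle
  simp only
  rw [← exp_logWeight hN3 hN5, ← Real.exp_nat_mul]
  refine Real.exp_le_exp.mpr ?_
  have h1 := (hsol fun l => logWeight u₀ v l x).le_two_mul j
  have h2 := le_abs_self (sol (fun l => logWeight u₀ v l x) j)
  push_cast
  linarith

end

section

/-! ### Boundedness of Palais–Smale sequences -/

variable {e : Module.Basis (Fin 2) ℝ Plane} {N : ℕ} {u₀ : Fin N → Plane → ℝ}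

theorem force_sq_le (hN5 : N ≤ 5) (v : W12N e N) (j : Fin N) (x : Plane) :
    force u₀ v j x ^ 2 ≤ 205 * ∑ k, weight u₀ v k x ^ 4 + 1 := by
  have h4 : (N : ℝ) ≤ 5 := by exact_mod_cast hN5
  have h1 := sq_K_mulVec_le (fun k => weight u₀ v k x) j
  have h2 : weight u₀ v j x ^ 2 ≤ ∑ k, weight u₀ v k x ^ 2 :=
    Finset.single_le_sum (f := fun k => weight u₀ v k x ^ 2) (fun k _ => sq_nonneg _)
      (Finset.mem_univ j)
  have h3 : (∑ k, weight u₀ v k x ^ 2) ^ 2 ≤ 5 * ∑ k, weight u₀ v k x ^ 4 := by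
    refine sq_sum_le_card_mul_sum_sq.trans ?_
    rw [Finset.card_univ, Fintype.card_fin]
    simp only [← pow_mul, Nat.reduceMul]
    exact mul_le_mul_of_nonneg_right h4 (Finset.sum_nonneg fun j _ => by positivity)
  rw [force, mul_pow]
  generalize (K N *ᵥ fun k => weight u₀ v k x) j = s at *
  have hS : 0 ≤ ∑ k, weight u₀ v k x ^ 2 := Finset.sum_nonneg fun k _ => sq_nonneg _
  generalize ∑ k, weight u₀ v k x ^ 2 = S at *
  have h5 : s ^ 2 ≤ 20 * S := by nlinarith
  have h6 : (s - 1) ^ 2 ≤ 40 * S + 2 := by nlinarith [sq_nonneg (s + 1)]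
  have h7 : weight u₀ v j x ^ 2 * (s - 1) ^ 2 ≤ S * (40 * S + 2) :=
    mul_le_mul h2 h6 (sq_nonneg _) hS
  -- Here 2S ≤ S² + 1 and S² ≤ 5 ∑ a_k⁴, whence 205 = 41 · 5.
  nlinarith [sq_nonneg (S - 1)]

theorem exists_integral_force_sq_le (hN3 : 3 ≤ N) (hN5 : N ≤ 5) {lam : ℝ} (hlam : 0 < lam)
    {n : Fin N → ℕ} (hn : ∃ k, 0 < n k) {p : (i : Fin N) → Fin (n i) → Plane}
    (hu₀ : ∀ i, IsBackground e (p i) (u₀ i)) (B : ℝ) :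
    ∃ C, 0 ≤ C ∧ ∀ v : W12N e N, ‖fderiv ℝ (action e lam n u₀) v‖ ≤ B →
      ∀ j, Real.sqrt (∫ x in cell e, force u₀ v j x ^ 2) ≤ C := by
  obtain ⟨C, hC⟩ := exists_integral_weight_pow_four_le hN3 hN5 hlam hn hu₀ B
  refine ⟨Real.sqrt (205 * (∑ _k : Fin N, C) + area e), Real.sqrt_nonneg _, fun v hv j =>
    Real.sqrt_le_sqrt ?_⟩
  have hu : ∀ j, HasExpMoments e (u₀ j) := fun j => (hu₀ j).hasExpMoments
  have i1 : ∀ k ∈ Finset.univ, Integrable (fun x => weight u₀ v k x ^ 4) (cellMeasure e) :=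
    fun k _ => (memLp_weight_mul hu v k k).integrable_sq.congr (ae_of_all _ fun x => by
      simp only; ring)
  calc ∫ x in cell e, force u₀ v j x ^ 2
      ≤ ∫ x in cell e, (205 * ∑ k, weight u₀ v k x ^ 4 + 1) :=
        integral_mono (memLp_force hu v j).integrable_sq
          (((integrable_finsetSum _ i1).const_mul 205).add (integrable_const 1))
          fun x => force_sq_le hN5 v j x
    _ = 205 * (∑ k, ∫ x in cell e, weight u₀ v k x ^ 4) + area e := by
        refine (integral_add ((integrable_finsetSum _ i1).const_mul 205)
          (integrable_const 1)).trans ?_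
        rw [integral_const_mul, integral_finsetSum _ i1]
        simp [area]
    _ ≤ _ := by
        have := Finset.sum_le_sum fun k (_ : k ∈ Finset.univ) => hC v hv k
        linarith

theorem dirichlet_eq_norm_gradL (f : W12 e) : dirichlet f = ∑ i, ‖W12.gradL e i f‖ ^ 2 := by
  refine Finset.sum_congr rfl fun i _ => ?_
  rw [← real_inner_self_eq_norm_sq, inner_gradL]
  simp only [sq]

theorem sum_A_mul_inner_ge (hN3 : 3 ≤ N) (hN5 : N ≤ 5) (v : W12N e N) :
    1 / 1500 * ∑ j, dirichlet (v j)
      ≤ ∑ i, ∑ j, ∑ k, A N j k * ⟪W12.gradL e i (v j), W12.gradL e i (v k)⟫_ℝ := by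
  have h1 : ∑ j, dirichlet (v j) = ∑ i, ∑ j, ∫ x in cell e, W12.grad (v j) i x ^ 2 := by
    rw [Finset.sum_comm]; rfl
  rw [h1, Finset.mul_sum]
  refine Finset.sum_le_sum fun i _ => ?_
  have i1 : ∀ j k, Integrable (fun x => W12.grad (v j) i x * W12.grad (v k) i x) (cellMeasure e) :=
    fun j k => (W12.memLp_grad (v j) i).integrable_mul (W12.memLp_grad (v k) i)
  have i2 : ∀ j ∈ Finset.univ, Integrable (fun x => W12.grad (v j) i x ^ 2) (cellMeasure e) :=
    fun j _ => (W12.memLp_grad (v j) i).integrable_sq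
  simp only [inner_gradL]
  rw [← integral_dot_mulVec (F := fun j x => W12.grad (v j) i x)
    (G := fun j x => W12.grad (v j) i x) (A N) i1, ← integral_finsetSum _ i2, ← integral_const_mul]
  refine integral_mono ((integrable_finsetSum _ i2).const_mul _) ?_ fun x =>
    A_coercive hN3 hN5 fun j => W12.grad (v j) i x
  simp only [dotProduct, mulVec, Finset.mul_sum]
  refine integrable_finsetSum _ fun j _ => integrable_finsetSum _ fun k _ => ?_
  exact ((i1 j k).const_mul (A N j k)).congr (ae_of_all _ fun x => by simp only; ring)

theorem sum_A_mul_inner_le (v : W12N e N) :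
    ∑ i, ∑ j, ∑ k, A N j k * ⟪W12.gradL e i (v j), W12.gradL e i (v k)⟫_ℝ
      ≤ 2 * (∑ j, ∑ k, |A N j k|) * ∑ j, dirichlet (v j) := by
  have h1 : ∀ i j, ‖W12.gradL e i (v j)‖ ^ 2 ≤ ∑ j, dirichlet (v j) := fun i j => by
    refine le_trans ?_ (Finset.single_le_sum (f := fun j => dirichlet (v j))
      (fun k _ => dirichlet_nonneg _) (Finset.mem_univ j))
    rw [dirichlet_eq_norm_gradL]
    exact Finset.single_le_sum (f := fun i => ‖W12.gradL e i (v j)‖ ^ 2)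
      (fun k _ => sq_nonneg _) (Finset.mem_univ i)
  have h2 : ∀ i : Fin 2, ∑ j, ∑ k, A N j k * ⟪W12.gradL e i (v j), W12.gradL e i (v k)⟫_ℝ
      ≤ (∑ j, ∑ k, |A N j k|) * ∑ j, dirichlet (v j) := fun i => by
    rw [Finset.sum_mul]
    refine Finset.sum_le_sum fun j _ => ?_
    rw [Finset.sum_mul]
    refine Finset.sum_le_sum fun k _ => (le_abs_self _).trans ?_
    rw [abs_mul]
    refine mul_le_mul_of_nonneg_left ((abs_real_inner_le_norm _ _).trans ?_) (abs_nonneg _)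
    nlinarith [h1 i j, h1 i k, sq_nonneg (‖W12.gradL e i (v j)‖ - ‖W12.gradL e i (v k)‖)]
  rw [Fin.sum_univ_two]
  linarith [h2 0, h2 1]

theorem sqrt_integral_sq_le_norm (f : W12 e) :
    Real.sqrt (∫ x in cell e, W12.toFun f x ^ 2) ≤ ‖f‖ := by
  rw [Real.sqrt_le_left (norm_nonneg f)]
  exact W12.integral_sq_le f

theorem norm_apply_le (w : W12N e N) (j : Fin N) : ‖w j‖ ≤ ‖w‖ :=
  PiLp.norm_apply_le w j

/-- The mean value of a function over the period cell. -/
def mean (f : W12 e) : ℝ := (∫ x in cell e, W12.toFun f x) / area e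

theorem integralL_sub_mean (f : W12 e) :
    integralL (memLp_const (1 : ℝ)) (f - mean f • W12.one e) = 0 := by
  have h : ∫ _ in cell e, (1 : ℝ) = area e := by simp [area]
  rw [map_sub, map_smul, integralL_one, h, integralL_apply, mean, smul_eq_mul]
  simp only [mul_one]
  rw [div_mul_cancel₀ _ (area_pos e).ne', sub_self]

theorem gradL_sub_mean (f : W12 e) (i : Fin 2) :
    W12.gradL e i (f - mean f • W12.one e) = W12.gradL e i f := by
  rw [map_sub, map_smul, W12.gradL_one, smul_zero, sub_zero]

/-- The mean-free part of a tuple. -/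
def meanFree (v : W12N e N) : W12N e N := WithLp.toLp 2 fun j => v j - mean (v j) • W12.one e

/-- In the direction of the mean-free part the b term vanishes and the gradients are those of v. The
L² bound on the force makes the remaining terms linear in the norm, against the quadratic lower
bound from A and Poincaré's inequality. -/
theorem exists_norm_meanFree_le (hN3 : 3 ≤ N) (hN5 : N ≤ 5) {lam : ℝ} (hlam : 0 < lam)
    {n : Fin N → ℕ} (hn : ∃ k, 0 < n k) {p : (i : Fin N) → Fin (n i) → Plane}
    (hu₀ : ∀ i, IsBackground e (p i) (u₀ i)) (B : ℝ) :
    ∃ R, ∀ v : W12N e N, ‖fderiv ℝ (action e lam n u₀) v‖ ≤ B → ‖meanFree v‖ ≤ R := by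
  have hu : ∀ j, HasExpMoments e (u₀ j) := fun j => (hu₀ j).hasExpMoments
  obtain ⟨Cf, hCf0, hCf⟩ := exists_integral_force_sq_le hN3 hN5 hlam hn hu₀ B
  obtain ⟨Cp, hCp0, hCp⟩ := exists_poincare e
  refine ⟨(1 + Cp) * (1500 * (B + lam * (5 * Cf))), fun v hv => ?_⟩
  set w := meanFree v with hw
  have hwj : ∀ j, w j = v j - mean (v j) • W12.one e := fun j => rfl
  have hg : ∀ i j, W12.gradL e i (w j) = W12.gradL e i (v j) := fun i j => gradL_sub_mean _ i
  have hz : ∀ j, integralL (memLp_const (1 : ℝ)) (w j) = 0 := fun j => integralL_sub_mean _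
  have hdir : ∀ j, dirichlet (w j) = dirichlet (v j) := fun j => by
    simp only [dirichlet_eq_norm_gradL, hg]
  have h1 := (le_abs_self _).trans ((abs_dAction_le hN3 hN5 hu lam n v w).trans
    (mul_le_mul_of_nonneg_right hv (norm_nonneg w)))
  rw [dAction_eq_inner hu] at h1
  simp only [hg, hz, mul_zero, Finset.sum_const_zero, add_zero] at h1
  have h2 := sum_A_mul_inner_ge hN3 hN5 v
  have h3 : ∑ _j : Fin N, -(‖w‖ * Cf) ≤ ∑ j, integralL (memLp_force hu v j) (w j) := by
    refine Finset.sum_le_sum fun j _ => ?_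
    rw [integralL_apply]
    refine neg_le_of_abs_le ((abs_integral_mul_le (W12.memLp_toFun (w j))
      (memLp_force hu v j)).trans ?_)
    exact mul_le_mul ((sqrt_integral_sq_le_norm _).trans (norm_apply_le w j)) (hCf v hv j)
      (Real.sqrt_nonneg _) (norm_nonneg _)
  have h4 : -(5 * (‖w‖ * Cf)) ≤ ∑ j, integralL (memLp_force hu v j) (w j) := by
    refine le_trans ?_ h3
    have : (N : ℝ) ≤ 5 := by exact_mod_cast hN5
    rw [Finset.sum_const, Finset.card_univ, Fintype.card_fin, nsmul_eq_mul]
    have h5 : 0 ≤ ‖w‖ * Cf := by positivity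
    nlinarith
  have h5 : ‖w‖ ^ 2 ≤ (1 + Cp) * ∑ j, dirichlet (v j) := by
    rw [norm_W12N_sq, Finset.mul_sum]
    refine Finset.sum_le_sum fun j _ => ?_
    rw [W12.norm_sq, ← hdir]
    have := hCp (w j) (by simpa only [integralL_apply, mul_one] using hz j)
    linarith
  have h6 := mul_le_mul_of_nonneg_left h4 hlam.le
  have h7 : ∑ j, dirichlet (v j) ≤ 1500 * (B + lam * (5 * Cf)) * ‖w‖ := by nlinarith
  have h8 : ‖w‖ * ‖w‖ ≤ (1 + Cp) * (1500 * (B + lam * (5 * Cf))) * ‖w‖ := by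
    have := mul_le_mul_of_nonneg_left h7 (by positivity : 0 ≤ 1 + Cp)
    nlinarith
  rcases (norm_nonneg w).eq_or_lt with h0 | h0
  · rw [← h0]
    have := (norm_nonneg _).trans hv
    positivity
  · exact le_of_mul_le_mul_right h8 h0

end

/-! ### Bounds on the means and comparison of differentials -/

section

variable {e : Module.Basis (Fin 2) ℝ Plane} {N : ℕ} {u₀ : Fin N → Plane → ℝ}

theorem dot_M_mulVec_eq (y : Fin N → ℝ) :
    y ⬝ᵥ M N *ᵥ y = (fun j => r N j * y j) ⬝ᵥ K N *ᵥ (fun j => r N j * y j) := by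
  simp only [dotProduct, mulVec, M, mul_diagonal, diagonal_mul, Finset.mul_sum]
  exact Finset.sum_congr rfl fun j _ => Finset.sum_congr rfl fun k _ => by ring

theorem dot_K_mulVec_le (hN5 : N ≤ 5) (z : Fin N → ℝ) : z ⬝ᵥ K N *ᵥ z ≤ 10 * ∑ j, z j ^ 2 := by
  have hN : (N : ℝ) ≤ 5 := by exact_mod_cast hN5
  have h1 : z ⬝ᵥ K N *ᵥ z ≤ ∑ j, ∑ k, (z j ^ 2 + z k ^ 2) := by
    simp only [dotProduct, mulVec, Finset.mul_sum]
    refine Finset.sum_le_sum fun j _ => Finset.sum_le_sum fun k _ => (le_abs_self _).trans ?_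
    rw [abs_mul, abs_mul, ← sq_abs (z j), ← sq_abs (z k)]
    have h2 : |K N j k| * |z k| ≤ 2 * |z k| :=
      mul_le_mul_of_nonneg_right (abs_K_le j k) (abs_nonneg _)
    have h3 := mul_le_mul_of_nonneg_left h2 (abs_nonneg (z j))
    nlinarith [sq_nonneg (|z j| - |z k|)]
  have h2 : ∑ j, ∑ k, (z j ^ 2 + z k ^ 2) = 2 * N * ∑ j, z j ^ 2 := by
    simp only [Finset.sum_add_distrib, Finset.sum_const, Finset.card_univ, Fintype.card_fin,
      nsmul_eq_mul, ← Finset.mul_sum]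
    ring
  have h3 : 0 ≤ ∑ j, z j ^ 2 := Finset.sum_nonneg fun j _ => sq_nonneg _
  nlinarith

theorem integral_dot_M_mulVec_le (hN3 : 3 ≤ N) (hN5 : N ≤ 5) (hu : ∀ j, HasExpMoments e (u₀ j))
    (v : W12N e N) :
    ∫ x in cell e, (fun j => Real.exp (u₀ j x + W12.toFun (v j) x) - 1) ⬝ᵥ
        M N *ᵥ (fun j => Real.exp (u₀ j x + W12.toFun (v j) x) - 1)
      ≤ 20 * ((∑ j, ∫ x in cell e, weight u₀ v j x ^ 2) + area e * ∑ j, r N j ^ 2) := by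
  have i1 : ∀ j ∈ Finset.univ, Integrable (fun x => weight u₀ v j x ^ 2) (cellMeasure e) :=
    fun j _ => (memLp_weight hu v j).integrable_sq
  have e1 : 20 * ((∑ j, ∫ x in cell e, weight u₀ v j x ^ 2) + area e * ∑ j, r N j ^ 2)
      = ∫ x in cell e, 20 * (∑ j, weight u₀ v j x ^ 2 + ∑ j, r N j ^ 2) := by
    rw [integral_const_mul]
    congr 1
    refine Eq.trans ?_ (integral_add (integrable_finsetSum _ i1) (integrable_const _)).symm
    rw [integral_finsetSum _ i1]
    simp [area]
  rw [e1]
  refine integral_mono_of_nonneg (ae_of_all _ fun x => ?_)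
    (((integrable_finsetSum _ i1).add (integrable_const _)).const_mul 20)
    (ae_of_all _ fun x => ?_)
  · simp only [Pi.zero_apply]
    rw [dot_M_mulVec_eq]
    refine le_trans ?_ (K_coercive hN3 hN5 _)
    exact mul_nonneg (by norm_num) (Finset.sum_nonneg fun j _ => sq_nonneg _)
  · simp only
    rw [dot_M_mulVec_eq]
    refine (dot_K_mulVec_le hN5 _).trans ?_
    rw [← Finset.sum_add_distrib, Finset.mul_sum, Finset.mul_sum]
    refine Finset.sum_le_sum fun j _ => ?_
    have h1 : r N j * (Real.exp (u₀ j x + W12.toFun (v j) x) - 1) = weight u₀ v j x - r N j := by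
      rw [weight, density]; ring
    rw [h1]
    nlinarith [sq_nonneg (weight u₀ v j x + r N j)]

/-- Since u⁰ has mean zero, the integral of v equals that of u⁰ + v, and s ≤ exp s bounds it by that
of the weight. -/
theorem integral_toFun_le (hN3 : 3 ≤ N) (hN5 : N ≤ 5) {n : Fin N → ℕ}
    {p : (i : Fin N) → Fin (n i) → Plane} (hu₀ : ∀ i, IsBackground e (p i) (u₀ i))
    (v : W12N e N) (j : Fin N) :
    ∫ x in cell e, W12.toFun (v j) x
      ≤ (r N j)⁻¹ * (area e + ∫ x in cell e, weight u₀ v j x ^ 2) := by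
  have hu : ∀ j, HasExpMoments e (u₀ j) := fun j => (hu₀ j).hasExpMoments
  have i1 := MemLp.integrableOn_cell (W12.memLp_toFun (v j))
  have i2 := (hu₀ j).integrable
  have i3 := (memLp_weight hu v j).integrable_sq
  have e1 : (∫ x in cell e, W12.toFun (v j) x)
      = ∫ x in cell e, W12.toFun (v j) x + u₀ j x := by
    rw [integral_add i1 i2, (hu₀ j).mean_zero, add_zero]
  have e2 : (r N j)⁻¹ * (area e + ∫ x in cell e, weight u₀ v j x ^ 2)
      = ∫ x in cell e, (r N j)⁻¹ * (1 + weight u₀ v j x ^ 2) := by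
    rw [integral_const_mul]
    congr 1
    refine Eq.trans ?_ (integral_add (integrable_const 1) i3).symm
    simp [area]
  rw [e1, e2]
  refine integral_mono (i1.add i2) (((integrable_const 1).add i3).const_mul _) fun x => ?_
  have h1 := Real.add_one_le_exp (u₀ j x + W12.toFun (v j) x)
  have h2 : Real.exp (u₀ j x + W12.toFun (v j) x) = (r N j)⁻¹ * weight u₀ v j x := by
    rw [weight, density, inv_mul_cancel_left₀ (r_pos hN3 hN5 j).ne']
  have h3 : (r N j)⁻¹ * weight u₀ v j x ≤ (r N j)⁻¹ * (1 + weight u₀ v j x ^ 2) :=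
    mul_le_mul_of_nonneg_left (by nlinarith [sq_nonneg (weight u₀ v j x - 1)])
      (inv_nonneg.mpr (r_pos hN3 hN5 j).le)
  simp only
  linarith

/-- A family of almost critical points on which the action is bounded below is bounded. -/
theorem exists_norm_le (hN3 : 3 ≤ N) (hN5 : N ≤ 5) {lam : ℝ} (hlam : 0 < lam)
    {n : Fin N → ℕ} (hn : ∃ k, 0 < n k) {p : (i : Fin N) → Fin (n i) → Plane}
    (hu₀ : ∀ i, IsBackground e (p i) (u₀ i)) (B B' : ℝ) :
    ∃ R, ∀ v : W12N e N, ‖fderiv ℝ (action e lam n u₀) v‖ ≤ B → -B' ≤ action e lam n u₀ v →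
      ∀ j, ‖v j‖ ≤ R := by
  have hu : ∀ j, HasExpMoments e (u₀ j) := fun j => (hu₀ j).hasExpMoments
  have ha := area_pos e
  obtain ⟨R₁, hR₁⟩ := exists_norm_meanFree_le hN3 hN5 hlam hn hu₀ B
  obtain ⟨Cw, hCw0, hCw⟩ := exists_integral_weight_sq_le hN3 hN5 hlam hn hu B
  set Cμ := ∑ j, (r N j)⁻¹ * (area e + Cw) with hCμ
  set S := area e * (B' + 1 / 2 * (2 * (∑ j, ∑ k, |A N j k|) * R₁ ^ 2)
    + lam / 2 * (20 * (Cw + area e * ∑ j, r N j ^ 2))) + ∑ j, bvec n j * Cμ with hS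
  have hr : ∀ j, 0 ≤ (r N j)⁻¹ * (area e + Cw) := fun j =>
    mul_nonneg (inv_nonneg.mpr (r_pos hN3 hN5 j).le) (by positivity)
  have hCμ0 : 0 ≤ Cμ := Finset.sum_nonneg fun j _ => hr j
  refine ⟨R₁ + (Cμ + ∑ j, |S| / bvec n j) / area e * ‖W12.one e‖, fun v hv hv' j => ?_⟩
  have hbp := bvec_pos hN3 hN5 hn
  have hw := hR₁ v hv
  have hdir : ∑ j, dirichlet (v j) ≤ R₁ ^ 2 := by
    refine le_trans ?_ (pow_le_pow_left₀ (norm_nonneg _) hw 2)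
    rw [norm_W12N_sq]
    refine Finset.sum_le_sum fun j _ => le_trans (le_of_eq ?_) (W12.dirichlet_le _)
    simp only [dirichlet_eq_norm_gradL]
    exact Finset.sum_congr rfl fun i _ => by rw [← gradL_sub_mean (v j) i]; rfl
  have hup : ∀ j, ∫ x in cell e, W12.toFun (v j) x ≤ Cμ := fun j => by
    refine (integral_toFun_le hN3 hN5 hu₀ v j).trans (le_trans ?_ (Finset.single_le_sum
      (f := fun j => (r N j)⁻¹ * (area e + Cw)) (fun k _ => hr k) (Finset.mem_univ j)))
    have h1 : ∫ x in cell e, weight u₀ v j x ^ 2 ≤ Cw := (Finset.single_le_sum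
      (f := fun j => ∫ x in cell e, weight u₀ v j x ^ 2)
      (fun k _ => integral_nonneg fun x => sq_nonneg _) (Finset.mem_univ j)).trans (hCw v hv)
    exact mul_le_mul_of_nonneg_left (by linarith) (inv_nonneg.mpr (r_pos hN3 hN5 j).le)
  have hquad : ∑ i : Fin 2, ∫ x in cell e,
      (fun j => W12.grad (v j) i x) ⬝ᵥ A N *ᵥ (fun j => W12.grad (v j) i x)
      ≤ 2 * (∑ j, ∑ k, |A N j k|) * R₁ ^ 2 := by
    refine le_trans (le_of_eq ?_) ((sum_A_mul_inner_le v).trans (mul_le_mul_of_nonneg_left hdir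
      (mul_nonneg (by norm_num) (Finset.sum_nonneg fun j _ => Finset.sum_nonneg fun k _ =>
        abs_nonneg _))))
    simp only [inner_gradL]
    exact Finset.sum_congr rfl fun i _ => integral_dot_mulVec
      (F := fun j x => W12.grad (v j) i x) (G := fun j x => W12.grad (v j) i x) _ fun j k =>
        (W12.memLp_grad (v j) i).integrable_mul (W12.memLp_grad (v k) i)
  have hM := (integral_dot_M_mulVec_le hN3 hN5 hu v).trans (mul_le_mul_of_nonneg_left
    (add_le_add_left (hCw v hv) (area e * ∑ j, r N j ^ 2)) (by norm_num : (0 : ℝ) ≤ 20))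
  have hlin : ∫ x in cell e, bvec n ⬝ᵥ (fun j => W12.toFun (v j) x)
      = ∑ j, bvec n j * ∫ x in cell e, W12.toFun (v j) x :=
    integral_dot (F := fun j x => W12.toFun (v j) x) _ fun j =>
      MemLp.integrableOn_cell (W12.memLp_toFun (v j))
  -- The lower bound on the action, with all other terms bounded above, becomes an upper bound for
  -- this sum. Its summands are nonnegative by `hup`, so each one is bounded, and b_k > 0 gives a
  -- lower bound on each mean.
  have hsum : ∑ k, bvec n k * (Cμ - ∫ x in cell e, W12.toFun (v k) x) ≤ S := by
    rw [action, hlin] at hv'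
    simp only [mul_sub, Finset.sum_sub_distrib]
    have h1 := mul_le_mul_of_nonneg_left hM (by positivity : 0 ≤ lam / 2)
    have h2 : 1 / area e * (-∑ j, bvec n j * ∫ x in cell e, W12.toFun (v j) x)
        ≤ B' + 1 / 2 * (2 * (∑ j, ∑ k, |A N j k|) * R₁ ^ 2)
          + lam / 2 * (20 * (Cw + area e * ∑ j, r N j ^ 2)) := by linarith
    rw [one_div, inv_mul_le_iff₀ ha] at h2
    rw [hS]
    linarith
  have hlow : Cμ - (∫ x in cell e, W12.toFun (v j) x) ≤ |S| / bvec n j := by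
    rw [le_div_iff₀ (hbp j), mul_comm]
    refine le_trans ?_ (hsum.trans (le_abs_self S))
    exact Finset.single_le_sum
      (f := fun k => bvec n k * (Cμ - ∫ x in cell e, W12.toFun (v k) x))
      (fun k _ => mul_nonneg (hbp k).le (by linarith [hup k])) (Finset.mem_univ j)
  have hsS : |S| / bvec n j ≤ ∑ j, |S| / bvec n j :=
    Finset.single_le_sum (f := fun j => |S| / bvec n j)
      (fun k _ => div_nonneg (abs_nonneg _) (hbp k).le) (Finset.mem_univ j)
  have hS0 : 0 ≤ |S| / bvec n j := div_nonneg (abs_nonneg _) (hbp j).le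
  have hmean : |mean (v j)| ≤ (Cμ + ∑ j, |S| / bvec n j) / area e := by
    rw [mean, abs_div, abs_of_pos ha]
    refine div_le_div_of_nonneg_right (abs_le.mpr ⟨?_, ?_⟩) ha.le
    · linarith
    · linarith [hup j]
  have hvj : v j = meanFree v j + mean (v j) • W12.one e := by
    change v j = (v j - mean (v j) • W12.one e) + mean (v j) • W12.one e
    rw [sub_add_cancel]
  rw [hvj]
  refine (norm_add_le _ _).trans (add_le_add ((norm_apply_le _ j).trans hw) ?_)
  rw [norm_smul, Real.norm_eq_abs]
  exact mul_le_mul_of_nonneg_right hmean (norm_nonneg _)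

/-- The b terms cancel in the difference and A is coercive. The forces need only be bounded in L²,
since they are paired with v - v', which will be small in L². -/
theorem dAction_sub_ge (hN3 : 3 ≤ N) (hN5 : N ≤ 5) {lam : ℝ} (hlam : 0 < lam) (n : Fin N → ℕ)
    (hu : ∀ j, HasExpMoments e (u₀ j)) {C : ℝ} {v v' : W12N e N}
    (hv : ∀ j, Real.sqrt (∫ x in cell e, force u₀ v j x ^ 2) ≤ C)
    (hv' : ∀ j, Real.sqrt (∫ x in cell e, force u₀ v' j x ^ 2) ≤ C) :
    1 / 1500 * (∑ j, dirichlet (v j - v' j))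
        - lam * (2 * C * ∑ j, Real.sqrt (∫ x in cell e, W12.toFun (v j - v' j) x ^ 2))
      ≤ dAction lam n u₀ v (v - v') - dAction lam n u₀ v' (v - v') := by
  have h1 : ∀ (g : W12N e N), (∀ j, Real.sqrt (∫ x in cell e, force u₀ g j x ^ 2) ≤ C) → ∀ j,
      |integralL (memLp_force hu g j) (v j - v' j)|
        ≤ C * Real.sqrt (∫ x in cell e, W12.toFun (v j - v' j) x ^ 2) := fun g hg j => by
    rw [integralL_apply, mul_comm C]
    exact (abs_integral_mul_le (W12.memLp_toFun _) (memLp_force hu g j)).trans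
      (mul_le_mul_of_nonneg_left (hg j) (Real.sqrt_nonneg _))
  have h2 : -(2 * C * ∑ j, Real.sqrt (∫ x in cell e, W12.toFun (v j - v' j) x ^ 2))
      ≤ (∑ j, integralL (memLp_force hu v j) (v j - v' j))
        - ∑ j, integralL (memLp_force hu v' j) (v j - v' j) := by
    rw [← Finset.sum_sub_distrib, Finset.mul_sum, ← Finset.sum_neg_distrib]
    refine Finset.sum_le_sum fun j _ => ?_
    have h3 := neg_le_of_abs_le (h1 v hv j)
    have h4 := le_of_abs_le (h1 v' hv' j)
    linarith
  have h3 := sum_A_mul_inner_ge hN3 hN5 (v - v')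
  have h4 : ∑ i, ∑ j, ∑ k, A N j k *
        ⟪W12.gradL e i ((v - v') j), W12.gradL e i ((v - v') k)⟫_ℝ
      = (∑ i, ∑ j, ∑ k, A N j k * ⟪W12.gradL e i (v j), W12.gradL e i ((v - v') k)⟫_ℝ)
        - ∑ i, ∑ j, ∑ k, A N j k * ⟪W12.gradL e i (v' j), W12.gradL e i ((v - v') k)⟫_ℝ := by
    simp only [← Finset.sum_sub_distrib, ← mul_sub, ← inner_sub_left, ← map_sub]
    rfl
  have h5 := mul_le_mul_of_nonneg_left h2 hlam.le
  rw [dAction_eq_inner hu, dAction_eq_inner hu]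
  rw [h4] at h3
  change 1 / 1500 * (∑ j, dirichlet (v j - v' j)) ≤ _ at h3
  change _ ≤ _ + lam * (∑ j, integralL (memLp_force hu v j) (v j - v' j)) + _ -
    (_ + lam * (∑ j, integralL (memLp_force hu v' j) (v j - v' j)) + _)
  linarith

end

section

/-! ### The Palais–Smale condition -/

variable {e : Module.Basis (Fin 2) ℝ Plane} {N : ℕ} {u₀ : Fin N → Plane → ℝ}

/-- Small differentials control the energy of the difference once its L² norm is small; the
right-hand side tends to 0 with η for fixed C, R and λ. -/
theorem norm_sub_sq_le (hN3 : 3 ≤ N) (hN5 : N ≤ 5) {lam : ℝ} (hlam : 0 < lam) (n : Fin N → ℕ)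
    (hu : ∀ j, HasExpMoments e (u₀ j)) {C R η : ℝ} (hC : 0 ≤ C) {v v' : W12N e N}
    (hv : ∀ j, Real.sqrt (∫ x in cell e, force u₀ v j x ^ 2) ≤ C)
    (hv' : ∀ j, Real.sqrt (∫ x in cell e, force u₀ v' j x ^ 2) ≤ C)
    (hR : ∀ j, ‖v j‖ ≤ R) (hR' : ∀ j, ‖v' j‖ ≤ R)
    (hd : ‖fderiv ℝ (action e lam n u₀) v‖ ≤ η) (hd' : ‖fderiv ℝ (action e lam n u₀) v'‖ ≤ η)
    (hL : ∀ j, ∫ x in cell e, W12.toFun (v j - v' j) x ^ 2 ≤ η) :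
    ‖v - v'‖ ^ 2 ≤ 5 * η + 1500 * (2 * η * (10 * R) + lam * (2 * C * (5 * Real.sqrt η))) := by
  have hN : (N : ℝ) ≤ 5 := by exact_mod_cast hN5
  have hη : 0 ≤ η := (norm_nonneg _).trans hd
  have hcard : ∀ (f : Fin N → ℝ) (c : ℝ), 0 ≤ c → (∀ j, f j ≤ c) → ∑ j, f j ≤ 5 * c := by
    intro f c hc hf
    refine (Finset.sum_le_sum fun j _ => hf j).trans ?_
    rw [Finset.sum_const, Finset.card_univ, Fintype.card_fin, nsmul_eq_mul]
    exact mul_le_mul_of_nonneg_right hN hc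
  have hR0 : 0 ≤ R := (norm_nonneg _).trans (hR ⟨0, by omega⟩)
  have h1 : ‖v - v'‖ ≤ 10 * R := by
    refine (norm_W12N_le_sum _).trans ((hcard _ (2 * R) (by positivity) fun j => ?_).trans_eq
      (by ring))
    exact (norm_sub_le (v j) (v' j)).trans (by linarith [hR j, hR' j])
  have h2 := dAction_sub_ge hN3 hN5 hlam n hu hv hv'
  have h3 := (le_abs_self _).trans ((abs_dAction_le hN3 hN5 hu lam n v (v - v')).trans
    (mul_le_mul hd h1 (norm_nonneg _) hη))
  have h4 := (neg_le_abs _).trans ((abs_dAction_le hN3 hN5 hu lam n v' (v - v')).trans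
    (mul_le_mul hd' h1 (norm_nonneg _) hη))
  have h5 := hcard _ (Real.sqrt η) (Real.sqrt_nonneg _) fun j => Real.sqrt_le_sqrt (hL j)
  have h6 := hcard _ η hη hL
  have h7 : lam * (2 * C * ∑ j, Real.sqrt (∫ x in cell e, W12.toFun (v j - v' j) x ^ 2))
      ≤ lam * (2 * C * (5 * Real.sqrt η)) := by gcongr
  have h8 : ‖v - v'‖ ^ 2 = (∑ j, ∫ x in cell e, W12.toFun (v j - v' j) x ^ 2)
      + ∑ j, dirichlet (v j - v' j) := by
    rw [norm_W12N_sq, ← Finset.sum_add_distrib]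
    exact Finset.sum_congr rfl fun j _ => W12.norm_sq _
  rw [h8]
  linarith

end

end ChernSimons

end

/-- Convergence makes the actions and the norms of the derivatives bounded, so the a priori bounds
are uniform. Rellich's theorem gives L² compactness, `norm_sub_sq_le` upgrades it to a Cauchy
subsequence in the full norm, and the space is complete. -/
theorem proposition3p2 (e : Module.Basis (Fin 2) ℝ ChernSimons.Plane)
    (N : ℕ) (hN3 : 3 ≤ N) (hN5 : N ≤ 5)
    (lam : ℝ) (hlam : 0 < lam)
    (n : Fin N → ℕ) (hn : ∃ k, 0 < n k)
    (p : (i : Fin N) → Fin (n i) → ChernSimons.Plane)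
    (u₀ : Fin N → ChernSimons.Plane → ℝ)
    (hu₀ : ∀ i, ChernSimons.IsBackground e (p i) (u₀ i))
    (v : ℕ → ChernSimons.W12N e N) (a₀ : ℝ)
    (hI : Tendsto (fun m => ChernSimons.action e lam n u₀ (v m)) atTop (𝓝 a₀))
    (hI' : Tendsto (fun m => ‖fderiv ℝ (ChernSimons.action e lam n u₀) (v m)‖) atTop (𝓝 0)) :
    ∃ (w : ChernSimons.W12N e N) (σ : ℕ → ℕ),
      StrictMono σ ∧ Tendsto (v ∘ σ) atTop (𝓝 w) := by
  have hu : ∀ j, ChernSimons.HasExpMoments e (u₀ j) := fun j => (hu₀ j).hasExpMoments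
  obtain ⟨B, hB⟩ := hI'.bddAbove_range
  obtain ⟨B', hB'⟩ := hI.bddBelow_range
  have hB : ∀ m, ‖fderiv ℝ (ChernSimons.action e lam n u₀) (v m)‖ ≤ B := fun m => hB ⟨m, rfl⟩
  -- `exists_norm_le` takes its lower bound in the form -B', hence the sign.
  obtain ⟨R, hR⟩ := ChernSimons.exists_norm_le hN3 hN5 hlam hn hu₀ B (-B')
  have hR : ∀ m j, ‖v m j‖ ≤ R := fun m =>
    hR (v m) (hB m) (by rw [neg_neg]; exact hB' ⟨m, rfl⟩)
  obtain ⟨C, hC0, hC⟩ := ChernSimons.exists_integral_force_sq_le hN3 hN5 hlam hn hu₀ B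
  obtain ⟨σ, hσ, hcauchy⟩ := ChernSimons.exists_subseq_cauchy_L2 (fun m j => v m j) hR
  have hCS : CauchySeq (v ∘ σ) := by
    rw [Metric.cauchySeq_iff]
    intro ε hε
    -- The bound of `norm_sub_sq_le` is continuous in η and vanishes at 0, so some η > 0 brings it
    -- below ε².
    have hcont : Continuous fun η : ℝ =>
      5 * η + 1500 * (2 * η * (10 * R) + lam * (2 * C * (5 * Real.sqrt η))) := by fun_prop
    have h0 : Tendsto (fun η : ℝ =>
        5 * η + 1500 * (2 * η * (10 * R) + lam * (2 * C * (5 * Real.sqrt η)))) (𝓝[>] 0) (𝓝 0) := by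
      have := (hcont.tendsto 0).mono_left (nhdsWithin_le_nhds (s := Set.Ioi 0))
      simpa using this
    obtain ⟨η, hη, hη0⟩ := ((h0.eventually_lt_const (by positivity : 0 < ε ^ 2)).and
      self_mem_nhdsWithin).exists
    obtain ⟨n₀, hn₀⟩ := hcauchy η hη0
    obtain ⟨n₁, hn₁⟩ := eventually_atTop.mp (hI'.eventually_lt_const hη0)
    refine ⟨max n₀ n₁, fun m hm l hl => ?_⟩
    have hm' := (le_of_max_le_right hm).trans (hσ.id_le m)
    have hl' := (le_of_max_le_right hl).trans (hσ.id_le l)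
    have key := ChernSimons.norm_sub_sq_le hN3 hN5 hlam n hu hC0 (hC _ (hB (σ m)))
      (hC _ (hB (σ l))) (hR (σ m)) (hR (σ l)) (hn₁ _ hm').le (hn₁ _ hl').le
      fun j => (hn₀ m (le_of_max_le_left hm) l (le_of_max_le_left hl) j).le
    rw [dist_eq_norm]
    exact lt_of_pow_lt_pow_left₀ 2 hε.le (key.trans_lt hη)
  obtain ⟨w, hw⟩ := cauchySeq_tendsto_of_complete hCS
  exact ⟨w, σ, hσ, hw⟩
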